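/- Let $\zeta$ be the Riemann zeta function, and for $s\in\mathbb C$ such that $\zeta$ has neither a zero nor a pole on the horizontal ray $\{s+x: x\ge 0\}$ let $\arg\zeta(s)$ be the branch of the argument obtained by continuous variation along this ray, with $\arg\zeta(s+x)\to 0$ as $x\to+\infty$ (so $\arg\zeta(x)=0$ for real $x>1$, and $\arg\zeta(b+i\varepsilon)\to-\pi$ as $\varepsilon\to 0^+$ when $1/2\le b<1$). Let $a,b$ be real with $a>0$ and $1/2\le b<1$. Then the integrals below converge absolutely (for fixed $b$, $\arg\zeta(b+it)$ is undefined for at most countably many $t>0$), and the following hold. (i) If $a(1-b)\le\pi$, the equality $$\int_0^\infty e^{-at}\ln|\zeta(b+it)|\,dt-\int_0^\infty \sin(ax)\ln|\zeta(b+x)|\,dx+\frac{\pi}{a}\sin(a(1-b))=0\qquad(6)$$ holds if and only if $\zeta$ has no zeros with $\operatorname{Re}s>b$. (ii) If $a(1-b)\le 2\pi$, the equality $$\int_0^\infty e^{-at}\arg\zeta(b+it)\,dt+\int_0^\infty \cos(ax)\ln|\zeta(b+x)|\,dx+\frac{\pi}{a}\bigl(1-\cos(a(1-b))\bigr)=0\qquad(7)$$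 holds if and only if $\zeta$ has no zeros with $\operatorname{Re}s>b$. For $b=1/2$ each of (6) (with $0<a\le 2\pi$) and (7) (with $0<a\le 4\pi$) is equivalent to the Riemann hypothesis. In particular, each of the following two equalities is equivalent to the Riemann hypothesis: $$\int_0^\infty e^{-2\pi t}\ln|\zeta(1/2+it)|\,dt-\int_0^\infty \sin(2\pi x)\ln|\zeta(1/2+x)|\,dx=0\qquad(6a)$$ $$\int_0^\infty e^{-\pi t}\arg\zeta(1/2+it)\,dt+\int_0^\infty \cos(\pi x)\ln|\zeta(1/2+x)|\,dx+1=0\qquad(7a)$$ -/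

import Mathlib

open Set Filter Topology MeasureTheory

noncomputable section

/-- `θ` is a continuous determination of the argument of `ζ` along the horizontal ray
`{s + x : x ≥ 0}`, on which `ζ` has no zero, and it is normalized to tend to `0` at the right end
of the ray (where `ζ → 1`). -/
def IsZetaArgOnRay (s : ℂ) (θ : ℝ → ℝ) : Prop :=
  ContinuousOn θ (Ici 0) ∧
  (∀ x : ℝ, 0 ≤ x → riemannZeta (s + x) ≠ 0 ∧
    riemannZeta (s + x) = ‖riemannZeta (s + x)‖ * Complex.exp (θ x * Complex.I)) ∧
  Tendsto θ atTop (𝓝 0)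

/-- The determination in `IsZetaArgOnRay` is unique. -/
theorem IsZetaArgOnRay.unique {s : ℂ} {θ₁ θ₂ : ℝ → ℝ} (h₁ : IsZetaArgOnRay s θ₁)
    (h₂ : IsZetaArgOnRay s θ₂) {x : ℝ} (hx : 0 ≤ x) : θ₁ x = θ₂ x := by
  have key : ∀ y : ℝ, 0 ≤ y → ∃ n : ℤ, θ₁ y - θ₂ y = n * (2 * Real.pi) := by
    intro y hy
    obtain ⟨hne, e₁⟩ := h₁.2.1 y hy
    obtain ⟨-, e₂⟩ := h₂.2.1 y hy
    have hn : ((‖riemannZeta (s + y)‖ : ℝ) : ℂ) ≠ 0 := by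
      exact_mod_cast (norm_pos_iff.mpr hne).ne'
    have e : Complex.exp (θ₁ y * Complex.I) = Complex.exp (θ₂ y * Complex.I) :=
      mul_left_cancel₀ hn (e₁.symm.trans e₂)
    obtain ⟨n, hn⟩ := Complex.exp_eq_exp_iff_exists_int.mp e
    refine ⟨n, ?_⟩
    have := congrArg Complex.im hn
    simp at this
    linarith
  have hcont : ContinuousOn (fun y => θ₁ y - θ₂ y) (Ici 0) := h₁.1.sub h₂.1
  have hlim : Tendsto (fun y => θ₁ y - θ₂ y) atTop (𝓝 0) := by
    simpa using h₁.2.2.sub h₂.2.2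
  have hpi := Real.pi_pos
  obtain ⟨N, hN⟩ := (Metric.tendsto_atTop.mp hlim) 1 one_pos
  set M : ℝ := max N x with hM
  have hxM : x ≤ M := le_max_right N x
  have hM0 : 0 ≤ M := hx.trans hxM
  have hzero : θ₁ M - θ₂ M = 0 := by
    obtain ⟨n, hn⟩ := key M hM0
    have hb := hN M (le_max_left _ _)
    rw [Real.dist_eq, sub_zero, hn, abs_mul, abs_of_pos (by positivity : 0 < 2 * Real.pi)] at hb
    have h3 := Real.pi_gt_three
    have : |(n : ℝ)| < 1 := by
      by_contra hc
      push Not at hc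
      nlinarith
    have hn0 : n = 0 := by
      rw [← Int.abs_lt_one_iff]
      exact_mod_cast this
    rw [hn, hn0]
    simp
  by_contra hne
  have hx' : θ₁ x - θ₂ x ≠ 0 := sub_ne_zero.mpr hne
  have hsub : Icc x M ⊆ Ici (0 : ℝ) := fun y hy => hx.trans hy.1
  have hivt : uIcc (θ₁ x - θ₂ x) (θ₁ M - θ₂ M) ⊆ (fun y => θ₁ y - θ₂ y) '' uIcc x M :=
    intermediate_value_uIcc (by rw [uIcc_of_le hxM]; exact hcont.mono hsub)
  rw [hzero, uIcc_of_le hxM] at hivt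
  obtain ⟨k, hk⟩ := key x hx
  have hk0 : k ≠ 0 := by
    rintro rfl
    simp at hk
    exact hx' hk
  have hk1 : (1 : ℝ) ≤ |(k : ℝ)| := by exact_mod_cast Int.one_le_abs hk0
  have hmem : ∀ d : ℝ, d ∈ uIcc (θ₁ x - θ₂ x) 0 → ∃ n : ℤ, d = n * (2 * Real.pi) := by
    intro d hd
    obtain ⟨y, hy, rfl⟩ := hivt hd
    exact key y (hsub hy)
  obtain ⟨n, hn⟩ : ∃ n : ℤ, (θ₁ x - θ₂ x) / (2 * k) = n * (2 * Real.pi) := by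
    have hkk : (k : ℝ) ≠ 0 := by exact_mod_cast hk0
    have hval : (θ₁ x - θ₂ x) / (2 * k) = Real.pi := by rw [hk]; field_simp
    rcases lt_or_gt_of_ne hk0 with hneg | hpos
    · obtain ⟨n, hn⟩ := hmem (-Real.pi) (by
        have : (k : ℝ) ≤ -1 := by exact_mod_cast Int.le_sub_one_of_lt hneg
        rw [mem_uIcc]; left; constructor <;> nlinarith)
      exact ⟨-n, by rw [hval]; push_cast; linarith⟩
    · obtain ⟨n, hn⟩ := hmem Real.pi (by
        have : (1 : ℝ) ≤ k := by exact_mod_cast hpos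
        rw [mem_uIcc]; right; constructor <;> nlinarith)
      exact ⟨n, by rw [hval]; exact hn⟩
  have hkk : (k : ℝ) ≠ 0 := by exact_mod_cast hk0
  have hval : (θ₁ x - θ₂ x) / (2 * k) = Real.pi := by rw [hk]; field_simp
  rw [hval] at hn
  have h2 : (1 : ℝ) = 2 * n := by
    have : Real.pi * 1 = Real.pi * (2 * n) := by linarith
    exact mul_left_cancel₀ hpi.ne' this
  have h3 : (1 : ℤ) = 2 * n := by exact_mod_cast h2
  omega

open Classical in
/-- The branch `arg ζ(s)` obtained by continuous variation along the horizontal ray from `+∞` to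
`s`, starting with the value `0`. It is `0` on real `s > 1`. The value `0` is put in where the
branch is undefined, that is where the ray from `s` to the right meets a zero or the pole of `ζ`:
for `s = b + it`, `t > 0`, `b` fixed, this concerns only countably many `t`. -/
def zetaArg (s : ℂ) : ℝ :=
  if h : ∃ θ : ℝ → ℝ, IsZetaArgOnRay s θ then h.choose 0 else 0

theorem zetaArg_eq {s : ℂ} {θ : ℝ → ℝ} (h : IsZetaArgOnRay s θ) : zetaArg s = θ 0 := by
  have hex : ∃ θ : ℝ → ℝ, IsZetaArgOnRay s θ := ⟨θ, h⟩
  rw [zetaArg, dif_pos hex]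
  exact hex.choose_spec.unique h le_rfl

/-- `∫₀^∞ e^{-at} ln|ζ(b+it)| dt - ∫₀^∞ sin(ax) ln|ζ(b+x)| dx + (π/a) sin(a(1-b)) = 0`. -/
def LogModulusEquality (a b : ℝ) : Prop :=
  (∫ t in Ioi (0 : ℝ), Real.exp (-a * t) * Real.log ‖riemannZeta (b + t * Complex.I)‖)
    - (∫ x in Ioi (0 : ℝ), Real.sin (a * x) * Real.log ‖riemannZeta (b + x)‖)
    + Real.pi / a * Real.sin (a * (1 - b)) = 0

/-- `∫₀^∞ e^{-at} arg ζ(b+it) dt + ∫₀^∞ cos(ax) ln|ζ(b+x)| dx + (π/a) (1 - cos(a(1-b))) = 0`. -/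
def ArgumentEquality (a b : ℝ) : Prop :=
  (∫ t in Ioi (0 : ℝ), Real.exp (-a * t) * zetaArg (b + t * Complex.I))
    + (∫ x in Ioi (0 : ℝ), Real.cos (a * x) * Real.log ‖riemannZeta (b + x)‖)
    + Real.pi / a * (1 - Real.cos (a * (1 - b))) = 0

end

/-! Both equalities are the real and imaginary parts of one contour identity: integrate `exp (i a z)
log ζ(b + z)` around a large rectangle in the first quadrant and let it grow. The bottom edge gives
`log |ζ(b + x)|`, with an extra `-π i` for `x < 1 - b` because the path passes above the pole. The
left edge gives `i` times the integral of `exp (-a t) log ζ(b + it)`. The top and right edges vanish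
in the limit.

The branch fixed by continuation from the right has horizontal cuts, each running to the left from a
zero. A zero `ρ = β + iγ` with `β > b`, `γ > 0` therefore contributes a jump `2π i` along its cut as
far as the left edge. This integrates to `zeroJump`, whose real part is `(2π/a) exp (-aγ) (1 - cos
(a(β - b)))` and whose imaginary part is `-(2π/a) exp (-aγ) sin (a(β - b))`. As `0 < β - b < 1 - b`,
the real part is positive when `a(1 - b) ≤ 2π`, and the imaginary part is negative when `a(1 - b) ≤
π`. Contributions of one sign cannot cancel, so the real (or imaginary) part of `rayDifference`
vanishes exactly when no zero lies to the right of the line. Zeros below the axis are reflected by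
conjugation, and there are none on the positive real axis.

The analytic work is in controlling `log ζ` on the edges. A bound `exp (C (1 + |Im s|))` in a strip
(`exists_norm_riemannZeta₁_le_exp`) yields, by dividing out zeros and by Borel–Carathéodory, an
explicit local formula: a holomorphic part plus linearly many principal logarithms
(`ZetaLocalLog.exists_branch_bound`). The formula gives absolute convergence and the decay of the
top edge. It also reduces the contour integral to that of a single `exp (i a z) log (z - w)`, which
is `rectIntegral_expLog`. The pieces meet in `exists_rect_identity`, `exists_tendsto_rayDifference`
and `apply_rayDifference_eq_zero_iff`. -/

noncomputable section

/-! ### A series for `(s - 1) ζ(s)` in `Re s > 0`, and its positivity on the real axis -/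

/-- The `n`-th term of a series for `(s - 1) ζ(s) - 1` that converges for `Re s > 0`. -/
def zetaDiffTerm (n : ℕ) (s : ℂ) : ℂ :=
  (s - 1) * ((n + 1 : ℝ) : ℂ) ^ (-s) + ((n + 2 : ℝ) : ℂ) ^ (1 - s) - ((n + 1 : ℝ) : ℂ) ^ (1 - s)

lemma norm_cpow_neg_sub_le {y x : ℝ} (hy : 0 < y) (hx : x ∈ Icc y (y + 1)) {s : ℂ}
    (hs : 0 ≤ s.re) :
    ‖((x : ℂ) ^ (-s) - (y : ℂ) ^ (-s))‖ ≤ ‖s‖ * y ^ (-s.re - 1) := by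
  have hd : ∀ u ∈ Icc y (y + 1), HasDerivWithinAt (fun u : ℝ => (u : ℂ) ^ (-s))
      (-s * (u : ℂ) ^ (-s - 1)) (Icc y (y + 1)) u := by
    intro u hu
    have hu0 : 0 < u := hy.trans_le hu.1
    by_cases h0 : s = 0
    · subst h0; simpa using hasDerivWithinAt_const u _ (1 : ℂ)
    exact (hasDerivAt_ofReal_cpow_const hu0.ne' (by simpa using h0)).hasDerivWithinAt
  have hb : ∀ u ∈ Icc y (y + 1), ‖-s * (u : ℂ) ^ (-s - 1)‖ ≤ ‖s‖ * y ^ (-s.re - 1) := by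
    intro u hu
    have hu0 : 0 < u := hy.trans_le hu.1
    rw [norm_mul, norm_neg, Complex.norm_cpow_eq_rpow_re_of_pos hu0]
    gcongr ‖s‖ * ?_
    simpa using Real.rpow_le_rpow_of_nonpos hy hu.1 (by linarith : -s.re - 1 ≤ 0)
  have := (convex_Icc y (y + 1)).norm_image_sub_le_of_norm_hasDerivWithin_le hd hb
    (left_mem_Icc.2 (by linarith)) hx
  refine this.trans ?_
  have h1 : ‖x - y‖ ≤ 1 := by
    rw [Real.norm_eq_abs, abs_le]; constructor <;> linarith [hx.1, hx.2]
  have : 0 ≤ ‖s‖ * y ^ (-s.re - 1) := by positivity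
  nlinarith

/-- The term is the increment over `[y, y + 1]`, `y = n + 1`, of `u ↦ (s - 1) y ^ (-s) u + u ^ (1 -
s)`. Its derivative `(1 - s) (u ^ (-s) - y ^ (-s))` is itself a difference, which gains the extra
power of `y` that makes the series converge for all `Re s > 0`. -/
lemma norm_zetaDiffTerm_le (n : ℕ) {s : ℂ} (hs : 0 ≤ s.re) :
    ‖zetaDiffTerm n s‖ ≤ ‖s - 1‖ * ‖s‖ * (n + 1 : ℝ) ^ (-s.re - 1) := by
  set y : ℝ := n + 1
  have hy : 0 < y := by positivity
  by_cases h1 : s = 1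
  · simp [zetaDiffTerm, h1]
  have hd : ∀ u ∈ Icc y (y + 1), HasDerivWithinAt
      (fun u : ℝ => (s - 1) * (y : ℂ) ^ (-s) * u + (u : ℂ) ^ (1 - s))
      ((s - 1) * (y : ℂ) ^ (-s) + (1 - s) * (u : ℂ) ^ (-s)) (Icc y (y + 1)) u := by
    intro u hu
    have hu0 : 0 < u := hy.trans_le hu.1
    have e1 : HasDerivAt (fun u : ℝ => (u : ℂ) ^ (1 - s)) ((1 - s) * (u : ℂ) ^ (1 - s - 1)) u :=
      hasDerivAt_ofReal_cpow_const hu0.ne' (sub_ne_zero.2 (Ne.symm h1))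
    rw [show 1 - s - 1 = -s by ring] at e1
    have e2 : HasDerivAt (fun u : ℝ => (s - 1) * (y : ℂ) ^ (-s) * (u : ℂ))
        ((s - 1) * (y : ℂ) ^ (-s)) u := by
      simpa using (Complex.ofRealCLM.hasDerivAt (x := u)).const_mul ((s - 1) * (y : ℂ) ^ (-s))
    exact (e2.add e1).hasDerivWithinAt
  have hb : ∀ u ∈ Icc y (y + 1), ‖(s - 1) * (y : ℂ) ^ (-s) + (1 - s) * (u : ℂ) ^ (-s)‖ ≤
      ‖s - 1‖ * ‖s‖ * y ^ (-s.re - 1) := by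
    intro u hu
    rw [show (s - 1) * (y : ℂ) ^ (-s) + (1 - s) * (u : ℂ) ^ (-s) =
      (1 - s) * ((u : ℂ) ^ (-s) - (y : ℂ) ^ (-s)) by ring, norm_mul, norm_sub_rev, mul_assoc]
    gcongr
    exact norm_cpow_neg_sub_le hy hu hs
  have := (convex_Icc y (y + 1)).norm_image_sub_le_of_norm_hasDerivWithin_le hd hb
    (left_mem_Icc.2 (by linarith)) (right_mem_Icc.2 (by linarith))
  convert this using 1
  · congr 1
    simp only [zetaDiffTerm, y]
    push_cast
    rw [show (n : ℂ) + 1 + 1 = n + 2 by ring]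
    ring
  · simp

lemma summable_succ_rpow {σ : ℝ} (hσ : 0 < σ) :
    Summable fun n : ℕ => (n + 1 : ℝ) ^ (-σ - 1) := by
  have := (summable_nat_add_iff 1).2 (Real.summable_nat_rpow.2 (by linarith : -σ - 1 < -1))
  simpa using this

lemma summable_zetaDiffTerm {s : ℂ} (hs : 0 < s.re) : Summable fun n => zetaDiffTerm n s :=
  .of_norm_bounded ((summable_succ_rpow hs).mul_left _) fun n => norm_zetaDiffTerm_le n hs.le

lemma differentiable_zetaDiffTerm (n : ℕ) : Differentiable ℂ (zetaDiffTerm n) := by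
  have h1 : ((n + 1 : ℝ) : ℂ) ≠ 0 := by exact_mod_cast (by positivity : (n + 1 : ℝ) ≠ 0)
  have h2 : ((n + 2 : ℝ) : ℂ) ≠ 0 := by exact_mod_cast (by positivity : (n + 2 : ℝ) ≠ 0)
  intro s
  have e1 : DifferentiableAt ℂ (fun s : ℂ => ((n + 1 : ℝ) : ℂ) ^ (-s)) s :=
    (differentiableAt_id.neg).const_cpow (Or.inl h1)
  have e2 : DifferentiableAt ℂ (fun s : ℂ => ((n + 2 : ℝ) : ℂ) ^ (1 - s)) s :=
    ((differentiableAt_const _).sub differentiableAt_id).const_cpow (Or.inl h2)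
  have e3 : DifferentiableAt ℂ (fun s : ℂ => ((n + 1 : ℝ) : ℂ) ^ (1 - s)) s :=
    ((differentiableAt_const _).sub differentiableAt_id).const_cpow (Or.inl h1)
  exact (((differentiableAt_id.sub (differentiableAt_const _)).mul e1).add e2).sub e3

lemma differentiableOn_tsum_zetaDiffTerm :
    DifferentiableOn ℂ (fun s => ∑' n, zetaDiffTerm n s) {s | 0 < s.re} := by
  intro s hs
  rw [mem_ofPred_eq] at hs
  set U : Set ℂ := {z | s.re / 2 < z.re} ∩ Metric.ball s 1
  have hU : IsOpen U := (isOpen_lt continuous_const Complex.continuous_re).inter Metric.isOpen_ball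
  have hsU : s ∈ U := ⟨by simp only [mem_ofPred_eq]; linarith, Metric.mem_ball_self one_pos⟩
  have hdiff : DifferentiableOn ℂ (fun s => ∑' n, zetaDiffTerm n s) U := by
    refine Complex.differentiableOn_tsum_of_summable_norm
      (u := fun n : ℕ => (‖s‖ + 2) * (‖s‖ + 1) * (n + 1 : ℝ) ^ (-(s.re / 2) - 1))
      ((summable_succ_rpow (by linarith)).mul_left _)
      (fun n => (differentiable_zetaDiffTerm n).differentiableOn) hU ?_
    rintro n z ⟨hz1, hz2⟩
    simp only [mem_ofPred_eq] at hz1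
    refine (norm_zetaDiffTerm_le n (by linarith)).trans ?_
    have hz : ‖z‖ ≤ ‖s‖ + 1 := by
      have := norm_le_norm_add_norm_sub' z s
      rw [Metric.mem_ball, dist_eq_norm] at hz2
      linarith
    have hz' : ‖z - 1‖ ≤ ‖s‖ + 2 := (norm_sub_le _ _).trans (by simp; linarith)
    gcongr
    simp
  exact (hdiff.differentiableAt (hU.mem_nhds hsU)).differentiableWithinAt

lemma hasSum_telescope_cpow {s : ℂ} (hs : 1 < s.re) :
    HasSum (fun n : ℕ => ((n + 2 : ℝ) : ℂ) ^ (1 - s) - ((n + 1 : ℝ) : ℂ) ^ (1 - s)) (-1) := by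
  have hlim : Tendsto (fun n : ℕ => ((n + 1 : ℝ) : ℂ) ^ (1 - s)) atTop (𝓝 0) := by
    rw [tendsto_zero_iff_norm_tendsto_zero]
    have h1 : Tendsto (fun n : ℕ => (n + 1 : ℝ)) atTop atTop :=
      tendsto_atTop_add_const_right _ _ tendsto_natCast_atTop_atTop
    have := (tendsto_rpow_neg_atTop (by linarith : 0 < s.re - 1)).comp h1
    refine this.congr fun n => ?_
    rw [Complex.norm_cpow_eq_rpow_re_of_pos (by positivity)]
    simp
  have hS : Summable fun n : ℕ =>
      ((n + 2 : ℝ) : ℂ) ^ (1 - s) - ((n + 1 : ℝ) : ℂ) ^ (1 - s) := by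
    have h1 := summable_zetaDiffTerm (by linarith : 0 < s.re)
    have h2 : Summable fun n : ℕ => (s - 1) * ((n + 1 : ℝ) : ℂ) ^ (-s) := by
      refine Summable.mul_left _ (.of_norm ?_)
      refine ((summable_nat_add_iff 1).2
        (Real.summable_nat_rpow.2 (by linarith : -s.re < -1))).congr fun n => ?_
      rw [Complex.norm_cpow_eq_rpow_re_of_pos (by positivity)]
      simp
    refine (h1.sub h2).congr fun n => ?_
    simp only [zetaDiffTerm]; ring
  refine (hS.hasSum_iff_tendsto_nat).2 ?_
  have key : ∀ N : ℕ, ∑ n ∈ Finset.range N,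
      (((n + 2 : ℝ) : ℂ) ^ (1 - s) - ((n + 1 : ℝ) : ℂ) ^ (1 - s)) =
      ((N + 1 : ℝ) : ℂ) ^ (1 - s) - 1 := by
    intro N
    induction N with
    | zero => simp
    | succ N ih =>
      rw [Finset.sum_range_succ, ih]
      push_cast
      rw [show (N : ℂ) + 1 + 1 = N + 2 by ring]
      ring
  simp_rw [key]
  simpa using hlim.sub_const 1

lemma riemannZeta₁_eq_mul {s : ℂ} (hs : s ≠ 1) : riemannZeta₁ s = (s - 1) * riemannZeta s := by
  rw [riemannZeta_eq_inv_sub_mul hs, mul_inv_cancel_left₀ (sub_ne_zero.2 hs)]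

/-- Identity theorem on the half plane: for `Re s > 1` the series splits into `(s - 1)` times the
Dirichlet series and a telescoping part with sum `-1`. -/
lemma riemannZeta₁_eq_one_add_tsum {s : ℂ} (hs : 0 < s.re) :
    riemannZeta₁ s = 1 + ∑' n, zetaDiffTerm n s := by
  have hopen : IsOpen {s : ℂ | 0 < s.re} := isOpen_lt continuous_const Complex.continuous_re
  have h1 : AnalyticOnNhd ℂ riemannZeta₁ {s | 0 < s.re} :=
    differentiable_riemannZeta₁.differentiableOn.analyticOnNhd hopen
  have h2 : AnalyticOnNhd ℂ (fun s => 1 + ∑' n, zetaDiffTerm n s) {s | 0 < s.re} :=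
    (differentiableOn_tsum_zetaDiffTerm.const_add 1).analyticOnNhd hopen
  refine h1.eqOn_of_preconnected_of_eventuallyEq h2
    (convex_halfSpace_re_gt 0).isPreconnected (z₀ := 2) (by simp) ?_ hs
  refine eventuallyEq_of_mem
    ((isOpen_lt continuous_const Complex.continuous_re).mem_nhds (by norm_num : 1 < (2 : ℂ).re)) ?_
  intro z (hz : 1 < z.re)
  have hz1 : z ≠ 1 := by rintro rfl; simp at hz
  have hs2 : Summable fun n : ℕ => (1 : ℂ) / (n + 1 : ℂ) ^ z := by
    have := (summable_nat_add_iff 1).2 (Complex.summable_one_div_nat_cpow.2 hz)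
    simpa using this
  have e : ∀ n, zetaDiffTerm n z = (z - 1) * (1 / (n + 1 : ℂ) ^ z) +
      (((n + 2 : ℝ) : ℂ) ^ (1 - z) - ((n + 1 : ℝ) : ℂ) ^ (1 - z)) := by
    intro n
    simp only [zetaDiffTerm, Complex.cpow_neg]
    push_cast
    ring
  simp only []
  rw [riemannZeta₁_eq_mul hz1, zeta_eq_tsum_one_div_nat_add_one_cpow hz, tsum_congr e,
    (hs2.mul_left _).tsum_add (hasSum_telescope_cpow hz).summable,
    (hasSum_telescope_cpow hz).tsum_eq, tsum_mul_left]
  ring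

lemma rpow_one_sub_sub_ge {σ y : ℝ} (h0 : 0 < σ) (h1 : σ < 1) (hy : 0 < y) :
    (1 - σ) * (y + 1) ^ (-σ) ≤ (y + 1) ^ (1 - σ) - y ^ (1 - σ) := by
  have hd : ∀ x ∈ Ioo y (y + 1), HasDerivAt (fun u : ℝ => u ^ (1 - σ)) ((1 - σ) * x ^ (-σ)) x := by
    intro x hx
    have := Real.hasDerivAt_rpow_const (x := x) (p := 1 - σ) (Or.inl (hy.trans hx.1).ne')
    rwa [show 1 - σ - 1 = -σ by ring] at this
  obtain ⟨c, hc, hc'⟩ := exists_hasDerivAt_eq_slope (fun u : ℝ => u ^ (1 - σ))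
    (fun x => (1 - σ) * x ^ (-σ)) (by linarith : y < y + 1)
    (fun x hx => (Real.continuousAt_rpow_const x _
      (Or.inl (hy.trans_le hx.1).ne')).continuousWithinAt) hd
  simp only [add_sub_cancel_left, div_one] at hc'
  rw [← hc']
  have := Real.rpow_le_rpow_of_nonpos (hy.trans hc.1) hc.2.le (by linarith : -σ ≤ 0)
  have h1' : 0 ≤ 1 - σ := by linarith
  gcongr

/-- By the mean value bound each term is at least `-(1 - σ)((n + 1) ^ (-σ) - (n + 2) ^ (-σ))`. This
telescopes, so the series is at least `-(1 - σ)` and the value at least `σ`. -/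
lemma riemannZeta₁_ofReal_pos {σ : ℝ} (h0 : 0 < σ) (h1 : σ < 1) :
    0 < (riemannZeta₁ σ).re := by
  have hs : 0 < (σ : ℂ).re := by simpa
  have hre : ∀ n, (zetaDiffTerm n σ).re =
      (σ - 1) * (n + 1 : ℝ) ^ (-σ) + (n + 2 : ℝ) ^ (1 - σ) - (n + 1 : ℝ) ^ (1 - σ) := by
    intro n
    have : zetaDiffTerm n σ = (((σ - 1) * (n + 1 : ℝ) ^ (-σ) + (n + 2 : ℝ) ^ (1 - σ) -
        (n + 1 : ℝ) ^ (1 - σ) : ℝ) : ℂ) := by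
      simp only [zetaDiffTerm]
      rw [show (-(σ : ℂ)) = ((-σ : ℝ) : ℂ) by push_cast; rfl,
        show (1 - (σ : ℂ)) = ((1 - σ : ℝ) : ℂ) by push_cast; rfl,
        ← Complex.ofReal_cpow (by positivity), ← Complex.ofReal_cpow (by positivity),
        ← Complex.ofReal_cpow (by positivity)]
      norm_cast
    rw [this, Complex.ofReal_re]
  have hsum : HasSum (fun n => (zetaDiffTerm n σ).re) (∑' n, zetaDiffTerm n σ).re :=
    Complex.hasSum_re (summable_zetaDiffTerm hs).hasSum
  have hpart : ∀ N : ℕ, -(1 - σ) ≤ ∑ n ∈ Finset.range N, (zetaDiffTerm n σ).re := by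
    intro N
    have key : -(1 - σ) * (1 - (N + 1 : ℝ) ^ (-σ)) ≤
        ∑ n ∈ Finset.range N, (zetaDiffTerm n σ).re := by
      induction N with
      | zero => simp
      | succ N ih =>
        rw [Finset.sum_range_succ, hre]
        have := rpow_one_sub_sub_ge h0 h1 (by positivity : (0 : ℝ) < N + 1)
        rw [show (N : ℝ) + 1 + 1 = N + 2 by ring] at this
        push_cast
        rw [show (N : ℝ) + 1 + 1 = N + 2 by ring]
        linarith
    have : 0 ≤ (N + 1 : ℝ) ^ (-σ) := by positivity
    nlinarith
  have := ge_of_tendsto' hsum.tendsto_sum_nat hpart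
  rw [riemannZeta₁_eq_one_add_tsum hs]
  simp only [Complex.add_re, Complex.one_re]
  linarith

lemma riemannZeta₁_conj (s : ℂ) :
    riemannZeta₁ ((starRingEnd ℂ) s) = (starRingEnd ℂ) (riemannZeta₁ s) := by
  by_cases h : s = 1
  · simp [h]
  · rw [riemannZeta₁_eq_mul h,
      riemannZeta₁_eq_mul ((map_ne_one_iff _ (starRingEnd ℂ).injective).mpr h), riemannZeta_conj]
    simp

lemma riemannZeta₁_ofReal_im (σ : ℝ) : (riemannZeta₁ σ).im = 0 := by
  rw [← Complex.conj_eq_iff_im, ← riemannZeta₁_conj, Complex.conj_ofReal]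

lemma riemannZeta₁_ne_zero_iff (s : ℂ) : riemannZeta₁ s ≠ 0 ↔ riemannZeta s ≠ 0 := by
  by_cases h : s = 1
  · simp [h, riemannZeta_one_ne_zero]
  · rw [riemannZeta₁_eq_mul h]
    simp [sub_ne_zero.2 h]

lemma riemannZeta₁_ne_zero_of_one_le_re {s : ℂ} (hs : 1 ≤ s.re) : riemannZeta₁ s ≠ 0 :=
  (riemannZeta₁_ne_zero_iff s).2 (riemannZeta_ne_zero_of_one_le_re hs)

lemma riemannZeta₁_ofReal_ne_zero {σ : ℝ} (hσ : 0 < σ) : riemannZeta₁ σ ≠ 0 := by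
  rcases lt_or_ge σ 1 with h | h
  · intro h0
    have := riemannZeta₁_ofReal_pos hσ h
    simp [h0] at this
  · exact riemannZeta₁_ne_zero_of_one_le_re (by simpa)

/-! ### The half plane `Re s ≥ 2` -/

/-- `ζ(σ) - 1` decays exponentially. -/
lemma norm_riemannZeta_sub_one_le {s : ℂ} (hs : 2 ≤ s.re) :
    ‖riemannZeta s - 1‖ ≤ 2 ^ (2 - s.re) * (2 / 3) := by
  have hs1 : 1 < s.re := by linarith
  have hsum : Summable fun n : ℕ => 1 / (n : ℂ) ^ s := Complex.summable_one_div_nat_cpow.2 hs1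
  have e : riemannZeta s - 1 = ∑' n : ℕ, 1 / ((n + 2 : ℕ) : ℂ) ^ s := by
    rw [zeta_eq_tsum_one_div_nat_cpow hs1, ← hsum.sum_add_tsum_nat_add 2]
    have : s ≠ 0 := by rintro rfl; simp at hs; linarith
    simp [Finset.sum_range_succ, this]
  have hz2 : HasSum (fun n : ℕ => 1 / ((n + 2 : ℕ) : ℝ) ^ 2) (Real.pi ^ 2 / 6 - 1) := by
    have := (hasSum_nat_add_iff' 2).2 hasSum_zeta_two
    simpa [Finset.sum_range_succ] using this
  rw [e]
  -- Compare with `ζ(2) - 1 = π² / 6 - 1`, which is below `2 / 3` because `π² < 10`.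
  have hle : ∀ n : ℕ, ‖1 / ((n + 2 : ℕ) : ℂ) ^ s‖ ≤
      2 ^ (2 - s.re) * (1 / ((n + 2 : ℕ) : ℝ) ^ 2) := by
    intro n
    have hpos : (0 : ℝ) < ((n + 2 : ℕ) : ℝ) := by positivity
    have h2 : (2 : ℝ) ≤ ((n + 2 : ℕ) : ℝ) := by push_cast; linarith [n.cast_nonneg (α := ℝ)]
    rw [norm_div, norm_one, ← Complex.ofReal_natCast, Complex.norm_cpow_eq_rpow_re_of_pos hpos]
    have : 1 / ((n + 2 : ℕ) : ℝ) ^ s.re =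
        ((n + 2 : ℕ) : ℝ) ^ (2 - s.re) * (1 / ((n + 2 : ℕ) : ℝ) ^ 2) := by
      rw [Real.rpow_sub hpos, Real.rpow_two]
      field_simp
    rw [this]
    exact mul_le_mul_of_nonneg_right
      (Real.rpow_le_rpow_of_nonpos (by norm_num) h2 (by linarith)) (by positivity)
  have hS : Summable fun n : ℕ => ‖1 / ((n + 2 : ℕ) : ℂ) ^ s‖ :=
    .of_nonneg_of_le (fun _ => norm_nonneg _) hle (hz2.summable.mul_left _)
  refine (norm_tsum_le_tsum_norm hS).trans ((hS.tsum_le_tsum hle (hz2.summable.mul_left _)).trans ?_)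
  rw [tsum_mul_left, hz2.tsum_eq]
  have : Real.pi ^ 2 < 10 := by nlinarith [Real.pi_lt_d2, Real.pi_pos]
  gcongr
  linarith

lemma norm_riemannZeta_sub_one_lt {s : ℂ} (hs : 2 ≤ s.re) : ‖riemannZeta s - 1‖ ≤ 2 / 3 := by
  refine (norm_riemannZeta_sub_one_le hs).trans ?_
  have := Real.rpow_le_one_of_one_le_of_nonpos (by norm_num : (1 : ℝ) ≤ 2)
    (by linarith : 2 - s.re ≤ 0)
  linarith

lemma riemannZeta_mem_slitPlane {s : ℂ} (hs : 2 ≤ s.re) : riemannZeta s ∈ Complex.slitPlane := by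
  have h := norm_riemannZeta_sub_one_lt hs
  refine Or.inl ?_
  have := (abs_le.1 ((Complex.abs_re_le_norm _).trans h)).1
  simp only [Complex.sub_re, Complex.one_re] at this
  linarith

/-! ### Growth of `(s - 1) ζ(s)` in a vertical strip -/

lemma norm_Gamma_le_re {s : ℂ} (hs : 0 < s.re) : ‖Complex.Gamma s‖ ≤ Real.Gamma s.re := by
  rw [Complex.Gamma_eq_integral hs, Real.Gamma_eq_integral hs, Complex.GammaIntegral]
  refine (norm_integral_le_integral_norm _).trans (le_of_eq ?_)
  refine setIntegral_congr_fun measurableSet_Ioi fun x hx => ?_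
  rw [norm_mul, Complex.norm_cpow_eq_rpow_re_of_pos hx, Complex.norm_real,
    Real.norm_of_nonneg (Real.exp_pos _).le]
  simp

lemma norm_cos_le_exp (z : ℂ) : ‖Complex.cos z‖ ≤ Real.exp |z.im| := by
  rw [Complex.cos, norm_div]
  have h1 : ‖Complex.exp (z * Complex.I)‖ ≤ Real.exp |z.im| := by
    rw [Complex.norm_exp]; simp; exact neg_le_abs _
  have h2 : ‖Complex.exp (-z * Complex.I)‖ ≤ Real.exp |z.im| := by
    rw [Complex.norm_exp]; simp; exact le_abs_self _
  have := norm_add_le (Complex.exp (z * Complex.I)) (Complex.exp (-z * Complex.I))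
  simp only [Complex.norm_ofNat]
  linarith

lemma exists_norm_riemannZeta₁_le_of_half_le_re :
    ∃ K : ℝ, 0 ≤ K ∧ ∀ s : ℂ, 1 / 2 ≤ s.re → ‖riemannZeta₁ s‖ ≤ 1 + K * (‖s - 1‖ * ‖s‖) := by
  have hS := summable_succ_rpow (by norm_num : (0 : ℝ) < 1 / 2)
  refine ⟨∑' n : ℕ, (n + 1 : ℝ) ^ (-(1 / 2 : ℝ) - 1), tsum_nonneg fun n => by positivity,
    fun s hs => ?_⟩
  have hs0 : 0 < s.re := by linarith
  rw [riemannZeta₁_eq_one_add_tsum hs0]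
  refine (norm_add_le _ _).trans ?_
  rw [norm_one, mul_comm (tsum _), ← tsum_mul_left]
  gcongr
  refine tsum_of_norm_bounded (hS.mul_left _).hasSum fun n => ?_
  refine (norm_zetaDiffTerm_le n hs0.le).trans ?_
  gcongr
  simp

/-- In a vertical strip, `(s - 1) ζ(s)` grows at most exponentially. -/
lemma exists_norm_riemannZeta₁_le_exp :
    ∃ C : ℝ, 0 ≤ C ∧ ∀ s : ℂ, -7 ≤ s.re → s.re ≤ 11 →
      ‖riemannZeta₁ s‖ ≤ Real.exp (C * (1 + |s.im|)) := by
  -- The strip `-7 ≤ Re s ≤ 11` is what the discs of radius `3 * 3` around `2 + iT` sweep out.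
  obtain ⟨K, hK0, hK⟩ := exists_norm_riemannZeta₁_le_of_half_le_re
  have hcomp : IsCompact (Icc (-7 : ℝ) 11 ×ℂ Icc (-1 : ℝ) 1) := isCompact_Icc.reProdIm isCompact_Icc
  obtain ⟨B, hB⟩ := hcomp.exists_bound_of_continuousOn
    differentiable_riemannZeta₁.continuous.continuousOn
  -- The interval contains `Re (1 - s)` for `-7 ≤ Re s < 1/2`, the range where the functional
  -- equation is needed.
  have hGc : ContinuousOn Real.Gamma (Icc (1 / 2) 8) := fun x hx =>
    (Real.differentiableAt_Gamma fun m => by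
      have : (0 : ℝ) ≤ m := m.cast_nonneg
      have := hx.1
      intro h; linarith).continuousAt.continuousWithinAt
  obtain ⟨G, hG⟩ := isCompact_Icc.exists_bound_of_continuousOn hGc
  have hG0 : 0 ≤ G := (norm_nonneg _).trans (hG 1 (by norm_num))
  have hB0 : 0 ≤ B := (norm_nonneg _).trans (hB 0 (by simp [Complex.mem_reProdIm]))
  have hsz : ∀ s : ℂ, -7 ≤ s.re → s.re ≤ 11 → ‖s‖ ≤ 12 * Real.exp |s.im| ∧
      ‖s - 1‖ ≤ 12 * Real.exp |s.im| := by
    intro s h1 h2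
    have e := Real.add_one_le_exp |s.im|
    have a1 : |s.re| ≤ 11 := abs_le.2 ⟨by linarith, h2⟩
    have a2 : |s.re - 1| ≤ 11 := abs_le.2 ⟨by linarith, by linarith⟩
    have b1 := Complex.norm_le_abs_re_add_abs_im s
    have b2 := Complex.norm_le_abs_re_add_abs_im (s - 1)
    simp only [Complex.sub_re, Complex.one_re, Complex.sub_im, Complex.one_im, sub_zero] at b2
    constructor <;> linarith [abs_nonneg s.im]
  set M : ℝ := B + (1 + K * 144) * (1 + 24 * G)
  have hM1 : 0 < M := by positivity
  have hKG : 0 ≤ (1 + K * 144) * (24 * G) := by positivity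
  -- the half plane `Re s ≥ 1/2`
  have hright : ∀ s : ℂ, 1 / 2 ≤ s.re → s.re ≤ 11 →
      ‖riemannZeta₁ s‖ ≤ (1 + K * 144) * Real.exp (2 * |s.im|) := by
    intro s h1 h2
    obtain ⟨e1, e2⟩ := hsz s (by linarith) h2
    have e3 : Real.exp (2 * |s.im|) = Real.exp |s.im| * Real.exp |s.im| := by
      rw [← Real.exp_add]; ring_nf
    have e4 : 1 ≤ Real.exp (2 * |s.im|) := Real.one_le_exp (by positivity)
    calc ‖riemannZeta₁ s‖ ≤ 1 + K * (‖s - 1‖ * ‖s‖) := hK s h1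
      _ ≤ Real.exp (2 * |s.im|) + K * ((12 * Real.exp |s.im|) * (12 * Real.exp |s.im|)) := by
        gcongr
      _ = _ := by rw [e3]; ring
  refine ⟨max 6 (Real.log M), by positivity, fun s h1 h2 => ?_⟩
  suffices h : ‖riemannZeta₁ s‖ ≤ M * Real.exp (6 * |s.im|) by
    refine h.trans ?_
    rw [mul_add, mul_one, Real.exp_add]
    gcongr
    · rw [← Real.log_le_iff_le_exp hM1]; exact le_max_right _ _
    · exact le_max_left _ _
  have e6 : 1 ≤ Real.exp (6 * |s.im|) := Real.one_le_exp (by positivity)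
  rcases le_or_gt |s.im| 1 with him | him
  · have := hB s ⟨⟨h1, h2⟩, abs_le.1 him⟩
    have hBM : B ≤ M := by simp only [M]; nlinarith
    nlinarith
  rcases le_or_gt (1 / 2) s.re with hre | hre
  · have h26 : Real.exp (2 * |s.im|) ≤ Real.exp (6 * |s.im|) := by
      gcongr; norm_num
    refine (hright s hre h2).trans ?_
    gcongr
    simp only [M]; nlinarith
  -- Functional equation. The assumption `|Im s| > 1` keeps `w` away from the poles of `Γ` and gives
  -- `‖w - 1‖ ≥ 1`, so the bound for `(w - 1) ζ(w)` passes to `ζ(w)`.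
  · set w := 1 - s with hw
    have hwre : w.re = 1 - s.re := by simp [hw]
    have hwim : |w.im| = |s.im| := by simp [hw]
    have hs1 : s ≠ 1 := by rintro rfl; simp at him; linarith
    have hw1 : w ≠ 1 := by intro h; rw [h] at hwim; simp at hwim; linarith
    have hwn : ∀ n : ℕ, w ≠ -n := by
      intro n h; rw [h] at hwim; simp at hwim; linarith
    have hsw : s = 1 - w := by simp [hw]
    have hz : ‖riemannZeta s‖ ≤ 2 * G * Real.exp (2 * |s.im|) *
        ((1 + K * 144) * Real.exp (2 * |s.im|)) := by
      rw [hsw, riemannZeta_one_sub hwn hw1, ← hsw]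
      rw [norm_mul, norm_mul, norm_mul, norm_mul]
      have c1 : ‖(2 * Real.pi : ℂ) ^ (-w)‖ ≤ 1 := by
        have : (2 * Real.pi : ℂ) = ((2 * Real.pi : ℝ) : ℂ) := by push_cast; rfl
        rw [this, Complex.norm_cpow_eq_rpow_re_of_pos (by positivity)]
        refine Real.rpow_le_one_of_one_le_of_nonpos ?_ ?_
        · linarith [Real.pi_gt_three]
        · simp only [Complex.neg_re]; linarith
      have c2 : ‖Complex.Gamma w‖ ≤ G := by
        refine (norm_Gamma_le_re (by linarith)).trans ((le_abs_self _).trans ?_)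
        exact hG _ ⟨by linarith, by linarith⟩
      have c3 : ‖Complex.cos (Real.pi * w / 2)‖ ≤ Real.exp (2 * |s.im|) := by
        refine (norm_cos_le_exp _).trans ?_
        gcongr
        have : (Real.pi * w / 2 : ℂ).im = Real.pi / 2 * w.im := by
          rw [show (Real.pi * w / 2 : ℂ) = ((Real.pi / 2 : ℝ) : ℂ) * w by push_cast; ring]
          simp
        rw [this, abs_mul, hwim, abs_of_pos (by positivity)]
        gcongr
        linarith [Real.pi_lt_four]
      have c4 : ‖riemannZeta w‖ ≤ (1 + K * 144) * Real.exp (2 * |s.im|) := by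
        have := hright w (by linarith) (by linarith)
        rw [hwim] at this
        refine le_trans ?_ this
        rw [riemannZeta₁_eq_mul hw1, norm_mul]
        have hn : 1 ≤ ‖w - 1‖ := by
          refine le_trans ?_ (Complex.abs_im_le_norm _)
          simp only [Complex.sub_im, Complex.one_im, sub_zero]
          linarith
        nlinarith [norm_nonneg (riemannZeta w)]
      simp only [Complex.norm_ofNat]
      calc 2 * ‖(2 * Real.pi : ℂ) ^ (-w)‖ * ‖Complex.Gamma w‖ * ‖Complex.cos (Real.pi * w / 2)‖ *
            ‖riemannZeta w‖
          ≤ 2 * 1 * G * Real.exp (2 * |s.im|) * ((1 + K * 144) * Real.exp (2 * |s.im|)) := by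
            gcongr
        _ = _ := by ring
    rw [riemannZeta₁_eq_mul hs1, norm_mul]
    have e5 : Real.exp (6 * |s.im|) = Real.exp |s.im| * Real.exp |s.im| *
        (Real.exp (2 * |s.im|) * Real.exp (2 * |s.im|)) := by
      rw [← Real.exp_add, ← Real.exp_add, ← Real.exp_add]; ring_nf
    have e7 : 1 ≤ Real.exp |s.im| := Real.one_le_exp (by positivity)
    calc ‖s - 1‖ * ‖riemannZeta s‖ ≤ (12 * Real.exp |s.im|) * (2 * G * Real.exp (2 * |s.im|) *
        ((1 + K * 144) * Real.exp (2 * |s.im|))) := by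
          gcongr
          exact (hsz s h1 h2).2
      _ = (1 + K * 144) * (24 * G) * (Real.exp |s.im| * 1 *
          (Real.exp (2 * |s.im|) * Real.exp (2 * |s.im|))) := by ring
      _ ≤ M * Real.exp (6 * |s.im|) := by
          rw [e5]
          have : (1 + K * 144) * (24 * G) ≤ M := by simp only [M]; nlinarith
          gcongr

/-! ### The Riemann hypothesis as a zero-free half plane -/

/-- A zero `s` left of the critical line is reflected to `w = 1 - s`. There `ζ`, `Γ` and the power
do not vanish, so the cosine must. This makes `w` an odd integer, at least `3` since `w ≠ 1`, and
`s` a trivial zero. -/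
lemma riemannHypothesis_iff_half :
    RiemannHypothesis ↔ ∀ s : ℂ, 1 / 2 < s.re → riemannZeta s ≠ 0 := by
  constructor
  · intro h s hs h0
    have := h s h0 (by
      rintro ⟨n, rfl⟩
      have : (0 : ℝ) ≤ n := n.cast_nonneg
      simp at hs
      linarith) (by rintro rfl; exact riemannZeta_one_ne_zero h0)
    linarith
  · intro h s h0 htriv hs1
    by_contra hne
    rcases lt_or_gt_of_ne hne with hlt | hgt
    · set w := 1 - s with hw
      have hwre : 1 / 2 < w.re := by simp [hw]; linarith
      have hwn : ∀ n : ℕ, w ≠ -n := by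
        intro n hn
        rw [hn] at hwre
        have : (0 : ℝ) ≤ n := n.cast_nonneg
        simp at hwre
        linarith
      have hw1 : w ≠ 1 := by
        intro h1
        have : s = 0 := by rw [hw] at h1; linear_combination -h1
        rw [this, riemannZeta_zero] at h0
        norm_num at h0
      have hfe := riemannZeta_one_sub hwn hw1
      rw [show 1 - w = s by simp [hw], h0] at hfe
      have hcos : Complex.cos (Real.pi * w / 2) = 0 := by
        have hG := Complex.Gamma_ne_zero hwn
        have hp : (2 * Real.pi : ℂ) ^ (-w) ≠ 0 := by
          rw [Complex.cpow_ne_zero_iff]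
          left
          exact_mod_cast (by positivity : 2 * Real.pi ≠ 0)
        have hz := h w hwre
        simpa [hG, hp, hz] using hfe.symm
      obtain ⟨k, hk⟩ := Complex.cos_eq_zero_iff.1 hcos
      have hpi : (Real.pi : ℂ) ≠ 0 := by exact_mod_cast Real.pi_ne_zero
      have hwk : w = 2 * k + 1 := by
        have : (Real.pi : ℂ) * w = Real.pi * (2 * k + 1) := by linear_combination 2 * hk
        exact mul_left_cancel₀ hpi this
      have hk0 : (-1 : ℝ) < k := by
        rw [hwk] at hwre
        simp at hwre
        linarith
      have hk1 : 0 ≤ k := by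
        have : (-1 : ℤ) < k := by exact_mod_cast hk0
        omega
      obtain ⟨m, rfl⟩ := Int.eq_ofNat_of_zero_le hk1
      rcases m with _ | m
      · exact hw1 (by rw [hwk]; simp)
      · refine htriv ⟨m, ?_⟩
        rw [show s = 1 - w by simp [hw], hwk]
        push_cast
        ring
    · exact h s hgt h0

/-! ### Dividing out zeros on a disc -/

/-- An entire function that is bounded by `2 ^ N |F(c)|` on a disc of radius `3 r` around `c` has
at most `N` zeros in the concentric disc of radius `r`; they can be divided out without increasing
the ratio between the supremum and the value at the centre. -/
lemma exists_factorization_on_disc {c : ℂ} {r : ℝ} (hr : 0 < r) (N : ℕ) :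
    ∀ F : ℂ → ℂ, Differentiable ℂ F → F c ≠ 0 →
      (∀ z ∈ Metric.closedBall c (3 * r), ‖F z‖ ≤ 2 ^ N * ‖F c‖) →
      ∃ (n : ℕ) (w : Fin n → ℂ) (g : ℂ → ℂ), n ≤ N ∧ Differentiable ℂ g ∧
        (∀ i, F (w i) = 0 ∧ w i ∈ Metric.closedBall c r) ∧
        (∀ z, F z = (∏ i, (z - w i)) * g z) ∧
        (∀ z ∈ Metric.closedBall c r, g z ≠ 0) ∧
        (∀ z ∈ Metric.closedBall c (3 * r), ‖g z‖ ≤ 2 ^ N * ‖g c‖) := by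
  -- Each division halves the ratio: on the circle of radius `3 r` the factor `|z - w|` is at least
  -- `2 r`, at the centre it is at most `r`, and the maximum principle carries the estimate inside.
  have div_zero : ∀ (F : ℂ → ℂ) (M : ℝ), Differentiable ℂ F → F c ≠ 0 →
      (∀ z ∈ Metric.closedBall c (3 * r), ‖F z‖ ≤ M * ‖F c‖) →
      ∀ w ∈ Metric.closedBall c r, F w = 0 →
      ∃ g : ℂ → ℂ, Differentiable ℂ g ∧ g c ≠ 0 ∧ (∀ z, F z = (z - w) * g z) ∧
        ∀ z ∈ Metric.closedBall c (3 * r), ‖g z‖ ≤ M / 2 * ‖g c‖ := by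
    intro F M hF hc hM w hw hw0
    have hfac : ∀ z, F z = (z - w) * dslope F w z := by
      intro z
      have := sub_smul_dslope F w z
      rw [hw0, sub_zero, smul_eq_mul] at this
      exact this.symm
    have hg : Differentiable ℂ (dslope F w) := by
      rw [← differentiableOn_univ]
      exact (Complex.differentiableOn_dslope univ_mem).2 hF.differentiableOn
    have hcw : ‖c - w‖ ≤ r := by rwa [Metric.mem_closedBall, dist_comm, dist_eq_norm] at hw
    have hgc : ‖F c‖ ≤ r * ‖dslope F w c‖ := by
      rw [hfac c, norm_mul]; gcongr
    have hM0 : 0 ≤ M := by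
      have := hM c (Metric.mem_closedBall_self (by positivity))
      have hc' := norm_pos_iff.2 hc
      nlinarith
    refine ⟨dslope F w, hg, ?_, hfac, ?_⟩
    · intro h
      exact hc (by rw [hfac c, h, mul_zero])
    · intro z hz
      have hz' : z ∈ closure (Metric.ball c (3 * r)) := by
        rwa [closure_ball c (by positivity)]
      refine Complex.norm_le_of_forall_mem_frontier_norm_le (f := dslope F w) Metric.isBounded_ball
        hg.diffContOnCl ?_ hz'
      intro y hy
      rw [frontier_ball c (by positivity), mem_sphere_iff_norm] at hy
      have h1 : 2 * r ≤ ‖y - w‖ := by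
        have := norm_sub_le_norm_sub_add_norm_sub y w c
        rw [norm_sub_rev w c] at this
        linarith
      have h2 := hM y (by rw [Metric.mem_closedBall, dist_eq_norm, hy])
      rw [hfac y, norm_mul] at h2
      have h3 : 2 * r * ‖dslope F w y‖ ≤ M * (r * ‖dslope F w c‖) :=
        (mul_le_mul_of_nonneg_right h1 (norm_nonneg _)).trans
          (h2.trans (mul_le_mul_of_nonneg_left hgc hM0))
      have : r * ‖dslope F w y‖ ≤ r * (M / 2 * ‖dslope F w c‖) := by linarith
      exact le_of_mul_le_mul_left this hr
  induction N with
  | zero =>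
    intro F hF hc hM
    refine ⟨0, Fin.elim0, F, le_rfl, hF, fun i => i.elim0, fun z => by simp, ?_, hM⟩
    -- With ratio `1`, one more zero would give `‖g c‖ ≤ ‖g c‖ / 2`.
    intro w hw hw0
    obtain ⟨g, -, hgc, -, hb⟩ := div_zero F (2 ^ 0) hF hc hM w hw hw0
    have := hb c (Metric.mem_closedBall_self (by positivity))
    have h0 := norm_pos_iff.2 hgc
    norm_num at this
    linarith
  | succ N ih =>
    intro F hF hc hM
    by_cases hz : ∀ z ∈ Metric.closedBall c r, F z ≠ 0
    · exact ⟨0, Fin.elim0, F, by omega, hF, fun i => i.elim0, fun z => by simp, hz, hM⟩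
    push Not at hz
    obtain ⟨w₀, hw₀, hw₀0⟩ := hz
    obtain ⟨g, hg, hgc, hfac, hb⟩ := div_zero F (2 ^ (N + 1)) hF hc hM w₀ hw₀ hw₀0
    rw [show (2 : ℝ) ^ (N + 1) / 2 = 2 ^ N by rw [pow_succ]; ring] at hb
    obtain ⟨n, w, g', hn, hg', hw, hfac', hne, hb'⟩ := ih g hg hgc hb
    refine ⟨n + 1, Fin.cons w₀ w, g', by omega, hg', ?_, ?_, hne, ?_⟩
    · intro i
      refine Fin.cases ⟨hw₀0, hw₀⟩ (fun j => ?_) i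
      simp only [Fin.cons_succ]
      exact ⟨by rw [hfac, (hw j).1, mul_zero], (hw j).2⟩
    · intro z
      rw [hfac, hfac', Fin.prod_univ_succ]
      simp [mul_assoc]
    · intro z hz
      refine (hb' z hz).trans ?_
      gcongr
      · norm_num
      · omega

/-- A primitive of `g' / g`, with value `log (g c)` at the centre; then `g exp (-ℓ)` has derivative
zero. -/
lemma exists_log_on_ball {c : ℂ} {r : ℝ} (hr : 0 < r) {g : ℂ → ℂ} (hg : Differentiable ℂ g)
    (hne : ∀ z ∈ Metric.ball c r, g z ≠ 0) :
    ∃ ℓ : ℂ → ℂ, DifferentiableOn ℂ ℓ (Metric.ball c r) ∧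
      ∀ z ∈ Metric.ball c r, g z = Complex.exp (ℓ z) := by
  have hcb : c ∈ Metric.ball c r := Metric.mem_ball_self hr
  have hq : DifferentiableOn ℂ (fun z => deriv g z / g z) (Metric.ball c r) :=
    (hg.differentiableOn.deriv Metric.isOpen_ball).div hg.differentiableOn hne
  obtain ⟨ℓ, hℓc, hℓ⟩ := hq.isExactOn_ball.with_val_at c (Complex.log (g c))
  have hd : DifferentiableOn ℂ ℓ (Metric.ball c r) := fun z hz =>
    (hℓ z hz).differentiableAt.differentiableWithinAt
  refine ⟨ℓ, hd, fun z hz => ?_⟩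
  have hconst : ∀ y ∈ Metric.ball c r,
      HasDerivAt (fun z => g z * Complex.exp (-ℓ z)) 0 y := by
    intro y hy
    have := (hg y).hasDerivAt.mul ((hℓ y hy).neg.cexp)
    convert! this using 1
    field_simp [hne y hy]
    simp
  have := (convex_ball c r).is_const_of_fderivWithin_eq_zero (𝕜 := ℂ)
    (f := fun z => g z * Complex.exp (-ℓ z))
    (fun y hy => (hconst y hy).differentiableAt.differentiableWithinAt)
    (fun y hy => by
      rw [fderivWithin_of_isOpen Metric.isOpen_ball hy, (hconst y hy).hasFDerivAt.fderiv]
      ext; simp) hz hcb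
  rw [hℓc, Complex.exp_neg, Complex.exp_neg, Complex.exp_log (hne c hcb),
    mul_inv_cancel₀ (hne c hcb)] at this
  exact (mul_inv_eq_one₀ (Complex.exp_ne_zero _)).1 this

/-- Local factorization of an entire function: finitely many zeros, and a zero-free factor with a
logarithm that is controlled by the growth of the function. -/
lemma exists_log_factorization {c : ℂ} {r : ℝ} (hr : 0 < r) (N : ℕ) {F : ℂ → ℂ}
    (hF : Differentiable ℂ F) (hc : F c ≠ 0)
    (hM : ∀ z ∈ Metric.closedBall c (3 * r), ‖F z‖ ≤ 2 ^ N * ‖F c‖) :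
    ∃ (n : ℕ) (w : Fin n → ℂ) (ℓ : ℂ → ℂ), n ≤ N ∧ DifferentiableOn ℂ ℓ (Metric.ball c r) ∧
      (∀ i, F (w i) = 0 ∧ w i ∈ Metric.closedBall c r) ∧
      (∀ z ∈ Metric.ball c r, F z = Complex.exp (ℓ z) * ∏ i, (z - w i)) ∧
      (∀ z ∈ Metric.ball c r, ‖ℓ z - ℓ c‖ ≤ 2 * (N + 1) * ‖z - c‖ / (r - ‖z - c‖)) := by
  obtain ⟨n, w, g, hn, hg, hw, hfac, hne, hb⟩ := exists_factorization_on_disc hr N F hF hc hM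
  obtain ⟨ℓ, hℓ, hexp⟩ := exists_log_on_ball hr hg fun z hz => hne z (Metric.ball_subset_closedBall hz)
  refine ⟨n, w, ℓ, hn, hℓ, hw, fun z hz => by rw [hfac, hexp z hz, mul_comm], fun z hz => ?_⟩
  have hcb : c ∈ Metric.ball c r := Metric.mem_ball_self hr
  have hmaps : ∀ y ∈ Metric.ball (0 : ℂ) r, c + y ∈ Metric.ball c r := by
    intro y hy; simpa [dist_eq_norm] using hy
  -- The maximum bound controls only the real part: `2 ^ N ≤ exp N` gives `Re (ℓ (c + y) - ℓ c) ≤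
  -- N`. Borel–Carathéodory turns this into a bound for the modulus; `N + 1` keeps the constant
  -- positive when `N = 0`.
  have := Complex.borelCaratheodory_zero (f := fun y => ℓ (c + y) - ℓ c) (M := N + 1) (R := r)
    (z := z - c) (by positivity)
    ((hℓ.comp (by fun_prop) hmaps).sub_const _) ?_ hr
    (by simpa [dist_eq_norm] using hz) (by simp)
  · simpa using this
  · intro y hy
    have hy' := hmaps y hy
    have h1 := hb (c + y) (Metric.closedBall_subset_closedBall (by linarith)
      (Metric.ball_subset_closedBall hy'))
    rw [hexp _ hy', hexp _ hcb, Complex.norm_exp, Complex.norm_exp] at h1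
    have h2 : Real.exp ((ℓ (c + y)).re - (ℓ c).re) ≤ Real.exp N := by
      rw [Real.exp_sub, div_le_iff₀ (Real.exp_pos _)]
      refine h1.trans ?_
      gcongr
      rw [← Real.exp_one_pow]
      gcongr
      linarith [Real.add_one_le_exp 1]
    have := Real.exp_le_exp.1 h2
    simp only [mem_ofPred_eq, Complex.sub_re]
    linarith

/-! ### The branch of `log ζ` and its local formula -/

/-- If two values differed, the image, being an interval, would contain `f x + π`, which is not a
multiple of `2π`. -/
lemma IsPreconnected.eq_of_mem_int_mul_two_pi {α : Type*} [TopologicalSpace α] {S : Set α}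
    (hS : IsPreconnected S) {f : α → ℝ} (hf : ContinuousOn f S)
    (hk : ∀ z ∈ S, ∃ k : ℤ, f z = k * (2 * Real.pi)) {x y : α} (hx : x ∈ S) (hy : y ∈ S) :
    f x = f y := by
  have key : ∀ x ∈ S, ∀ y ∈ S, ¬ f x < f y := by
    intro x hx y hy hlt
    obtain ⟨k, hkx⟩ := hk x hx
    obtain ⟨m, hmy⟩ := hk y hy
    have hpi := Real.pi_pos
    have hkm : (k : ℝ) < m := by
      rw [hkx, hmy] at hlt
      exact lt_of_mul_lt_mul_right hlt (by positivity)
    have hkm' : (k : ℝ) + 1 ≤ m := by exact_mod_cast (by exact_mod_cast hkm : k < m)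
    have : f x + Real.pi ∈ f '' S :=
      (hS.image f hf).ordConnected.out (mem_image_of_mem f hx) (mem_image_of_mem f hy)
        ⟨by linarith, by rw [hkx, hmy]; nlinarith⟩
    obtain ⟨z, hz, hfz⟩ := this
    obtain ⟨j, hj⟩ := hk z hz
    rw [hfz, hkx] at hj
    have h2 : Real.pi * (2 * k + 1) = Real.pi * (2 * j) := by linarith
    have h3 : (2 * k + 1 : ℝ) = 2 * j := mul_left_cancel₀ hpi.ne' h2
    have h4 : 2 * k + 1 = 2 * j := by exact_mod_cast h3
    omega
  exact le_antisymm (not_lt.1 (key y hy x hx)) (not_lt.1 (key x hx y hy))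

/-- The branch of `log ζ` whose imaginary part is `zetaArg`. -/
def zetaLog (s : ℂ) : ℂ := (Real.log ‖riemannZeta s‖ : ℂ) + zetaArg s * Complex.I

lemma riemannZeta_eq_norm_mul_exp (s : ℂ) : riemannZeta s =
    ‖riemannZeta s‖ * Complex.exp ((riemannZeta s).arg * Complex.I) :=
  (Complex.norm_mul_exp_arg_mul_I _).symm

lemma tendsto_riemannZeta_add_atTop (s : ℂ) :
    Tendsto (fun x : ℝ => riemannZeta (s + x)) atTop (𝓝 1) := by
  rw [tendsto_iff_norm_sub_tendsto_zero]
  have h1 : Tendsto (fun x : ℝ => (2 : ℝ) ^ (2 - s.re - x) * (2 / 3)) atTop (𝓝 0) := by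
    have h2 : Tendsto (fun x : ℝ => 2 - s.re - x) atTop atBot :=
      tendsto_atBot_add_const_left _ _ tendsto_neg_atTop_atBot
    simpa using ((tendsto_rpow_atBot_of_base_gt_one 2 (by norm_num)).comp h2).mul_const (2 / 3)
  refine squeeze_zero' (Eventually.of_forall fun _ => norm_nonneg _) ?_ h1
  filter_upwards [eventually_ge_atTop (2 - s.re)] with x hx
  have := norm_riemannZeta_sub_one_le (s := s + x) (by simp; linarith)
  simpa [sub_sub] using this

/-- A determination of the argument on an initial segment of the ray that agrees with the principal
argument at the right end, where `Re ≥ 2`, computes `zetaArg`. -/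
lemma zetaArg_eq_of_segment {s : ℂ} {x₀ : ℝ} (hx₀ : 0 ≤ x₀) (hs : 2 ≤ s.re + x₀) {θ : ℝ → ℝ}
    (hθ : ContinuousOn θ (Icc 0 x₀))
    (h : ∀ x ∈ Icc 0 x₀, riemannZeta (s + x) ≠ 0 ∧
      riemannZeta (s + x) = ‖riemannZeta (s + x)‖ * Complex.exp (θ x * Complex.I))
    (hend : θ x₀ = (riemannZeta (s + x₀)).arg) : zetaArg s = θ 0 := by
  have hslit : ∀ x : ℝ, x₀ ≤ x → riemannZeta (s + x) ∈ Complex.slitPlane := fun x hx =>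
    riemannZeta_mem_slitPlane (by simp; linarith)
  have hcont : ContinuousOn (fun x : ℝ => (riemannZeta (s + x)).arg) (Ici x₀) := by
    intro x hx
    have h1 : s + x ≠ 1 := by
      intro h1
      have := congrArg Complex.re h1
      simp at this
      linarith [mem_Ici.1 hx]
    have h2 : ContinuousAt (fun x : ℝ => riemannZeta (s + x)) x :=
      ContinuousAt.comp (f := fun x : ℝ => s + (x : ℂ)) (g := riemannZeta)
        (differentiableAt_riemannZeta h1).continuousAt (by fun_prop)
    exact (ContinuousAt.comp (f := fun x : ℝ => riemannZeta (s + x)) (g := Complex.arg)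
      (Complex.continuousAt_arg (hslit x hx)) h2).continuousWithinAt
  have key : IsZetaArgOnRay s
      (fun x => θ (min x x₀) + ((riemannZeta (s + (max x x₀ : ℝ))).arg - θ x₀)) := by
    refine ⟨?_, ?_, ?_⟩
    · refine ContinuousOn.add ?_ (ContinuousOn.sub ?_ continuousOn_const)
      · exact hθ.comp (by fun_prop) fun x hx => ⟨le_min hx hx₀, min_le_right _ _⟩
      · exact hcont.comp (f := fun x => max x x₀) (by fun_prop)
          fun x _ => mem_Ici.2 (le_max_right x x₀)
    · intro x hx
      beta_reduce
      rcases le_total x x₀ with hxx | hxx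
      · rw [min_eq_left hxx, max_eq_right hxx, hend, sub_self, add_zero]
        exact h x ⟨hx, hxx⟩
      · rw [min_eq_right hxx, max_eq_left hxx, add_sub_cancel]
        exact ⟨Complex.slitPlane_ne_zero (hslit x hxx), riemannZeta_eq_norm_mul_exp _⟩
    · have h1 := (Complex.continuousAt_arg Complex.one_mem_slitPlane).tendsto.comp
        (tendsto_riemannZeta_add_atTop s)
      rw [Complex.arg_one] at h1
      refine h1.congr' ?_
      filter_upwards [eventually_ge_atTop x₀] with x hx
      simp [min_eq_right hx, max_eq_left hx]
  rw [zetaArg_eq key]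
  simp [min_eq_left hx₀, max_eq_right hx₀, hend]

lemma zetaLog_of_two_le_re {s : ℂ} (hs : 2 ≤ s.re) :
    zetaLog s = Complex.log (riemannZeta s) := by
  have : zetaArg s = (riemannZeta s).arg := by
    refine zetaArg_eq_of_segment (θ := fun _ => (riemannZeta s).arg) le_rfl (by simpa)
      continuousOn_const ?_ (by simp)
    intro x hx
    obtain rfl : x = 0 := le_antisymm hx.2 hx.1
    simp only [Complex.ofReal_zero, add_zero]
    exact ⟨Complex.slitPlane_ne_zero (riemannZeta_mem_slitPlane hs),
      riemannZeta_eq_norm_mul_exp _⟩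
  rw [zetaLog, this, Complex.log]

lemma norm_log_riemannZeta_le {s : ℂ} (hs : 2 ≤ s.re) :
    ‖Complex.log (riemannZeta s)‖ ≤ 2 * 2 ^ (2 - s.re) := by
  have h1 := norm_riemannZeta_sub_one_lt hs
  have h2 := norm_riemannZeta_sub_one_le hs
  set u := riemannZeta s - 1 with hu
  have e : riemannZeta s = 1 + u := by simp [hu]
  rw [e]
  refine (Complex.norm_log_one_add_le (by linarith)).trans ?_
  have h3 : (1 - ‖u‖)⁻¹ ≤ 3 := by
    rw [inv_le_comm₀ (by linarith) (by norm_num)]; linarith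
  have h4 : ‖u‖ ^ 2 * (1 - ‖u‖)⁻¹ / 2 ≤ ‖u‖ := by
    have : ‖u‖ ^ 2 * (1 - ‖u‖)⁻¹ ≤ ‖u‖ ^ 2 * 3 := by gcongr
    nlinarith [norm_nonneg u]
  have : (0 : ℝ) < 2 ^ (2 - s.re) := by positivity
  linarith

/-- A branch of `log ζ` on a disc around `2 + iT`, given by an explicit formula in terms of the
zeros in the disc. -/
structure ZetaLocalLog (T r : ℝ) where
  n : ℕ
  w : Fin n → ℂ
  ℓ : ℂ → ℂ
  diff : DifferentiableOn ℂ ℓ (Metric.ball (2 + T * Complex.I) r)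
  zero : ∀ i, riemannZeta₁ (w i) = 0
  mem : ∀ i, w i ∈ Metric.closedBall (2 + T * Complex.I) r
  eq : ∀ z ∈ Metric.ball (2 + T * Complex.I) r,
    riemannZeta₁ z = Complex.exp (ℓ z) * ∏ i, (z - w i)
  center : ℓ (2 + T * Complex.I) + ∑ i, Complex.log (2 + T * Complex.I - w i) -
    Complex.log (2 + T * Complex.I - 1) = Complex.log (riemannZeta (2 + T * Complex.I))

namespace ZetaLocalLog

/-- The normalization at the centre holds up to `2π i k`, which is absorbed into `ℓ`. Increments of
`ℓ` from the centre do not change, so bounds on them survive. -/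
lemma exists_of_factorization {T r : ℝ} (hr : 0 < r) {n : ℕ} (w : Fin n → ℂ) (ℓ : ℂ → ℂ)
    (diff : DifferentiableOn ℂ ℓ (Metric.ball (2 + T * Complex.I) r))
    (zero : ∀ i, riemannZeta₁ (w i) = 0 ∧ w i ∈ Metric.closedBall (2 + T * Complex.I) r)
    (eq : ∀ z ∈ Metric.ball (2 + T * Complex.I) r,
      riemannZeta₁ z = Complex.exp (ℓ z) * ∏ i, (z - w i)) :
    ∃ D : ZetaLocalLog T r, D.n = n ∧
      ∀ z, D.ℓ z - D.ℓ (2 + T * Complex.I) = ℓ z - ℓ (2 + T * Complex.I) := by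
  set c : ℂ := 2 + T * Complex.I with hc
  have hcre : c.re = 2 := by simp [hc]
  have hc1 : c ≠ 1 := by intro h; rw [h] at hcre; simp at hcre
  have hcb : c ∈ Metric.ball c r := Metric.mem_ball_self hr
  have hne : ∀ i, c - w i ≠ 0 := by
    intro i h
    have h2 := (zero i).1
    rw [← sub_eq_zero.1 h] at h2
    exact riemannZeta₁_ne_zero_of_one_le_re (by rw [hcre]; norm_num) h2
  have hexp : Complex.exp (ℓ c + ∑ i, Complex.log (c - w i) - Complex.log (c - 1)) =
      Complex.exp (Complex.log (riemannZeta c)) := by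
    rw [Complex.exp_log (Complex.slitPlane_ne_zero (riemannZeta_mem_slitPlane hcre.ge)),
      Complex.exp_sub, Complex.exp_add, Complex.exp_sum, Complex.exp_log (sub_ne_zero.2 hc1)]
    simp_rw [fun i => Complex.exp_log (hne i)]
    rw [← eq c hcb, riemannZeta_eq_inv_sub_mul hc1, div_eq_inv_mul]
  obtain ⟨k, hk⟩ := Complex.exp_eq_exp_iff_exists_int.1 hexp
  refine ⟨⟨n, w, fun z => ℓ z - k * (2 * Real.pi * Complex.I), diff.sub_const _,
    fun i => (zero i).1, fun i => (zero i).2, ?_, ?_⟩, rfl, fun z => by ring⟩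
  · intro z hz
    rw [eq z hz, Complex.exp_sub, Complex.exp_int_mul_two_pi_mul_I, div_one]
  · linear_combination hk

variable {T r : ℝ} (D : ZetaLocalLog T r)

/-- The branch of `log ζ` on the disc. -/
def branch (z : ℂ) : ℂ := D.ℓ z + ∑ i, Complex.log (z - D.w i) - Complex.log (z - 1)

lemma re_zero_lt_one (i : Fin D.n) : (D.w i).re < 1 := by
  by_contra h
  exact riemannZeta₁_ne_zero_of_one_le_re (not_lt.1 h) (D.zero i)

lemma exp_branch {z : ℂ} (hz : z ∈ Metric.ball (2 + T * Complex.I) r) (h1 : z ≠ 1)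
    (hw : ∀ i, z ≠ D.w i) : Complex.exp (D.branch z) = riemannZeta z := by
  rw [branch, Complex.exp_sub, Complex.exp_add, Complex.exp_sum,
    Complex.exp_log (sub_ne_zero.2 h1)]
  simp_rw [fun i => Complex.exp_log (sub_ne_zero.2 (hw i))]
  rw [← D.eq z hz, riemannZeta_eq_inv_sub_mul h1, div_eq_inv_mul]

lemma continuousAt_branch {z : ℂ} (hz : z ∈ Metric.ball (2 + T * Complex.I) r)
    (h1 : z - 1 ∈ Complex.slitPlane) (hw : ∀ i, z - D.w i ∈ Complex.slitPlane) :
    ContinuousAt D.branch z := by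
  refine ContinuousAt.sub (ContinuousAt.add ?_ ?_) ?_
  · exact (D.diff.differentiableAt (Metric.isOpen_ball.mem_nhds hz)).continuousAt
  · exact tendsto_finsetSum _ fun i _ =>
      (continuousAt_id.sub continuousAt_const).clog (hw i)
  · exact (continuousAt_id.sub continuousAt_const).clog h1

/-- Both sides are continuous logarithms of `ζ` on the convex set where the disc meets `Re z ≥ 2`,
and they agree at the centre. -/
lemma branch_eq_log {z : ℂ} (hz : z ∈ Metric.ball (2 + T * Complex.I) r) (hre : 2 ≤ z.re) :
    D.branch z = Complex.log (riemannZeta z) := by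
  set c : ℂ := 2 + T * Complex.I with hc
  have hcre : c.re = 2 := by simp [hc]
  set S : Set ℂ := Metric.ball c r ∩ {z | 2 ≤ z.re} with hS
  have hconv : Convex ℝ S := (convex_ball c r).inter (convex_halfSpace_re_ge 2)
  have hr : 0 < r := Metric.pos_of_mem_ball hz
  have hcS : c ∈ S := ⟨Metric.mem_ball_self hr, hcre.ge⟩
  have hzS : z ∈ S := ⟨hz, hre⟩
  have hslit : ∀ y ∈ S, ∀ u : ℂ, u.re ≤ 1 → y - u ∈ Complex.slitPlane := by
    intro y hy u hu
    left
    have : 2 ≤ y.re := hy.2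
    simp only [Complex.sub_re]
    linarith
  have hdiff : ∀ y ∈ S, ∃ k : ℤ, D.branch y - Complex.log (riemannZeta y) =
      k * (2 * Real.pi * Complex.I) := by
    intro y hy
    have hsl := riemannZeta_mem_slitPlane (s := y) hy.2
    have : Complex.exp (D.branch y) = Complex.exp (Complex.log (riemannZeta y)) := by
      rw [Complex.exp_log (Complex.slitPlane_ne_zero hsl)]
      refine D.exp_branch hy.1 ?_ ?_
      · exact sub_ne_zero.1 (Complex.slitPlane_ne_zero (hslit y hy 1 (by simp)))
      · exact fun i => sub_ne_zero.1
          (Complex.slitPlane_ne_zero (hslit y hy _ (D.re_zero_lt_one i).le))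
    obtain ⟨k, hk⟩ := Complex.exp_eq_exp_iff_exists_int.1 this
    exact ⟨k, by rw [hk]; ring⟩
  have hcont : ContinuousOn (fun y => (D.branch y - Complex.log (riemannZeta y)).im) S := by
    intro y hy
    have h1 : y ≠ 1 := sub_ne_zero.1 (Complex.slitPlane_ne_zero (hslit y hy 1 (by simp)))
    have := (D.continuousAt_branch hy.1 (hslit y hy 1 (by simp))
      fun i => hslit y hy _ (D.re_zero_lt_one i).le).sub
      ((differentiableAt_riemannZeta h1).continuousAt.clog (riemannZeta_mem_slitPlane hy.2))
    exact (Complex.continuous_im.continuousAt.comp this).continuousWithinAt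
  have him := hconv.isPreconnected.eq_of_mem_int_mul_two_pi hcont (fun y hy => by
    obtain ⟨k, hk⟩ := hdiff y hy
    exact ⟨k, by rw [hk]; simp⟩) hzS hcS
  have hcc : D.branch c - Complex.log (riemannZeta c) = 0 := by
    rw [sub_eq_zero]; exact D.center
  rw [hcc] at him
  obtain ⟨k, hk⟩ := hdiff z hzS
  rw [← sub_eq_zero, hk]
  rw [hk] at him
  simp at him
  simp [him]

/-- The explicit formula computes `zetaLog` away from the ordinates of the zeros. -/
lemma zetaLog_eq_branch {s : ℂ} (hs : s ∈ Metric.ball (2 + T * Complex.I) r) (h0 : s.im ≠ 0)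
    (hw : ∀ i, (D.w i).im ≠ s.im) : zetaLog s = D.branch s := by
  rcases le_or_gt 2 s.re with hre | hre
  · rw [zetaLog_of_two_le_re hre, D.branch_eq_log hs hre]
  set x₀ : ℝ := 2 - s.re with hx₀
  have hx₀0 : 0 ≤ x₀ := by linarith
  have hend : s + x₀ ∈ Metric.ball (2 + T * Complex.I) r := by
    rw [Metric.mem_ball, dist_eq_norm] at hs ⊢
    refine lt_of_le_of_lt ?_ hs
    have e : s + x₀ - (2 + T * Complex.I) = ((s - (2 + T * Complex.I)).im : ℂ) * Complex.I := by
      apply Complex.ext <;> simp [hx₀]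
    rw [e, norm_mul, Complex.norm_I, mul_one, Complex.norm_real]
    exact Complex.abs_im_le_norm _
  have hmem : ∀ x ∈ Icc 0 x₀, s + x ∈ Metric.ball (2 + T * Complex.I) r := by
    intro x hx
    refine (convex_ball (2 + T * Complex.I) r).segment_subset hs hend ?_
    rw [segment_eq_image']
    rcases hx₀0.eq_or_lt with h | h
    · refine ⟨0, by simp, ?_⟩
      have : x = 0 := le_antisymm (hx.2.trans h.symm.le) hx.1
      simp [this]
    · refine ⟨x / x₀, ⟨by have := hx.1; positivity, (div_le_one h).2 hx.2⟩, ?_⟩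
      beta_reduce
      rw [add_sub_cancel_left, Complex.real_smul, ← Complex.ofReal_mul, div_mul_cancel₀ _ h.ne']
  -- On the horizontal segment the imaginary parts of `s + x - 1` and `s + x - w i` are constant and
  -- nonzero, so no principal logarithm crosses its cut.
  have hsl1 : ∀ x : ℝ, s + x - 1 ∈ Complex.slitPlane := fun x => Or.inr (by simpa using h0)
  have hslw : ∀ (x : ℝ) (i), s + x - D.w i ∈ Complex.slitPlane := fun x i =>
    Or.inr (by simpa [sub_eq_zero] using (hw i).symm)
  have hexp : ∀ x ∈ Icc 0 x₀, Complex.exp (D.branch (s + x)) = riemannZeta (s + x) :=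
    fun x hx => D.exp_branch (hmem x hx) (sub_ne_zero.1 (Complex.slitPlane_ne_zero (hsl1 x)))
      fun i => sub_ne_zero.1 (Complex.slitPlane_ne_zero (hslw x i))
  have harg : zetaArg s = (D.branch (s + (0 : ℝ))).im := by
    refine zetaArg_eq_of_segment (θ := fun x => (D.branch (s + x)).im) hx₀0 (by simp [hx₀]) ?_ ?_ ?_
    · intro x hx
      have h1 := D.continuousAt_branch (hmem x hx) (hsl1 x) (hslw x)
      have h2 : ContinuousAt (fun x : ℝ => D.branch (s + x)) x :=
        ContinuousAt.comp (f := fun x : ℝ => s + (x : ℂ)) (g := D.branch) h1 (by fun_prop)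
      exact (Complex.continuous_im.continuousAt.comp h2).continuousWithinAt
    · intro x hx
      rw [← hexp x hx]
      refine ⟨Complex.exp_ne_zero _, ?_⟩
      rw [Complex.norm_exp, Complex.ofReal_exp, ← Complex.exp_add, Complex.re_add_im]
    · rw [D.branch_eq_log hend (by simp [hx₀]), Complex.log_im]
  have hre' : Real.log ‖riemannZeta s‖ = (D.branch s).re := by
    have := hexp 0 ⟨le_rfl, hx₀0⟩
    simp only [Complex.ofReal_zero, add_zero] at this
    rw [← this, Complex.norm_exp, Real.log_exp]
  rw [zetaLog, harg, hre']
  simp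

end ZetaLocalLog

/-! ### Bounds for `log ζ` near a given height -/

/-- An integrable majorant of the logarithmic singularity. -/
def logBump (x : ℝ) : ℝ := (Ioo (-1 : ℝ) 1).indicator (fun x => |Real.log x|) x

lemma logBump_nonneg (x : ℝ) : 0 ≤ logBump x := indicator_nonneg (fun _ _ => abs_nonneg _) x

lemma integrable_logBump : Integrable logBump := by
  have h : IntervalIntegrable (fun x => |Real.log x|) volume (-1) 1 :=
    intervalIntegral.intervalIntegrable_log'.abs
  rw [intervalIntegrable_iff_integrableOn_Ioc_of_le (by norm_num)] at h
  exact (integrable_indicator_iff measurableSet_Ioo).2 (h.mono_set Ioo_subset_Ioc_self)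

/-- Here `x` plays the role of a real coordinate of `z`: along a horizontal or vertical line the
singularity is dominated by a one-variable function with finite integral. -/
lemma abs_log_norm_le_add_logBump {z : ℂ} {x : ℝ} (hx : x ≠ 0) (h : |x| ≤ ‖z‖) :
    |Real.log ‖z‖| ≤ ‖z‖ + logBump x := by
  have hx' : 0 < |x| := abs_pos.2 hx
  have hz : 0 < ‖z‖ := hx'.trans_le h
  rcases le_or_gt 1 ‖z‖ with h1 | h1
  · rw [abs_of_nonneg (Real.log_nonneg h1)]
    have := Real.log_le_sub_one_of_pos hz
    linarith [logBump_nonneg x]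
  · have hm : x ∈ Ioo (-1 : ℝ) 1 := abs_lt.1 (h.trans_lt h1)
    rw [logBump, indicator_of_mem hm, abs_of_neg (Real.log_neg hz h1), ← Real.log_abs x,
      abs_of_neg (Real.log_neg hx' (h.trans_lt h1))]
    have := Real.log_le_log hx' h
    linarith

lemma norm_clog_le (z : ℂ) : ‖Complex.log z‖ ≤ |Real.log ‖z‖| + Real.pi := by
  rw [Complex.log]
  refine (norm_add_le _ _).trans ?_
  rw [norm_mul, Complex.norm_I, mul_one, Complex.norm_real, Complex.norm_real]
  gcongr
  · exact le_rfl
  · exact Complex.abs_arg_le_pi z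

lemma norm_log_riemannZeta_le_exp {s : ℂ} (hs : 2 ≤ s.re) :
    ‖Complex.log (riemannZeta s)‖ ≤ 8 * Real.exp (-(1 / 2) * s.re) := by
  refine (norm_log_riemannZeta_le hs).trans ?_
  have h1 : (2 : ℝ) ^ (2 - s.re) ≤ Real.exp (1 - 1 / 2 * s.re) := by
    rw [Real.rpow_def_of_pos (by norm_num)]
    gcongr
    have := Real.log_two_gt_d9
    nlinarith
  have h2 : Real.exp (1 - 1 / 2 * s.re) = Real.exp 1 * Real.exp (-(1 / 2) * s.re) := by
    rw [← Real.exp_add]; ring_nf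
  have h3 := Real.exp_one_lt_d9
  have h4 := Real.exp_pos (-(1 / 2) * s.re)
  nlinarith

lemma riemannZeta₁_center_ne_zero (T : ℝ) : riemannZeta₁ (2 + T * Complex.I) ≠ 0 :=
  riemannZeta₁_ne_zero_of_one_le_re (by simp)

lemma ZetaLocalLog.nonempty (T : ℝ) {r : ℝ} (hr : 0 < r) : Nonempty (ZetaLocalLog T r) := by
  set c : ℂ := 2 + T * Complex.I
  have hc := riemannZeta₁_center_ne_zero T
  obtain ⟨B, hB⟩ := (isCompact_closedBall c (3 * r)).exists_bound_of_continuousOn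
    differentiable_riemannZeta₁.continuous.continuousOn
  obtain ⟨N, hN⟩ := pow_unbounded_of_one_lt (B / ‖riemannZeta₁ c‖) (one_lt_two : (1 : ℝ) < 2)
  rw [div_lt_iff₀ (norm_pos_iff.2 hc)] at hN
  obtain ⟨n, w, ℓ, -, hd, hw, he, -⟩ := exists_log_factorization hr N
    differentiable_riemannZeta₁ hc fun z hz => (hB z hz).trans hN.le
  exact ⟨(ZetaLocalLog.exists_of_factorization hr w ℓ hd hw he).choose⟩

/-- At the centre `‖(c - 1) ζ(c)‖ ≥ 1 / 3`, while on the disc of radius `9` the function is at most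
exponential in `|T|`. The ratio is thus below `2 ^ N` with `N` linear in `|T|`, which controls both
the number of zeros and the zero-free factor. -/
lemma ZetaLocalLog.exists_bounded : ∃ C : ℝ, 0 ≤ C ∧ ∀ T : ℝ, ∃ D : ZetaLocalLog T 3,
    (D.n : ℝ) ≤ C * (1 + |T|) ∧ ∀ z ∈ Metric.closedBall (2 + T * Complex.I) 2,
      ‖D.ℓ z - D.ℓ (2 + T * Complex.I)‖ ≤ C * (1 + |T|) := by
  obtain ⟨C, hC0, hC⟩ := exists_norm_riemannZeta₁_le_exp
  refine ⟨4 * (20 * C + 6), by positivity, fun T => ?_⟩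
  set c : ℂ := 2 + T * Complex.I with hcdef
  have hcre : c.re = 2 := by simp [hcdef]
  have hcim : c.im = T := by simp [hcdef]
  have hc1 : c ≠ 1 := by intro h; rw [h] at hcre; simp at hcre
  have hlow : 1 / 3 ≤ ‖riemannZeta₁ c‖ := by
    rw [riemannZeta₁_eq_mul hc1, norm_mul]
    have h1 : 1 ≤ ‖c - 1‖ := by
      refine le_trans ?_ (Complex.abs_re_le_norm _)
      rw [Complex.sub_re, hcre]; norm_num
    have h2 := norm_riemannZeta_sub_one_lt hcre.ge
    have h3 := norm_sub_norm_le 1 (riemannZeta c)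
    rw [norm_sub_rev, norm_one] at h3
    nlinarith
  have hT := abs_nonneg T
  -- On the large disc `1 + |Im z| ≤ 10 + |T|`; the summand `2` absorbs the factor `3 ≤ exp 2` from
  -- the lower bound at the centre, and the outer factor `2` compensates `log 2 > 1 / 2`.
  set N : ℕ := ⌈2 * (C * (10 + |T|) + 2)⌉₊ with hN
  have hN1 : 2 * (C * (10 + |T|) + 2) ≤ N := Nat.le_ceil _
  have hN2 : (N : ℝ) ≤ (20 * C + 5) * (1 + |T|) := by
    have := (Nat.ceil_lt_add_one (by positivity : 0 ≤ 2 * (C * (10 + |T|) + 2))).le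
    refine this.trans ?_
    nlinarith [mul_nonneg hC0 hT]
  have hM : ∀ z ∈ Metric.closedBall c (3 * 3), ‖riemannZeta₁ z‖ ≤ 2 ^ N * ‖riemannZeta₁ c‖ := by
    intro z hz
    rw [Metric.mem_closedBall, dist_eq_norm] at hz
    have h1 := (abs_le.1 ((Complex.abs_re_le_norm _).trans hz))
    have h2 := ((Complex.abs_im_le_norm _).trans hz)
    rw [Complex.sub_re, hcre] at h1
    rw [Complex.sub_im, hcim] at h2
    have h3 : |z.im| ≤ 9 + |T| := by
      have := abs_sub_abs_le_abs_sub z.im T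
      linarith
    have h4 : Real.exp (C * (10 + |T|)) * 3 ≤ 2 ^ N := by
      have e3 : (3 : ℝ) ≤ Real.exp 2 := by linarith [Real.add_one_le_exp (2 : ℝ)]
      calc Real.exp (C * (10 + |T|)) * 3 ≤ Real.exp (C * (10 + |T|)) * Real.exp 2 := by gcongr
        _ = Real.exp (C * (10 + |T|) + 2) := (Real.exp_add _ _).symm
        _ ≤ Real.exp (Real.log 2 * N) := by
          gcongr
          have := Real.log_two_gt_d9
          nlinarith
        _ = 2 ^ N := by
          rw [mul_comm, Real.exp_nat_mul, Real.exp_log (by norm_num)]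
    calc ‖riemannZeta₁ z‖ ≤ Real.exp (C * (1 + |z.im|)) := hC z (by linarith) (by linarith)
      _ ≤ Real.exp (C * (10 + |T|)) :=
        Real.exp_le_exp.2 (mul_le_mul_of_nonneg_left (by linarith) hC0)
      _ = Real.exp (C * (10 + |T|)) * 3 * (1 / 3) := by ring
      _ ≤ 2 ^ N * ‖riemannZeta₁ c‖ := by gcongr
  obtain ⟨n, w, ℓ, hn, hd, hw, he, hb⟩ := exists_log_factorization (by norm_num : (0 : ℝ) < 3) N
    differentiable_riemannZeta₁ (riemannZeta₁_center_ne_zero T) hM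
  obtain ⟨D, hDn, hDℓ⟩ := ZetaLocalLog.exists_of_factorization (by norm_num) w ℓ hd hw he
  refine ⟨D, ?_, fun z hz => ?_⟩
  · rw [hDn]
    have : (n : ℝ) ≤ N := by exact_mod_cast hn
    nlinarith [mul_nonneg hC0 hT]
  · rw [hDℓ]
    rw [Metric.mem_closedBall, dist_eq_norm] at hz
    refine (hb z (by rw [Metric.mem_ball, dist_eq_norm]; linarith)).trans ?_
    rw [div_le_iff₀ (by linarith)]
    have hx := norm_nonneg (z - c)
    have h5 : 2 * ((N : ℝ) + 1) * ‖z - c‖ ≤ 4 * (N + 1) := by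
      have : (0 : ℝ) ≤ N := N.cast_nonneg
      nlinarith
    have h6 : 4 * ((N : ℝ) + 1) ≤ 4 * (20 * C + 6) * (1 + |T|) := by nlinarith
    have h7 : 0 ≤ 4 * (20 * C + 6) * (1 + |T|) := by positivity
    nlinarith

/-- Everything is measured from the centre, where `log ζ` is bounded and each `log (c - w i)` is
too. The distances to the singularities are bounded below by differences of imaginary parts in the
first estimate, for vertical paths, and of real parts in the second, for horizontal ones. -/
lemma ZetaLocalLog.exists_branch_bound : ∃ A : ℝ, 0 ≤ A ∧ ∀ T : ℝ, ∃ D : ZetaLocalLog T 3,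
    (D.n : ℝ) ≤ A * (1 + |T|) ∧ ∀ s ∈ Metric.closedBall (2 + T * Complex.I) 2,
      (s.im ≠ 0 → (∀ i, (D.w i).im ≠ s.im) →
        ‖D.branch s‖ ≤ A * (1 + |T|) + (∑ i, logBump (s.im - (D.w i).im) + logBump s.im)) ∧
      (s.re ≠ 1 → (∀ i, (D.w i).re ≠ s.re) →
        ‖D.branch s‖ ≤ A * (1 + |T|) +
          (∑ i, logBump (s.re - (D.w i).re) + logBump (s.re - 1))) := by
  obtain ⟨C, hC0, hC⟩ := ZetaLocalLog.exists_bounded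
  refine ⟨40 + 17 * C, by positivity, fun T => ?_⟩
  obtain ⟨D, hDn, hDℓ⟩ := hC T
  set c : ℂ := 2 + T * Complex.I with hcdef
  have hcre : c.re = 2 := by simp [hcdef]
  have hT := abs_nonneg T
  have hpi := Real.pi_lt_four
  refine ⟨D, hDn.trans (by gcongr; linarith), fun s hs => ?_⟩
  have hs' : ‖s - c‖ ≤ 2 := by rwa [Metric.mem_closedBall, dist_eq_norm] at hs
  have hcw : ∀ i, ‖Complex.log (c - D.w i)‖ ≤ 7 := by
    intro i
    have h1 : 1 ≤ ‖c - D.w i‖ := by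
      refine le_trans ?_ (Complex.abs_re_le_norm _)
      rw [Complex.sub_re, hcre]
      refine le_trans ?_ (le_abs_self _)
      linarith [D.re_zero_lt_one i]
    have h2 : ‖c - D.w i‖ ≤ 3 := by
      have := D.mem i
      rwa [Metric.mem_closedBall, dist_comm, dist_eq_norm] at this
    refine (norm_clog_le _).trans ?_
    rw [abs_of_nonneg (Real.log_nonneg h1)]
    have := Real.log_le_sub_one_of_pos (by linarith : 0 < ‖c - D.w i‖)
    linarith
  have hc1n : ‖c - 1‖ ≤ 1 + |T| := by
    rw [show c - 1 = 1 + T * Complex.I by rw [hcdef]; ring]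
    refine (norm_add_le _ _).trans ?_
    simp
  have hc1 : ‖Complex.log (c - 1)‖ ≤ 4 + |T| := by
    have h1 : 1 ≤ ‖c - 1‖ := by
      refine le_trans ?_ (Complex.abs_re_le_norm _)
      rw [Complex.sub_re, hcre]; norm_num
    refine (norm_clog_le _).trans ?_
    rw [abs_of_nonneg (Real.log_nonneg h1)]
    have := Real.log_le_sub_one_of_pos (by linarith : 0 < ‖c - 1‖)
    linarith
  have hcz : ‖Complex.log (riemannZeta c)‖ ≤ 8 := by
    refine (norm_log_riemannZeta_le_exp hcre.ge).trans ?_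
    have := Real.exp_le_one_iff.2 (by rw [hcre]; norm_num : -(1 / 2) * c.re ≤ 0)
    linarith
  have hcb : ‖D.branch s - D.branch c‖ ≤ C * (1 + |T|) +
      (∑ i, (‖Complex.log (s - D.w i)‖ + 7)) + (‖Complex.log (s - 1)‖ + (4 + |T|)) := by
    have e : D.branch s - D.branch c = (D.ℓ s - D.ℓ c) +
        (∑ i, (Complex.log (s - D.w i) - Complex.log (c - D.w i))) -
        (Complex.log (s - 1) - Complex.log (c - 1)) := by
      simp only [ZetaLocalLog.branch, Finset.sum_sub_distrib]; ring
    rw [e]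
    refine (norm_sub_le _ _).trans (add_le_add ((norm_add_le _ _).trans
      (add_le_add (hDℓ s hs) ?_)) ((norm_sub_le _ _).trans (add_le_add le_rfl hc1)))
    refine (norm_sum_le _ _).trans (Finset.sum_le_sum fun i _ => ?_)
    exact (norm_sub_le _ _).trans (add_le_add le_rfl (hcw i))
  have hbc : ‖D.branch c‖ ≤ 8 := by
    have : D.branch c = Complex.log (riemannZeta c) := D.center
    rwa [this]
  have hsw : ∀ i, ‖s - D.w i‖ ≤ 5 := by
    intro i
    have := D.mem i
    rw [Metric.mem_closedBall, dist_comm, dist_eq_norm] at this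
    have h2 := norm_sub_le_norm_sub_add_norm_sub s c (D.w i)
    linarith
  have hs1 : ‖s - 1‖ ≤ 3 + |T| := by
    have h2 := norm_sub_le_norm_sub_add_norm_sub s c 1
    linarith
  have main : ∀ (x : Fin D.n → ℝ) (y : ℝ), (∀ i, x i ≠ 0 ∧ |x i| ≤ ‖s - D.w i‖) →
      y ≠ 0 → |y| ≤ ‖s - 1‖ → ‖D.branch s‖ ≤ (40 + 17 * C) * (1 + |T|) +
        (∑ i, logBump (x i) + logBump y) := by
    intro x y hx hy hy'
    have h1 := norm_le_norm_sub_add (D.branch s) (D.branch c)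
    have h2 : ∑ i, (‖Complex.log (s - D.w i)‖ + 7) ≤ ∑ i, (logBump (x i) + 16) := by
      refine Finset.sum_le_sum fun i _ => ?_
      have e1 := norm_clog_le (s - D.w i)
      have e2 := abs_log_norm_le_add_logBump (hx i).1 (hx i).2
      linarith [hsw i]
    rw [Finset.sum_add_distrib (f := fun i => logBump (x i)), Finset.sum_const,
      Finset.card_univ, Fintype.card_fin, nsmul_eq_mul] at h2
    have h3 : ‖Complex.log (s - 1)‖ ≤ 7 + |T| + logBump y := by
      have e1 := norm_clog_le (s - 1)
      have e2 := abs_log_norm_le_add_logBump hy hy'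
      linarith
    nlinarith
  refine ⟨fun h0 hw => ?_, fun h1 hw => ?_⟩
  · refine main _ _ (fun i => ⟨sub_ne_zero.2 (hw i).symm, ?_⟩) h0 ?_
    · simpa using Complex.abs_im_le_norm (s - D.w i)
    · simpa using Complex.abs_im_le_norm (s - 1)
  · refine main _ _ (fun i => ⟨sub_ne_zero.2 (hw i).symm, ?_⟩) (sub_ne_zero.2 h1) ?_
    · simpa using Complex.abs_re_le_norm (s - D.w i)
    · simpa using Complex.abs_re_le_norm (s - 1)

/-! ### Integrability along vertical and horizontal rays -/

lemma countable_riemannZeta₁_zeros : {s : ℂ | riemannZeta₁ s = 0}.Countable := by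
  have h : {s : ℂ | riemannZeta₁ s = 0} = riemannZetaZeros := by
    ext s
    have := riemannZeta₁_ne_zero_iff s
    simp only [mem_ofPred_eq, mem_riemannZetaZeros]
    tauto
  rw [h]
  exact (HereditarilyLindelofSpace.isLindelof _).countable_of_isDiscrete isDiscrete_riemannZetaZeros

/-- The ordinates of the zeros, which are excluded as heights of contours. -/
def zetaOrdinates : Set ℝ := Complex.im '' {s : ℂ | riemannZeta₁ s = 0}

lemma countable_zetaOrdinates : zetaOrdinates.Countable := countable_riemannZeta₁_zeros.image _

lemma ZetaLocalLog.im_ne {T r : ℝ} (D : ZetaLocalLog T r) {t : ℝ} (ht : t ∉ zetaOrdinates)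
    (i : Fin D.n) : (D.w i).im ≠ t := fun h => ht ⟨D.w i, D.zero i, h⟩

lemma exists_notMem_zetaOrdinates (n : ℕ) : ∃ t ∈ Ioo (n : ℝ) (n + 1), t ∉ zetaOrdinates := by
  by_contra h
  push Not at h
  have := (countable_zetaOrdinates.mono h).measure_zero volume
  simp at this

lemma ae_notMem_zetaOrdinates : ∀ᵐ t : ℝ, t ∉ zetaOrdinates :=
  measure_eq_zero_iff_ae_notMem.1 (countable_zetaOrdinates.measure_zero volume)

lemma mem_closedBall_of_abs_le {z c : ℂ} {r x y : ℝ} (hr : 0 ≤ r) (hx : |z.re - c.re| ≤ x)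
    (hy : |z.im - c.im| ≤ y) (h : x ^ 2 + y ^ 2 ≤ r ^ 2) : z ∈ Metric.closedBall c r := by
  rw [Metric.mem_closedBall, dist_eq_norm]
  refine abs_le_of_sq_le_sq' ?_ hr |>.2
  rw [← Complex.normSq_eq_norm_sq, Complex.normSq_apply, Complex.sub_re, Complex.sub_im]
  have h1 := sq_le_sq' (by linarith [neg_abs_le (z.re - c.re)]) ((le_abs_self _).trans hx)
  have h2 := sq_le_sq' (by linarith [neg_abs_le (z.im - c.im)]) ((le_abs_self _).trans hy)
  nlinarith

lemma integral_logBump_sub_le (v : ℝ) (S : Set ℝ) :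
    ∫ t in S, logBump (t - v) ≤ ∫ t, logBump t := by
  refine (setIntegral_le_integral (integrable_logBump.comp_sub_right v)
    (Eventually.of_forall fun _ => logBump_nonneg _)).trans (le_of_eq ?_)
  exact integral_sub_right_eq_self logBump v

lemma ZetaLocalLog.aestronglyMeasurable_branch_comp {T r : ℝ} (D : ZetaLocalLog T r) {γ : ℝ → ℂ}
    (hγ : Continuous γ) {S : Set ℝ} (hS : MeasurableSet S)
    (h : ∀ t ∈ S, γ t ∈ Metric.ball (2 + T * Complex.I) r) :
    AEStronglyMeasurable (fun t => D.branch (γ t)) (volume.restrict S) := by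
  refine AEStronglyMeasurable.sub (AEStronglyMeasurable.add ?_ ?_) ?_
  · exact (D.diff.continuousOn.comp hγ.continuousOn h).aestronglyMeasurable hS
  · refine Finset.aestronglyMeasurable_fun_sum _ fun i _ => ?_
    exact (Complex.measurable_log.comp
      (hγ.measurable.sub measurable_const)).aestronglyMeasurable
  · exact (Complex.measurable_log.comp
      (hγ.measurable.sub measurable_const)).aestronglyMeasurable

/-- Absolute convergence of the integrals over the vertical ray. -/
lemma integrableOn_exp_mul_zetaLog {a b : ℝ} (ha : 0 < a) (hb : 1 / 2 ≤ b) (hb1 : b < 1) :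
    IntegrableOn (fun t : ℝ => (Real.exp (-a * t) : ℂ) * zetaLog (b + t * Complex.I)) (Ioi 0) := by
  obtain ⟨A, hA0, hA⟩ := ZetaLocalLog.exists_branch_bound
  set κ : ℝ := ∫ t, logBump t with hκ
  have hκ0 : 0 ≤ κ := integral_nonneg logBump_nonneg
  set f : ℝ → ℂ := fun t => (Real.exp (-a * t) : ℂ) * zetaLog (b + t * Complex.I) with hf
  -- Each unit interval has its own disc. There are `O(1 + n)` singularities, each with the same
  -- finite integral, so the pieces are dominated by the summable `(1 + n) exp (-a n)`.
  have key : ∀ n : ℕ, IntegrableOn f (Ioc (n : ℝ) (n + 1)) ∧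
      ∫ t in Ioc (n : ℝ) (n + 1), ‖f t‖ ≤
        (A + A * κ + κ) * ((1 + (n : ℝ)) * Real.exp (-a * n)) := by
    intro n
    obtain ⟨D, hDn, hD⟩ := hA n
    rw [abs_of_nonneg n.cast_nonneg] at hDn hD
    have hball : ∀ t ∈ Ioc (n : ℝ) (n + 1),
        (b + t * Complex.I : ℂ) ∈ Metric.closedBall (2 + ((n : ℝ) : ℂ) * Complex.I) 2 := by
      intro t ht
      refine mem_closedBall_of_abs_le (x := 3 / 2) (y := 1) (by norm_num) ?_ ?_ (by norm_num)
      · simp only [Complex.add_re, Complex.ofReal_re, Complex.mul_re, Complex.I_re, mul_zero,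
          Complex.ofReal_im, Complex.I_im, mul_one, sub_self, add_zero, Complex.re_ofNat]
        rw [abs_le]; constructor <;> linarith
      · simp
        rw [abs_le]; constructor <;> linarith [ht.1, ht.2]
    have heq : ∀ᵐ t : ℝ, t ∈ Ioc (n : ℝ) (n + 1) →
        zetaLog (b + t * Complex.I) = D.branch (b + t * Complex.I) ∧
        ‖f t‖ ≤ Real.exp (-a * n) * (A * (1 + (n : ℝ)) +
          (∑ i, logBump (t - (D.w i).im) + logBump t)) := by
      filter_upwards [ae_notMem_zetaOrdinates] with t ht htm
      have ht0 : 0 < t := (n.cast_nonneg (α := ℝ)).trans_lt htm.1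
      have him : (b + t * Complex.I : ℂ).im = t := by simp
      have h1 : zetaLog (b + t * Complex.I) = D.branch (b + t * Complex.I) :=
        D.zetaLog_eq_branch (Metric.closedBall_subset_ball (by norm_num) (hball t htm))
          (by rw [him]; exact ht0.ne') (by rw [him]; exact D.im_ne ht)
      refine ⟨h1, ?_⟩
      have h2 := (hD _ (hball t htm)).1 (by rw [him]; exact ht0.ne') (by rw [him]; exact D.im_ne ht)
      rw [him] at h2
      rw [hf]
      simp only []
      rw [norm_mul, Complex.norm_real, Real.norm_of_nonneg (Real.exp_pos _).le, h1]
      have h3 : Real.exp (-a * t) ≤ Real.exp (-a * n) := by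
        rw [Real.exp_le_exp]; nlinarith [htm.1]
      gcongr
    have heq' := (ae_restrict_iff' measurableSet_Ioc).2 heq
    have hsum : IntegrableOn (fun t => ∑ i, logBump (t - (D.w i).im)) (Ioc (n : ℝ) (n + 1)) :=
      integrable_finsetSum _ fun i _ => (integrable_logBump.comp_sub_right _).integrableOn
    have hsk : IntegrableOn (fun t => ∑ i, logBump (t - (D.w i).im) + logBump t)
        (Ioc (n : ℝ) (n + 1)) := hsum.add integrable_logBump.integrableOn
    have hg : IntegrableOn (fun t => Real.exp (-a * n) * (A * (1 + (n : ℝ)) +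
        (∑ i, logBump (t - (D.w i).im) + logBump t))) (Ioc (n : ℝ) (n + 1)) :=
      Integrable.const_mul ((integrable_const _).add hsk) _
    have hint : IntegrableOn f (Ioc (n : ℝ) (n + 1)) := by
      refine Integrable.mono' hg ?_ (heq'.mono fun t ht => ht.2)
      refine AEStronglyMeasurable.mul (by fun_prop) ?_
      refine (D.aestronglyMeasurable_branch_comp (γ := fun t : ℝ => b + t * Complex.I) (by fun_prop)
        measurableSet_Ioc fun t ht =>
          Metric.closedBall_subset_ball (by norm_num) (hball t ht)).congr ?_
      exact heq'.mono fun t ht => ht.1.symm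
    refine ⟨hint, (integral_mono_ae hint.norm hg (heq'.mono fun t ht => ht.2)).trans ?_⟩
    rw [integral_const_mul, integral_add (integrable_const _) hsk,
      integral_add hsum integrable_logBump.integrableOn,
      integral_finsetSum _ fun i _ => (integrable_logBump.comp_sub_right _).integrableOn]
    have h1 : ∑ i, ∫ t in Ioc (n : ℝ) (n + 1), logBump (t - (D.w i).im) ≤ D.n * κ := by
      refine (Finset.sum_le_sum fun i _ => integral_logBump_sub_le _ _).trans ?_
      simp [hκ]
    have h2 : ∫ t in Ioc (n : ℝ) (n + 1), logBump t ≤ κ := by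
      simpa using integral_logBump_sub_le 0 (Ioc (n : ℝ) (n + 1))
    have h3 : (D.n : ℝ) * κ ≤ A * (1 + n) * κ := by gcongr
    have h4 : ∫ _ in Ioc (n : ℝ) (n + 1), A * (1 + (n : ℝ)) = A * (1 + n) := by simp
    rw [h4]
    have he := Real.exp_pos (-a * n)
    have h5 : A * (1 + (n : ℝ)) + ((∑ i, ∫ t in Ioc (n : ℝ) (n + 1), logBump (t - (D.w i).im)) +
        ∫ t in Ioc (n : ℝ) (n + 1), logBump t) ≤ (A + A * κ + κ) * (1 + n) := by
      nlinarith [mul_nonneg hκ0 (n.cast_nonneg (α := ℝ))]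
    calc _ ≤ Real.exp (-a * n) * ((A + A * κ + κ) * (1 + n)) :=
          mul_le_mul_of_nonneg_left h5 he.le
      _ = _ := by ring
  have hU : IntegrableOn f (⋃ n : ℕ, Ioc (n : ℝ) (n + 1)) := by
    refine integrableOn_iUnion_of_summable_integral_norm (fun n => (key n).1) ?_
    refine .of_nonneg_of_le (fun n => integral_nonneg fun _ => norm_nonneg _)
      (fun n => (key n).2) (Summable.mul_left _ ?_)
    have h0 := Real.summable_pow_mul_exp_neg_nat_mul 0 ha
    have h1 := Real.summable_pow_mul_exp_neg_nat_mul 1 ha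
    refine (h0.add h1).congr fun n => ?_
    ring
  refine hU.mono_set fun t (ht : 0 < t) => ?_
  obtain ⟨m, hm⟩ := Nat.exists_eq_succ_of_ne_zero (Nat.ceil_pos.2 ht).ne'
  have h1 := Nat.le_ceil t
  have h2 := Nat.ceil_lt_add_one ht.le
  rw [hm] at h1 h2
  push_cast at h1 h2
  exact mem_iUnion.2 ⟨m, by linarith, h1⟩

/-- On a horizontal ray, `log ζ` has an integrable majorant whose integral grows at most linearly
with the height. -/
lemma exists_horizontal_majorant {b : ℝ} (hb : 1 / 2 ≤ b) (hb1 : b < 1) :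
    ∃ B : ℝ, 0 ≤ B ∧ ∀ T : ℝ, ∃ G : ℝ → ℝ, IntegrableOn G (Ioi 0) ∧ (∀ x, 0 ≤ G x) ∧
      ∫ x in Ioi 0, G x ≤ B * (1 + |T|) ∧ ∀ᵐ x : ℝ, 0 < x →
        |Real.log ‖riemannZeta (b + x + T * Complex.I)‖| ≤ G x ∧
        (T ≠ 0 → T ∉ zetaOrdinates → ‖zetaLog (b + x + T * Complex.I)‖ ≤ G x) := by
  obtain ⟨A, hA0, hA⟩ := ZetaLocalLog.exists_branch_bound
  set κ : ℝ := ∫ t, logBump t with hκ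
  have hκ0 : 0 ≤ κ := integral_nonneg logBump_nonneg
  have hexp : IntegrableOn (fun x : ℝ => 8 * Real.exp (-(1 / 2) * x)) (Ioi 0) :=
    (exp_neg_integrableOn_Ioi 0 (by norm_num)).const_mul 8
  set K : ℝ := ∫ x in Ioi 0, 8 * Real.exp (-(1 / 2) * x) with hK
  have hK0 : 0 ≤ K := integral_nonneg fun x => by positivity
  refine ⟨2 * A + A * κ + κ + K, by positivity, fun T => ?_⟩
  obtain ⟨D, hDn, hD⟩ := hA T
  have hT := abs_nonneg T
  have hsum : Integrable fun x => ∑ i, logBump (x - ((D.w i).re - b)) :=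
    integrable_finsetSum _ fun i _ => integrable_logBump.comp_sub_right _
  have hκi : Integrable fun x => logBump (x - (1 - b)) := integrable_logBump.comp_sub_right _
  have hind : IntegrableOn ((Ioc (0 : ℝ) 2).indicator fun _ => A * (1 + |T|)) (Ioi 0) := by
    refine Integrable.integrableOn ?_
    rw [integrable_indicator_iff measurableSet_Ioc]
    exact continuous_const.integrableOn_Ioc
  have hsk : IntegrableOn (fun x => ∑ i, logBump (x - ((D.w i).re - b)) + logBump (x - (1 - b)))
      (Ioi 0) := (hsum.add hκi).integrableOn
  have hisk : IntegrableOn (fun x => (Ioc (0 : ℝ) 2).indicator (fun _ => A * (1 + |T|)) x +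
      (∑ i, logBump (x - ((D.w i).re - b)) + logBump (x - (1 - b)))) (Ioi 0) := hind.add hsk
  have hsum0 : ∀ x, 0 ≤ ∑ i, logBump (x - ((D.w i).re - b)) := fun x =>
    Finset.sum_nonneg fun i _ => logBump_nonneg _
  have hind0 : ∀ x, 0 ≤ (Ioc (0 : ℝ) 2).indicator (fun _ => A * (1 + |T|)) x := fun x =>
    indicator_nonneg (fun _ _ => by positivity) x
  -- The local bound is needed only while `b + x < 2`, hence on `(0, 2]`; the exponential covers the
  -- rest of the ray, where `ζ` is close to `1`.
  refine ⟨fun x => (Ioc (0 : ℝ) 2).indicator (fun _ => A * (1 + |T|)) x +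
    (∑ i, logBump (x - ((D.w i).re - b)) + logBump (x - (1 - b))) +
    8 * Real.exp (-(1 / 2) * x), hisk.add hexp, ?_, ?_, ?_⟩
  · intro x
    have := hsum0 x
    have := hind0 x
    have := logBump_nonneg (x - (1 - b))
    positivity
  · beta_reduce
    rw [integral_add hisk hexp, integral_add hind hsk,
      integral_add hsum.integrableOn hκi.integrableOn,
      integral_finsetSum _ fun i _ => (integrable_logBump.comp_sub_right _).integrableOn]
    have h1 : ∑ i, ∫ x in Ioi 0, logBump (x - ((D.w i).re - b)) ≤ D.n * κ := by
      refine (Finset.sum_le_sum fun i _ => integral_logBump_sub_le _ _).trans ?_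
      simp [hκ]
    have h2 : ∫ x in Ioi 0, logBump (x - (1 - b)) ≤ κ := integral_logBump_sub_le _ _
    have h3 : (D.n : ℝ) * κ ≤ A * (1 + |T|) * κ := by gcongr
    have h4 : ∫ x in Ioi 0, (Ioc (0 : ℝ) 2).indicator (fun _ => A * (1 + |T|)) x =
        2 * (A * (1 + |T|)) := by
      rw [setIntegral_indicator measurableSet_Ioc,
        inter_eq_self_of_subset_right (fun x hx => hx.1)]
      simp
    rw [h4]
    nlinarith [mul_nonneg hκ0 hT, mul_nonneg hK0 hT]
  -- The finitely many abscissae of the singularities in the disc are discarded.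
  · have hfin : ∀ᵐ x : ℝ, x ∉ insert (1 - b) (range fun i => (D.w i).re - b) :=
      measure_eq_zero_iff_ae_notMem.1 (((finite_range _).insert _).measure_zero volume)
    filter_upwards [hfin] with x hx hx0
    set s : ℂ := b + x + T * Complex.I with hs
    have hre : s.re = b + x := by simp [hs]
    have him : s.im = T := by simp [hs]
    have hlogre : ∀ z : ℂ, Complex.exp z = riemannZeta s → Real.log ‖riemannZeta s‖ = z.re := by
      intro z hz; rw [← hz, Complex.norm_exp, Real.log_exp]
    rcases le_or_gt 2 s.re with h2 | h2
    · have hn := norm_log_riemannZeta_le_exp h2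
      have hexple : Real.exp (-(1 / 2) * s.re) ≤ Real.exp (-(1 / 2) * x) := by
        rw [Real.exp_le_exp, hre]; linarith
      have hle : ‖Complex.log (riemannZeta s)‖ ≤
          (Ioc (0 : ℝ) 2).indicator (fun _ => A * (1 + |T|)) x +
          (∑ i, logBump (x - ((D.w i).re - b)) + logBump (x - (1 - b))) +
          8 * Real.exp (-(1 / 2) * x) := by
        linarith [hsum0 x, hind0 x, logBump_nonneg (x - (1 - b))]
      refine ⟨?_, fun _ _ => ?_⟩
      · rw [hlogre _ (Complex.exp_log (Complex.slitPlane_ne_zero (riemannZeta_mem_slitPlane h2)))]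
        exact (Complex.abs_re_le_norm _).trans hle
      · rw [zetaLog_of_two_le_re h2]; exact hle
    · have hball : s ∈ Metric.closedBall (2 + T * Complex.I) 2 := by
        refine mem_closedBall_of_abs_le (x := 3 / 2) (y := 1) (by norm_num) ?_ ?_ (by norm_num)
        · rw [hre]
          simp
          rw [abs_le]; constructor <;> linarith
        · simp [hs]
      have hsb := Metric.closedBall_subset_ball (by norm_num : (2 : ℝ) < 3) hball
      have hne1 : s.re ≠ 1 := by
        intro h; exact hx (mem_insert_iff.2 (Or.inl (by linarith)))
      have hnew : ∀ i, (D.w i).re ≠ s.re := by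
        intro i h; exact hx (mem_insert_of_mem _ (mem_range.2 ⟨i, by linarith⟩))
      have hle := (hD s hball).2 hne1 hnew
      have hind1 : (Ioc (0 : ℝ) 2).indicator (fun _ => A * (1 + |T|)) x = A * (1 + |T|) :=
        indicator_of_mem (show x ∈ Ioc (0 : ℝ) 2 from ⟨hx0, by linarith⟩) _
      have hle' : ‖D.branch s‖ ≤
          (Ioc (0 : ℝ) 2).indicator (fun _ => A * (1 + |T|)) x +
          (∑ i, logBump (x - ((D.w i).re - b)) + logBump (x - (1 - b))) +
          8 * Real.exp (-(1 / 2) * x) := by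
        rw [hind1]
        have e1 : ∀ i, s.re - (D.w i).re = x - ((D.w i).re - b) := fun i => by rw [hre]; ring
        have e2 : s.re - 1 = x - (1 - b) := by rw [hre]; ring
        simp_rw [e1, e2] at hle
        linarith [Real.exp_pos (-(1 / 2) * x)]
      refine ⟨?_, fun hT0 hTo => ?_⟩
      · rw [hlogre _ (D.exp_branch hsb (fun h => hne1 (by rw [h]; simp))
          fun i h => hnew i (by rw [h]))]
        exact (Complex.abs_re_le_norm _).trans hle'
      · rw [D.zetaLog_eq_branch hsb (by rwa [him]) (by rw [him]; exact D.im_ne hTo)]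
        exact hle'

/-! ### Rectangle integrals and Cauchy's theorem with a logarithmic singularity -/

/-- The integral of `f` over the boundary of the rectangle `[0, X] × [c, d]`. -/
def rectIntegral (f : ℂ → ℂ) (X c d : ℝ) : ℂ :=
  (∫ x : ℝ in 0..X, f (x + c * Complex.I)) - (∫ x : ℝ in 0..X, f (x + d * Complex.I)) +
    Complex.I * (∫ y : ℝ in c..d, f (X + y * Complex.I)) -
    Complex.I * ∫ y : ℝ in c..d, f (y * Complex.I)

/-- `f` is integrable along the four edges of the rectangle `[0, X] × [c, d]`. -/
def RectIntegrable (f : ℂ → ℂ) (X c d : ℝ) : Prop :=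
  IntervalIntegrable (fun x : ℝ => f (x + c * Complex.I)) volume 0 X ∧
  IntervalIntegrable (fun x : ℝ => f (x + d * Complex.I)) volume 0 X ∧
  IntervalIntegrable (fun y : ℝ => f (X + y * Complex.I)) volume c d ∧
  IntervalIntegrable (fun y : ℝ => f (y * Complex.I)) volume c d

lemma RectIntegrable.add {f g : ℂ → ℂ} {X c d : ℝ} (hf : RectIntegrable f X c d)
    (hg : RectIntegrable g X c d) : RectIntegrable (fun z => f z + g z) X c d :=
  ⟨hf.1.add hg.1, hf.2.1.add hg.2.1, hf.2.2.1.add hg.2.2.1, hf.2.2.2.add hg.2.2.2⟩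

lemma RectIntegrable.sum {ι : Type*} (s : Finset ι) {f : ι → ℂ → ℂ} {X c d : ℝ}
    (hf : ∀ i ∈ s, RectIntegrable (f i) X c d) :
    RectIntegrable (fun z => ∑ i ∈ s, f i z) X c d := by
  classical
  induction s using Finset.induction_on with
  | empty => simp [RectIntegrable]
  | insert i s hi ih =>
    simp_rw [Finset.sum_insert hi]
    exact (hf i (Finset.mem_insert_self _ _)).add
      (ih fun j hj => hf j (Finset.mem_insert_of_mem hj))

lemma rectIntegral_add {f g : ℂ → ℂ} {X c d : ℝ} (hf : RectIntegrable f X c d)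
    (hg : RectIntegrable g X c d) :
    rectIntegral (fun z => f z + g z) X c d = rectIntegral f X c d + rectIntegral g X c d := by
  simp only [rectIntegral]
  rw [intervalIntegral.integral_add hf.1 hg.1, intervalIntegral.integral_add hf.2.1 hg.2.1,
    intervalIntegral.integral_add hf.2.2.1 hg.2.2.1, intervalIntegral.integral_add hf.2.2.2 hg.2.2.2]
  ring

lemma rectIntegral_sub {f g : ℂ → ℂ} {X c d : ℝ} (hf : RectIntegrable f X c d)
    (hg : RectIntegrable g X c d) :
    rectIntegral (fun z => f z - g z) X c d = rectIntegral f X c d - rectIntegral g X c d := by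
  simp only [rectIntegral]
  rw [intervalIntegral.integral_sub hf.1 hg.1, intervalIntegral.integral_sub hf.2.1 hg.2.1,
    intervalIntegral.integral_sub hf.2.2.1 hg.2.2.1, intervalIntegral.integral_sub hf.2.2.2 hg.2.2.2]
  ring

lemma rectIntegral_sum {ι : Type*} (s : Finset ι) {f : ι → ℂ → ℂ} {X c d : ℝ}
    (hf : ∀ i ∈ s, RectIntegrable (f i) X c d) :
    rectIntegral (fun z => ∑ i ∈ s, f i z) X c d = ∑ i ∈ s, rectIntegral (f i) X c d := by
  classical
  induction s using Finset.induction_on with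
  | empty => simp [rectIntegral]
  | insert i s hi ih =>
    simp_rw [Finset.sum_insert hi]
    rw [rectIntegral_add (hf i (Finset.mem_insert_self _ _))
      (RectIntegrable.sum s fun j hj => hf j (Finset.mem_insert_of_mem hj)),
      ih fun j hj => hf j (Finset.mem_insert_of_mem hj)]

lemma rectIntegral_eq_zero {f : ℂ → ℂ} {X c d : ℝ} {s : Set ℂ} (hs : s.Countable) (hX : 0 ≤ X)
    (hcd : c ≤ d) (hc : ContinuousOn f (Icc 0 X ×ℂ Icc c d))
    (hd : ∀ z ∈ (Icc 0 X ×ℂ Icc c d) \ s, DifferentiableAt ℂ f z) :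
    rectIntegral f X c d = 0 := by
  have := Complex.integral_boundary_rect_eq_zero_of_differentiable_on_off_countable f
    (c * Complex.I) (X + d * Complex.I) s hs (by simpa [uIcc_of_le hX, uIcc_of_le hcd] using hc)
    (by
      intro z hz
      simp only [Complex.add_re, Complex.mul_re, Complex.ofReal_re, Complex.ofReal_im,
        Complex.I_re, Complex.I_im, mul_zero, mul_one, sub_self, add_zero,
        Complex.add_im, Complex.mul_im, zero_add, min_eq_left hX, max_eq_right hX,
        min_eq_left hcd, max_eq_right hcd] at hz
      exact hd z ⟨⟨Ioo_subset_Icc_self hz.1.1, Ioo_subset_Icc_self hz.1.2⟩, hz.2⟩)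
  simpa [rectIntegral] using this

/-- Logarithmic singularities are integrable along lines. -/
lemma intervalIntegrable_exp_mul_of_log_bound {a C : ℝ} {L : ℂ → ℂ} {w p q : ℂ} (hq : ‖q‖ = 1)
    (hL : Measurable L) (hb : ∀ z, ‖L z‖ ≤ |Real.log ‖z - w‖| + C) (α β : ℝ) :
    IntervalIntegrable (fun t : ℝ => Complex.exp (Complex.I * a * (p + t * q)) * L (p + t * q))
      volume α β := by
  have hcont : Continuous fun t : ℝ => Complex.exp (Complex.I * a * (p + t * q)) := by fun_prop
  suffices h : IntervalIntegrable (fun t : ℝ => L (p + t * q)) volume α β from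
    h.continuousOn_mul hcont.continuousOn
  -- The parameter of the foot of the perpendicular from `w` to the line, so the distance to `w` is
  -- at least `|t - t₀|`.
  set t₀ : ℝ := ((w - p) * (starRingEnd ℂ) q).re
  have hqq : q * (starRingEnd ℂ) q = 1 := by
    rw [Complex.mul_conj, Complex.normSq_eq_norm_sq, hq]; simp
  have hle : ∀ t : ℝ, |t - t₀| ≤ ‖p + t * q - w‖ := by
    intro t
    have h1 := Complex.abs_re_le_norm ((p + t * q - w) * (starRingEnd ℂ) q)
    have h2 : (p + t * q - w) * (starRingEnd ℂ) q = t - (w - p) * (starRingEnd ℂ) q := by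
      linear_combination t * hqq
    rw [h2, ← h2, norm_mul, Complex.norm_conj, hq, mul_one, h2] at h1
    simpa [t₀] using h1
  have hg : IntervalIntegrable (fun t : ℝ => ‖p + t * q - w‖ + logBump (t - t₀) + C) volume α β := by
    refine ((Continuous.intervalIntegrable (by fun_prop) _ _).add ?_).add
      (continuous_const.intervalIntegrable _ _)
    exact (integrable_logBump.comp_sub_right t₀).intervalIntegrable
  refine hg.mono_fun' ?_ ?_
  · exact (hL.comp (by fun_prop)).aestronglyMeasurable
  · have hne : ∀ᵐ t : ℝ, t ≠ t₀ :=
      measure_eq_zero_iff_ae_notMem.1 ((countable_singleton t₀).measure_zero volume)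
    filter_upwards [ae_restrict_of_ae hne] with t ht
    have := abs_log_norm_le_add_logBump (sub_ne_zero.2 ht) (hle t)
    linarith [hb (p + t * q)]

lemma rectIntegrable_exp_mul_of_log_bound {a C : ℝ} {L : ℂ → ℂ} {w : ℂ}
    (hL : Measurable L) (hb : ∀ z, ‖L z‖ ≤ |Real.log ‖z - w‖| + C) (X c d : ℝ) :
    RectIntegrable (fun z => Complex.exp (Complex.I * a * z) * L z) X c d := by
  have h := fun p q hq α β => intervalIntegrable_exp_mul_of_log_bound (a := a) (p := p) (q := q)
    hq hL hb α β
  refine ⟨?_, ?_, ?_, ?_⟩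
  · simpa [add_comm] using h (c * Complex.I) 1 (by simp) 0 X
  · simpa [add_comm] using h (d * Complex.I) 1 (by simp) 0 X
  · exact h X Complex.I (by simp) c d
  · simpa using h 0 Complex.I (by simp) c d

/-- An antiderivative of `z ↦ log (e (z - w)) + k`. -/
def logPrimitive (e w k z : ℂ) : ℂ := (z - w) * (Complex.log (e * (z - w)) + k) - (z - w)

lemma mul_mem_slitPlane {e z : ℂ} (he : ‖e‖ = 1) (hz : z ≠ 0) (h : 0 ≤ (e * z).re) :
    e * z ∈ Complex.slitPlane := by
  have h0 : e * z ≠ 0 := mul_ne_zero (by rintro rfl; simp at he) hz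
  rcases h.eq_or_lt with h1 | h1
  · right
    intro h2
    exact h0 (Complex.ext h1.symm h2)
  · exact Or.inl h1

lemma hasDerivAt_logPrimitive {e w k z : ℂ} (he : ‖e‖ = 1) (hz : z ≠ w)
    (h : 0 ≤ (e * (z - w)).re) :
    HasDerivAt (logPrimitive e w k) (Complex.log (e * (z - w)) + k) z := by
  have hzw : z - w ≠ 0 := sub_ne_zero.2 hz
  have he0 : e ≠ 0 := by rintro rfl; simp at he
  have h1 : HasDerivAt (fun z => z - w) 1 z := (hasDerivAt_id z).sub_const w
  have h2 : HasDerivAt (fun z => e * (z - w)) (e * 1) z := h1.const_mul e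
  have h3 := (h2.clog (mul_mem_slitPlane he hzw h)).add_const k
  have h4 := (h1.mul h3).sub h1
  convert! h4 using 1
  field_simp
  ring

/-- One integration removes the singularity, since `u log u → 0`. This is what allows `w` to lie on
the contour itself. -/
lemma continuousAt_logPrimitive_self {e w k : ℂ} (he : ‖e‖ = 1) :
    ContinuousAt (logPrimitive e w k) w := by
  have h0 : logPrimitive e w k w = 0 := by simp [logPrimitive]
  rw [ContinuousAt, h0]
  have hlim : Tendsto (fun z : ℂ => |‖z - w‖ * Real.log ‖z - w‖| +
      ‖z - w‖ * (Real.pi + ‖k‖ + 1)) (𝓝 w) (𝓝 0) := by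
    have hn : Continuous fun z : ℂ => ‖z - w‖ := by fun_prop
    have hc : Continuous fun z : ℂ => |‖z - w‖ * Real.log ‖z - w‖| +
        ‖z - w‖ * (Real.pi + ‖k‖ + 1) :=
      (Real.continuous_mul_log.comp hn).abs.add (hn.mul_const (Real.pi + ‖k‖ + 1))
    simpa using hc.tendsto w
  refine squeeze_zero_norm (fun z => ?_) hlim
  have h1 := norm_clog_le (e * (z - w))
  rw [norm_mul, he, one_mul] at h1
  calc ‖logPrimitive e w k z‖ ≤ ‖z - w‖ * (‖Complex.log (e * (z - w))‖ + ‖k‖) + ‖z - w‖ := by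
        refine (norm_sub_le _ _).trans ?_
        rw [norm_mul]
        gcongr
        exact norm_add_le _ _
    _ ≤ ‖z - w‖ * ((|Real.log ‖z - w‖| + Real.pi) + ‖k‖) + ‖z - w‖ := by gcongr
    _ = _ := by rw [abs_mul, abs_norm]; ring

/-- Integration by parts along an edge replaces the singular `L` by the continuous `logPrimitive`.
The line meets `w` for at most one parameter, which the fundamental theorem may ignore. -/
lemma integral_exp_mul_log_edge {a : ℝ} {e w k p q : ℂ} {L : ℂ → ℂ} (he : ‖e‖ = 1) (hq : ‖q‖ = 1)
    {α β : ℝ} (hαβ : α ≤ β)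
    (hside : ∀ t ∈ Icc α β, 0 ≤ (e * (p + t * q - w)).re)
    (hL : ∀ z, z ≠ w → 0 ≤ (e * (z - w)).re → L z = Complex.log (e * (z - w)) + k)
    (hint : IntervalIntegrable
      (fun t : ℝ => Complex.exp (Complex.I * a * (p + t * q)) * L (p + t * q)) volume α β) :
    q * (∫ t in α..β, Complex.exp (Complex.I * a * (p + t * q)) * L (p + t * q)) =
      Complex.exp (Complex.I * a * (p + β * q)) * logPrimitive e w k (p + β * q) -
      Complex.exp (Complex.I * a * (p + α * q)) * logPrimitive e w k (p + α * q) -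
      Complex.I * a * (q * ∫ t in α..β,
        Complex.exp (Complex.I * a * (p + t * q)) * logPrimitive e w k (p + t * q)) := by
  have hq0 : q ≠ 0 := by rintro rfl; simp at hq
  set S : Set ℝ := {t | p + t * q = w} with hS
  have hSc : S.Countable := by
    refine Set.Subsingleton.countable fun x hx y hy => ?_
    simp only [hS, mem_ofPred_eq] at hx hy
    have : (x : ℂ) * q = y * q := by linear_combination hx - hy
    exact_mod_cast mul_right_cancel₀ hq0 this
  have hγ : ∀ t : ℝ, HasDerivAt (fun t : ℝ => p + t * q) q t := by
    intro t
    simpa using ((Complex.ofRealCLM.hasDerivAt (x := t)).mul_const q).const_add p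
  have hγc : Continuous fun t : ℝ => p + t * q := by fun_prop
  have hder : ∀ t ∈ Icc α β, t ∉ S → HasDerivAt (logPrimitive e w k)
      (L (p + t * q)) (p + t * q) := by
    intro t ht htS
    rw [hL _ htS (hside t ht)]
    exact hasDerivAt_logPrimitive he htS (hside t ht)
  have hPc : ContinuousOn (fun t : ℝ => logPrimitive e w k (p + t * q)) (Icc α β) := by
    intro t ht
    refine ContinuousAt.continuousWithinAt ?_
    refine ContinuousAt.comp (f := fun t : ℝ => p + t * q) (g := logPrimitive e w k) ?_
      hγc.continuousAt
    by_cases htS : t ∈ S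
    · have : p + t * q = w := htS
      rw [this]
      exact continuousAt_logPrimitive_self he
    · exact (hder t ht htS).continuousAt
  have hec : Continuous fun t : ℝ => Complex.exp (Complex.I * a * (p + t * q)) := by fun_prop
  have hPi : IntervalIntegrable (fun t : ℝ => Complex.exp (Complex.I * a * (p + t * q)) *
      logPrimitive e w k (p + t * q)) volume α β := by
    refine ContinuousOn.intervalIntegrable ?_
    rw [uIcc_of_le hαβ]
    exact hec.continuousOn.mul hPc
  have hFTC := integral_eq_of_hasDerivAt_off_countable
    (fun t : ℝ => Complex.exp (Complex.I * a * (p + t * q)) * logPrimitive e w k (p + t * q))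
    (fun t : ℝ => q * (Complex.exp (Complex.I * a * (p + t * q)) * L (p + t * q)) +
      Complex.I * a * q * (Complex.exp (Complex.I * a * (p + t * q)) *
        logPrimitive e w k (p + t * q))) (a := α) (b := β) hSc
    (by rw [uIcc_of_le hαβ]; exact hec.continuousOn.mul hPc)
    (by
      rw [min_eq_left hαβ, max_eq_right hαβ]
      rintro t ⟨ht, htS⟩
      have h1 := (hder t (Ioo_subset_Icc_self ht) htS).comp t (hγ t)
      have h2 := ((hγ t).const_mul (Complex.I * a)).cexp.mul h1
      convert! h2 using 1
      simp only [Function.comp_apply]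
      ring)
    ((hint.const_mul q).add (hPi.const_mul _))
  rw [intervalIntegral.integral_add (hint.const_mul q) (hPi.const_mul _),
    intervalIntegral.integral_const_mul, intervalIntegral.integral_const_mul] at hFTC
  linear_combination hFTC

/-- Cauchy's theorem for `exp (i a z) log (z - w)` on a rectangle contained in a closed half plane
with `w` on or outside its boundary line. -/
lemma rectIntegral_exp_mul_log_eq_zero {a C : ℝ} {e w k : ℂ} {L : ℂ → ℂ} (he : ‖e‖ = 1)
    (hLm : Measurable L) (hLb : ∀ z, ‖L z‖ ≤ |Real.log ‖z - w‖| + C)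
    (hL : ∀ z, z ≠ w → 0 ≤ (e * (z - w)).re → L z = Complex.log (e * (z - w)) + k)
    {X c d : ℝ} (hX : 0 ≤ X) (hcd : c ≤ d)
    (hside : ∀ z ∈ Icc 0 X ×ℂ Icc c d, 0 ≤ (e * (z - w)).re) :
    rectIntegral (fun z => Complex.exp (Complex.I * a * z) * L z) X c d = 0 := by
  have hmem : ∀ x ∈ Icc 0 X, ∀ y ∈ Icc c d, (x + y * Complex.I : ℂ) ∈ Icc 0 X ×ℂ Icc c d := by
    intro x hx y hy
    simpa [Complex.mem_reProdIm] using ⟨hx, hy⟩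
  have hI := rectIntegrable_exp_mul_of_log_bound (a := a) hLm hLb X c d
  have e1 := integral_exp_mul_log_edge (p := c * Complex.I) (q := 1) (k := k) he (by simp) hX
    (fun t ht => hside _ (by simpa [add_comm] using hmem t ht c ⟨le_rfl, hcd⟩)) hL
    (by simpa [add_comm] using hI.1)
  have e2 := integral_exp_mul_log_edge (p := d * Complex.I) (q := 1) (k := k) he (by simp) hX
    (fun t ht => hside _ (by simpa [add_comm] using hmem t ht d ⟨hcd, le_rfl⟩)) hL
    (by simpa [add_comm] using hI.2.1)
  have e3 := integral_exp_mul_log_edge (p := X) (q := Complex.I) (k := k) he (by simp) hcd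
    (fun t ht => hside _ (hmem X ⟨hX, le_rfl⟩ t ht)) hL hI.2.2.1
  have e4 := integral_exp_mul_log_edge (p := 0) (q := Complex.I) (k := k) he (by simp) hcd
    (fun t ht => hside _ (by simpa using hmem 0 ⟨le_rfl, hX⟩ t ht)) hL
    (by simpa using hI.2.2.2)
  have hdiff : ∀ z ∈ (Icc 0 X ×ℂ Icc c d) \ {w}, DifferentiableAt ℂ
      (fun z => Complex.exp (Complex.I * a * z) * logPrimitive e w k z) z := by
    rintro z ⟨hz, hzw⟩
    exact (by fun_prop : DifferentiableAt ℂ (fun z => Complex.exp (Complex.I * a * z)) z).mul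
      (hasDerivAt_logPrimitive he hzw (hside z hz)).differentiableAt
  have hP : rectIntegral (fun z => Complex.exp (Complex.I * a * z) * logPrimitive e w k z)
      X c d = 0 := by
    refine rectIntegral_eq_zero (countable_singleton w) hX hcd ?_ hdiff
    intro z hz
    by_cases hzw : z = w
    · subst hzw
      exact ((by fun_prop : ContinuousAt (fun z => Complex.exp (Complex.I * a * z)) z).mul
        (continuousAt_logPrimitive_self he)).continuousWithinAt
    · exact (hdiff z ⟨hz, hzw⟩).continuousAt.continuousWithinAt
  simp only [rectIntegral] at hP ⊢
  simp only [mul_one, one_mul, zero_add, add_comm (_ * Complex.I) (Complex.ofReal _),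
    Complex.ofReal_zero, add_zero] at e1 e2 e3 e4
  -- The endpoint terms of the four integrations by parts cancel at the corners.
  linear_combination e1 - e2 + e3 - e4 - Complex.I * a * hP

/-! ### The jump across the cut of a single zero -/

/-- A branch of the logarithm that is continuous on the closed lower half plane without `0`. -/
def lowerLog (z : ℂ) : ℂ := Complex.log (Complex.I * z) + -(Real.pi / 2 * Complex.I)

lemma log_eq_log_neg_I_mul {z : ℂ} (hz : z ≠ 0) (h : 0 ≤ z.im) :
    Complex.log z = Complex.log (-Complex.I * z) + Real.pi / 2 * Complex.I := by
  have hpi := Real.pi_pos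
  rw [(Complex.log_mul_eq_add_log_iff (neg_ne_zero.2 Complex.I_ne_zero) hz).2, Complex.log_neg_I]
  · ring
  · rw [Complex.arg_neg_I]
    have h1 := Complex.arg_nonneg_iff.2 h
    have h2 := Complex.arg_le_pi z
    constructor <;> linarith

lemma lowerLog_eq_log {z : ℂ} (h : z.im < 0) : lowerLog z = Complex.log z := by
  have hpi := Real.pi_pos
  have hz : z ≠ 0 := by rintro rfl; simp at h
  rw [lowerLog, (Complex.log_mul_eq_add_log_iff Complex.I_ne_zero hz).2, Complex.log_I]
  · ring
  · rw [Complex.arg_I]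
    have h1 := Complex.arg_neg_iff.2 h
    have h2 := Complex.neg_pi_lt_arg z
    constructor <;> linarith

/-- The principal logarithm takes the boundary value from above on its cut and `lowerLog` the one
from below, so the difference is the jump. -/
lemma log_sub_lowerLog_ofReal {x : ℝ} (hx : x ≠ 0) :
    Complex.log x - lowerLog x = if x < 0 then 2 * Real.pi * Complex.I else 0 := by
  have hx' : (x : ℂ) ≠ 0 := by exact_mod_cast hx
  have hpi := Real.pi_pos
  split_ifs with h
  · have h1 := log_eq_log_neg_I_mul hx' (by simp)
    have h2 : lowerLog x = Complex.log (-x) - Real.pi * Complex.I := by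
      have : Complex.I * (x : ℂ) = -Complex.I * (-x : ℂ) := by ring
      have h3 := log_eq_log_neg_I_mul (neg_ne_zero.2 hx') (by simp)
      rw [lowerLog, this]
      linear_combination -h3
    have h4 : Complex.log x = Complex.log (-x) + Real.pi * Complex.I := by
      have e : (x : ℂ) = ((-x : ℝ) : ℂ) * (-1) := by push_cast; ring
      have : Complex.log (x : ℂ) = (Real.log (-x) : ℂ) + Complex.log (-1) := by
        conv_lhs => rw [e]
        exact Complex.log_ofReal_mul (by linarith) (by norm_num)
      rw [this, Complex.log_neg_one, ← Complex.ofReal_neg, ← Complex.ofReal_log (by linarith)]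
    rw [h2, h4]
    ring
  · have hx0 : 0 < x := lt_of_le_of_ne (not_lt.1 h) (Ne.symm hx)
    rw [lowerLog, (Complex.log_mul_eq_add_log_iff Complex.I_ne_zero hx').2, Complex.log_I]
    · ring
    · rw [Complex.arg_I, Complex.arg_ofReal_of_nonneg hx0.le]
      constructor <;> linarith

lemma measurable_lowerLog : Measurable lowerLog :=
  (Complex.measurable_log.comp (measurable_const_mul _)).add_const _

lemma norm_lowerLog_le (z : ℂ) : ‖lowerLog z‖ ≤ |Real.log ‖z‖| + 2 * Real.pi := by
  have h := norm_clog_le (Complex.I * z)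
  rw [norm_mul, Complex.norm_I, one_mul] at h
  have h2 : ‖-(Real.pi / 2 * Complex.I : ℂ)‖ = Real.pi / 2 := by
    rw [norm_neg, norm_mul, Complex.norm_I, mul_one, norm_div, Complex.norm_real,
      Real.norm_of_nonneg Real.pi_pos.le]
    simp
  refine (norm_add_le _ _).trans ?_
  rw [h2]
  linarith [Real.pi_pos]

/-- `exp (i a z) log (z - w)`. -/
def expLog (a : ℝ) (w z : ℂ) : ℂ := Complex.exp (Complex.I * a * z) * Complex.log (z - w)

/-- `exp (i a z)` times the lower branch of `log (z - w)`. -/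
def expLowerLog (a : ℝ) (w z : ℂ) : ℂ := Complex.exp (Complex.I * a * z) * lowerLog (z - w)

lemma rectIntegrable_expLog (a : ℝ) (w : ℂ) (X c d : ℝ) : RectIntegrable (expLog a w) X c d :=
  rectIntegrable_exp_mul_of_log_bound (L := fun z => Complex.log (z - w)) (w := w) (C := Real.pi)
    (Complex.measurable_log.comp (measurable_id.sub_const w)) (fun _ => norm_clog_le _) X c d

lemma rectIntegrable_expLowerLog (a : ℝ) (w : ℂ) (X c d : ℝ) :
    RectIntegrable (expLowerLog a w) X c d :=
  rectIntegrable_exp_mul_of_log_bound (L := fun z => lowerLog (z - w)) (w := w)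
    (C := 2 * Real.pi)
    (measurable_lowerLog.comp (measurable_id.sub_const w)) (fun _ => norm_lowerLog_le _) X c d

/-- The rectangle lies on or above the horizontal line through `w`. There, away from `w`, the
principal logarithm is `log (-i (z - w)) + iπ/2`, which has no cut in that closed half plane. -/
lemma rectIntegral_expLog_of_im_le {a X c d : ℝ} {w : ℂ} (hX : 0 ≤ X) (hcd : c ≤ d)
    (hw : w.im ≤ c) : rectIntegral (expLog a w) X c d = 0 := by
  have hre : ∀ z : ℂ, (-Complex.I * (z - w)).re = z.im - w.im := by intro z; simp
  refine rectIntegral_exp_mul_log_eq_zero (L := fun z => Complex.log (z - w)) (w := w)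
    (C := Real.pi) (e := -Complex.I) (k := Real.pi / 2 * Complex.I) (by simp)
    (Complex.measurable_log.comp (measurable_id.sub_const w)) (fun _ => norm_clog_le _) ?_ hX hcd ?_
  · intro z hz h
    rw [hre] at h
    exact log_eq_log_neg_I_mul (sub_ne_zero.2 hz) (by simpa using h)
  · intro z hz
    rw [hre]
    linarith [hz.2.1]

lemma rectIntegral_expLowerLog_of_le_im {a X c d : ℝ} {w : ℂ} (hX : 0 ≤ X) (hcd : c ≤ d)
    (hw : d ≤ w.im) : rectIntegral (expLowerLog a w) X c d = 0 := by
  have hre : ∀ z : ℂ, (Complex.I * (z - w)).re = w.im - z.im := by intro z; simp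
  refine rectIntegral_exp_mul_log_eq_zero (L := fun z => lowerLog (z - w)) (w := w)
    (C := 2 * Real.pi) (e := Complex.I) (k := -(Real.pi / 2 * Complex.I)) (by simp)
    (measurable_lowerLog.comp (measurable_id.sub_const w)) (fun _ => norm_lowerLog_le _) ?_ hX hcd ?_
  · intro z hz h
    rfl
  · intro z hz
    rw [hre]
    linarith [hz.2.2]

lemma expLowerLog_eq {a : ℝ} {w z : ℂ} (h : z.im < w.im) : expLowerLog a w z = expLog a w z := by
  rw [expLowerLog, expLog, lowerLog_eq_log (by simpa using h)]

/-- Strictly below `w` the principal logarithm agrees with `lowerLog`, whose integral vanishes. -/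
lemma rectIntegral_expLog_of_lt_im {a X c d : ℝ} {w : ℂ} (hX : 0 ≤ X) (hcd : c ≤ d)
    (hw : d < w.im) : rectIntegral (expLog a w) X c d = 0 := by
  rw [← rectIntegral_expLowerLog_of_le_im (a := a) hX hcd hw.le]
  have hh : ∀ y < w.im, ∫ x : ℝ in 0..X, expLog a w (x + y * Complex.I) =
      ∫ x : ℝ in 0..X, expLowerLog a w (x + y * Complex.I) := fun y hy =>
    intervalIntegral.integral_congr fun x _ => (expLowerLog_eq (by simpa using hy)).symm
  have hv : ∀ p : ℂ, p.im = 0 → ∫ y : ℝ in c..d, expLog a w (p + y * Complex.I) =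
      ∫ y : ℝ in c..d, expLowerLog a w (p + y * Complex.I) := by
    intro p hp
    refine intervalIntegral.integral_congr fun y hy => (expLowerLog_eq ?_).symm
    rw [uIcc_of_le hcd] at hy
    simp only [Complex.add_im, hp, Complex.mul_im, Complex.ofReal_re, Complex.I_im, mul_one,
      Complex.ofReal_im, Complex.I_re, mul_zero, add_zero, zero_add]
    linarith [hy.2]
  have hv0 := hv 0 rfl
  simp only [zero_add] at hv0
  simp only [rectIntegral]
  rw [hh c (by linarith), hh d hw, hv X (by simp), hv0]

/-- The contribution of a zero at `w` to the contour integral. -/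
def zeroJump (a : ℝ) (w : ℂ) : ℂ :=
  -(2 * Real.pi / a * Real.exp (-a * w.im) *
    (Complex.exp (Complex.I * a * (max w.re 0 : ℝ)) - 1))

lemma integral_exp_mul_indicator {a X u : ℝ} (ha : a ≠ 0) (hX : 0 ≤ X) (hu : u ≤ X) :
    ∫ x : ℝ in 0..X, (if x < u then Complex.exp (Complex.I * a * x) else 0) =
      (Complex.exp (Complex.I * a * (max u 0 : ℝ)) - 1) / (Complex.I * a) := by
  have hm0 : 0 ≤ max u 0 := le_max_right _ _
  have hmX : max u 0 ≤ X := max_le hu hX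
  have hc : Complex.I * a ≠ 0 := mul_ne_zero Complex.I_ne_zero (by exact_mod_cast ha)
  have hcont : Continuous fun x : ℝ => Complex.exp (Complex.I * a * x) := by fun_prop
  have e1 : ∀ x ∈ Ioo 0 (max u 0), (if x < u then Complex.exp (Complex.I * a * x) else 0) =
      Complex.exp (Complex.I * a * x) := by
    intro x hx
    rw [if_pos]
    rcases le_total u 0 with h | h
    · rw [max_eq_right h] at hx; linarith [hx.1, hx.2]
    · rw [max_eq_left h] at hx; exact hx.2
  have e2 : ∀ x ∈ Ioo (max u 0) X, (if x < u then Complex.exp (Complex.I * a * x) else 0) = 0 := by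
    intro x hx
    rw [if_neg]
    exact not_lt.2 ((le_max_left u 0).trans hx.1.le)
  have i1 : IntervalIntegrable (fun x : ℝ => if x < u then Complex.exp (Complex.I * a * x) else 0)
      volume 0 (max u 0) := by
    refine (hcont.intervalIntegrable 0 (max u 0)).congr_ae ?_
    rw [uIoc_of_le hm0, ← restrict_Ioo_eq_restrict_Ioc]
    exact (ae_restrict_mem measurableSet_Ioo).mono fun x hx => (e1 x hx).symm
  have i2 : IntervalIntegrable (fun x : ℝ => if x < u then Complex.exp (Complex.I * a * x) else 0)
      volume (max u 0) X := by
    refine (intervalIntegrable_const (c := (0 : ℂ))).congr_ae ?_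
    rw [uIoc_of_le hmX, ← restrict_Ioo_eq_restrict_Ioc]
    exact (ae_restrict_mem measurableSet_Ioo).mono fun x hx => (e2 x hx).symm
  rw [← intervalIntegral.integral_add_adjacent_intervals i1 i2,
    intervalIntegral.integral_of_le hm0, intervalIntegral.integral_of_le hmX,
    integral_Ioc_eq_integral_Ioo, integral_Ioc_eq_integral_Ioo,
    setIntegral_congr_fun measurableSet_Ioo e1, setIntegral_congr_fun measurableSet_Ioo e2,
    ← integral_Ioc_eq_integral_Ioo, ← intervalIntegral.integral_of_le hm0,
    integral_exp_mul_complex hc]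
  simp

/-- Split the rectangle at the height of `w`. Cauchy's theorem applies to the principal branch above
and to the lower branch below. On the common edge the two differ by `2π i` for `x < Re w`; the part
of the cut inside the rectangle is empty if `Re w ≤ 0`, whence the `max` in `zeroJump`. -/
lemma rectIntegral_expLog_of_mem {a X T : ℝ} {w : ℂ} (ha : a ≠ 0) (hX : 0 ≤ X) (hwX : w.re ≤ X)
    (h0 : 0 < w.im) (hT : w.im < T) : rectIntegral (expLog a w) X 0 T = zeroJump a w := by
  set v := w.im with hv
  have hup := rectIntegral_expLog_of_im_le (a := a) (w := w) hX hT.le le_rfl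
  have hlow := rectIntegral_expLowerLog_of_le_im (a := a) (w := w) hX h0.le le_rfl
  obtain ⟨iu1, -, iu3, iu4⟩ := rectIntegrable_expLog a w X v T
  obtain ⟨-, -, il3, il4⟩ := rectIntegrable_expLog a w X 0 v
  obtain ⟨-, id2, -, -⟩ := rectIntegrable_expLowerLog a w X 0 v
  simp only [rectIntegral] at hup hlow ⊢
  rw [← intervalIntegral.integral_add_adjacent_intervals il3 iu3,
    ← intervalIntegral.integral_add_adjacent_intervals il4 iu4]
  have hbot : ∫ x : ℝ in 0..X, expLowerLog a w (x + (0 : ℝ) * Complex.I) =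
      ∫ x : ℝ in 0..X, expLog a w (x + (0 : ℝ) * Complex.I) :=
    intervalIntegral.integral_congr fun x _ => expLowerLog_eq (by simpa using h0)
  have hvert : ∀ p : ℂ, p.im = 0 → ∫ y : ℝ in 0..v, expLowerLog a w (p + y * Complex.I) =
      ∫ y : ℝ in 0..v, expLog a w (p + y * Complex.I) := by
    intro p hp
    rw [intervalIntegral.integral_of_le h0.le, intervalIntegral.integral_of_le h0.le,
      integral_Ioc_eq_integral_Ioo, integral_Ioc_eq_integral_Ioo]
    refine setIntegral_congr_fun measurableSet_Ioo fun y hy => expLowerLog_eq ?_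
    simpa [hp] using hy.2
  have hl := hvert 0 rfl
  have hr := hvert X (by simp)
  simp only [zero_add] at hl
  rw [hbot, hl, hr] at hlow
  have hmid : (∫ x : ℝ in 0..X, expLog a w (x + v * Complex.I)) -
      ∫ x : ℝ in 0..X, expLowerLog a w (x + v * Complex.I) = -zeroJump a w := by
    rw [← intervalIntegral.integral_sub iu1 id2]
    have hpt : ∀ᵐ x : ℝ, x ∈ uIoc 0 X → expLog a w (x + v * Complex.I) -
        expLowerLog a w (x + v * Complex.I) = (2 * Real.pi * Complex.I * Real.exp (-a * v)) *
          (if x < w.re then Complex.exp (Complex.I * a * x) else 0) := by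
      have hne : ∀ᵐ x : ℝ, x ≠ w.re :=
        measure_eq_zero_iff_ae_notMem.1 ((countable_singleton w.re).measure_zero volume)
      filter_upwards [hne] with x hx _
      have e1 : (x + v * Complex.I - w : ℂ) = ((x - w.re : ℝ) : ℂ) := by
        apply Complex.ext <;> simp [hv]
      have e2 : Complex.exp (Complex.I * a * (x + v * Complex.I)) =
          Real.exp (-a * v) * Complex.exp (Complex.I * a * x) := by
        rw [Complex.ofReal_exp, ← Complex.exp_add]
        congr 1
        push_cast
        linear_combination (a * v : ℂ) * Complex.I_mul_I
      rw [expLog, expLowerLog, ← mul_sub, e1, log_sub_lowerLog_ofReal (sub_ne_zero.2 hx), e2]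
      simp only [sub_neg]
      split_ifs
      · ring
      · simp
    rw [intervalIntegral.integral_congr_ae hpt, intervalIntegral.integral_const_mul,
      integral_exp_mul_indicator ha hX hwX, zeroJump]
    have hac : (a : ℂ) ≠ 0 := by exact_mod_cast ha
    field_simp
    ring
  linear_combination hup + hlow - hmid

lemma rectIntegral_expLog {a X T : ℝ} {w : ℂ} (ha : a ≠ 0) (hX : 0 ≤ X) (hT : 0 ≤ T)
    (hwX : w.re ≤ X) (hwT : w.im ≠ T) :
    rectIntegral (expLog a w) X 0 T = if 0 < w.im ∧ w.im < T then zeroJump a w else 0 := by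
  split_ifs with h
  · exact rectIntegral_expLog_of_mem ha hX hwX h.1 h.2
  · rcases le_or_gt w.im 0 with h0 | h0
    · exact rectIntegral_expLog_of_im_le hX hT h0
    · have : T < w.im := lt_of_le_of_ne (not_lt.1 fun h' => h ⟨h0, h'⟩) hwT.symm
      exact rectIntegral_expLog_of_lt_im hX hT this

/-! ### The contour identity for `log ζ` -/

lemma riemannZeta₁_ofReal_re_pos {σ : ℝ} (hσ : 0 < σ) : 0 < (riemannZeta₁ σ).re := by
  rcases lt_or_ge σ 1 with h | h
  · exact riemannZeta₁_ofReal_pos hσ h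
  by_contra hneg
  have hcont : ContinuousOn (fun x : ℝ => (riemannZeta₁ x).re) (Icc 1 σ) :=
    (Complex.continuous_re.comp
      (differentiable_riemannZeta₁.continuous.comp Complex.continuous_ofReal)).continuousOn
  obtain ⟨x, hx, hx0⟩ := intermediate_value_Icc' h hcont (show (0 : ℝ) ∈ _ by
    simpa using not_lt.1 hneg)
  refine riemannZeta₁_ofReal_ne_zero (by linarith [hx.1] : 0 < x) (Complex.ext hx0 ?_)
  exact riemannZeta₁_ofReal_im x

/-- On the real axis the explicit formula gives the boundary value from the upper half plane. -/
lemma ZetaLocalLog.branch_ofReal {r : ℝ} (D : ZetaLocalLog 0 r) {σ : ℝ} (hσ : 0 < σ)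
    (hball : |σ - 2| < r) (h1 : σ ≠ 1) :
    D.branch σ = Real.log ‖riemannZeta σ‖ - if σ < 1 then Real.pi * Complex.I else 0 := by
  have hr : 0 < r := (abs_nonneg _).trans_lt hball
  have hmem : ∀ x : ℝ, |x - 2| < r → (x : ℂ) ∈ Metric.ball (2 + (0 : ℝ) * Complex.I) r := by
    intro x hx
    rw [Metric.mem_ball, dist_eq_norm, show (x - (2 + (0 : ℝ) * Complex.I) : ℂ) =
      ((x - 2 : ℝ) : ℂ) by push_cast; ring, Complex.norm_real]
    exact hx
  -- Real zeros are nonpositive, so no cut of `log (z - w i)` meets the positive axis.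
  have hslit : ∀ x : ℝ, 0 < x → ∀ i, (x - D.w i : ℂ) ∈ Complex.slitPlane := by
    intro x hx i
    by_cases him : (D.w i).im = 0
    · left
      have hw : D.w i = ((D.w i).re : ℂ) := Complex.ext (by simp) (by simp [him])
      have : (D.w i).re ≤ 0 := by
        by_contra hpos
        exact riemannZeta₁_ofReal_ne_zero (not_le.1 hpos) (by rw [← hw]; exact D.zero i)
      simp only [Complex.sub_re, Complex.ofReal_re]
      linarith
    · right
      simpa using him
  -- `E` is a logarithm of `(s - 1) ζ(s)`, which is positive on the positive axis. Its imaginary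
  -- part is therefore a constant multiple of `2π`, and it vanishes at `2`. Only `-log (σ - 1)` is
  -- left to contribute, with `-π` for `σ < 1`.
  set E : ℂ → ℂ := fun z => D.ℓ z + ∑ i, Complex.log (z - D.w i) with hE
  have hexp : ∀ x : ℝ, 0 < x → |x - 2| < r → Complex.exp (E x) = riemannZeta₁ x := by
    intro x hx hxr
    rw [hE]
    beta_reduce
    rw [Complex.exp_add, Complex.exp_sum]
    simp_rw [fun i => Complex.exp_log (Complex.slitPlane_ne_zero (hslit x hx i))]
    exact (D.eq _ (hmem x hxr)).symm
  set S : Set ℝ := Ioi 0 ∩ Metric.ball 2 r with hS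
  have hSmem : ∀ x ∈ S, 0 < x ∧ |x - 2| < r := fun x hx => ⟨hx.1, by
    simpa [Real.dist_eq] using hx.2⟩
  have hSconv : Convex ℝ S := (convex_Ioi 0).inter (convex_ball 2 r)
  have hint : ∀ x ∈ S, ∃ k : ℤ, (E x).im = k * (2 * Real.pi) := by
    intro x hx
    obtain ⟨hx0, hxr⟩ := hSmem x hx
    have hpos := riemannZeta₁_ofReal_re_pos hx0
    have hreal : riemannZeta₁ x = ((riemannZeta₁ x).re : ℂ) :=
      Complex.ext (by simp) (by simpa using riemannZeta₁_ofReal_im x)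
    have h2 : Complex.exp (E x) = Complex.exp (Real.log (riemannZeta₁ x).re : ℝ) := by
      rw [hexp x hx0 hxr, ← Complex.ofReal_exp, Real.exp_log hpos, ← hreal]
    obtain ⟨k, hk⟩ := Complex.exp_eq_exp_iff_exists_int.1 h2
    exact ⟨k, by rw [hk]; simp⟩
  have hcont : ContinuousOn (fun x : ℝ => (E x).im) S := by
    intro x hx
    obtain ⟨hx0, hxr⟩ := hSmem x hx
    have hEc : ContinuousAt E x := by
      refine ContinuousAt.add ?_ ?_
      · exact (D.diff.differentiableAt (Metric.isOpen_ball.mem_nhds (hmem x hxr))).continuousAt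
      · exact tendsto_finsetSum _ fun i _ =>
          (continuousAt_id.sub continuousAt_const).clog (hslit x hx0 i)
    exact (Complex.continuous_im.continuousAt.comp
      (ContinuousAt.comp (f := fun x : ℝ => (x : ℂ)) hEc
        Complex.continuous_ofReal.continuousAt)).continuousWithinAt
  have hE2 : (E (2 : ℝ)).im = 0 := by
    have hc := D.center
    have e : (2 + ((0 : ℝ) : ℂ) * Complex.I) = ((2 : ℝ) : ℂ) := by push_cast; ring
    rw [e, show (((2 : ℝ) : ℂ) - 1) = 1 by push_cast; norm_num, Complex.log_one, sub_zero] at hc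
    rw [show E (2 : ℝ) = Complex.log (riemannZeta (2 : ℝ)) from hc, Complex.log_im]
    have h3 : riemannZeta (2 : ℝ) = riemannZeta₁ (2 : ℝ) := by
      rw [riemannZeta₁_eq_mul (by norm_num)]
      push_cast
      norm_num
    rw [h3, Complex.arg_eq_zero_iff]
    exact ⟨(riemannZeta₁_ofReal_re_pos two_pos).le, riemannZeta₁_ofReal_im 2⟩
  have him : (E σ).im = 0 := by
    rw [← hE2]
    exact hSconv.isPreconnected.eq_of_mem_int_mul_two_pi hcont hint
      ⟨hσ, by simpa [Real.dist_eq] using hball⟩ ⟨by simp, Metric.mem_ball_self hr⟩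
  have h1' : (σ : ℂ) ≠ 1 := by exact_mod_cast h1
  have hbr : D.branch σ = E σ - Complex.log (σ - 1) := rfl
  have hre : Real.log ‖riemannZeta σ‖ = (D.branch σ).re := by
    rw [← D.exp_branch (hmem σ hball) h1'
      (fun i => sub_ne_zero.1 (Complex.slitPlane_ne_zero (hslit σ hσ i))), Complex.norm_exp,
      Real.log_exp]
  have harg : (Complex.log ((σ : ℂ) - 1)).im = if σ < 1 then Real.pi else 0 := by
    rw [Complex.log_im, ← Complex.ofReal_one, ← Complex.ofReal_sub]
    split_ifs with h
    · exact Complex.arg_ofReal_of_neg (by linarith)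
    · exact Complex.arg_ofReal_of_nonneg (by linarith)
  apply Complex.ext
  · rw [hre]
    split_ifs <;> simp
  · rw [hbr, Complex.sub_im, him, harg]
    split_ifs <;> simp

/-- Cauchy's theorem for `exp (i a z) log ζ(b + z)` on the rectangle `[0, X] × [0, T]`. -/
lemma exists_rect_identity {a b X T : ℝ} (ha : 0 < a) (hb : 1 / 2 ≤ b) (hb1 : b < 1) (hX : 1 ≤ X)
    (hT : 0 < T) (hTo : T ∉ zetaOrdinates) :
    ∃ (n : ℕ) (w : Fin n → ℂ), (∀ i, riemannZeta₁ (w i) = 0) ∧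
      (∀ ρ : ℂ, riemannZeta₁ ρ = 0 → b < ρ.re → 0 < ρ.im → ρ.im < T → ∃ i, w i = ρ) ∧
      (∫ x : ℝ in 0..X, Complex.exp (Complex.I * a * x) * (Real.log ‖riemannZeta (b + x)‖ -
          if x < 1 - b then Real.pi * Complex.I else 0)) -
        (∫ x : ℝ in 0..X, Complex.exp (Complex.I * a * (x + T * Complex.I)) *
          zetaLog (b + x + T * Complex.I)) +
        Complex.I * (∫ y : ℝ in 0..T, Complex.exp (Complex.I * a * (X + y * Complex.I)) *
          zetaLog (b + X + y * Complex.I)) -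
        Complex.I * (∫ y : ℝ in 0..T, Complex.exp (Complex.I * a * (y * Complex.I)) *
          zetaLog (b + y * Complex.I)) =
      ∑ i, if 0 < (w i).im ∧ (w i).im < T then zeroJump a (w i - b) else 0 := by
  set r : ℝ := X + T + 4 with hrdef
  obtain ⟨D⟩ := ZetaLocalLog.nonempty 0 (by positivity : 0 < r)
  have hX0 : 0 ≤ X := by linarith
  have hball : ∀ z ∈ Icc 0 X ×ℂ Icc 0 T, (b + z : ℂ) ∈ Metric.ball (2 + (0 : ℝ) * Complex.I) r := by
    intro z hz
    obtain ⟨⟨h1, h2⟩, h3, h4⟩ := hz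
    rw [Metric.mem_ball, dist_eq_norm]
    refine (Complex.norm_le_abs_re_add_abs_im _).trans_lt ?_
    have e1 : (b + z - (2 + (0 : ℝ) * Complex.I) : ℂ).re = b + z.re - 2 := by simp
    have e2 : (b + z - (2 + (0 : ℝ) * Complex.I) : ℂ).im = z.im := by simp
    rw [e1, e2, abs_of_nonneg h3]
    have : |b + z.re - 2| ≤ X + 2 := abs_le.2 ⟨by linarith, by linarith⟩
    linarith
  have hmem : ∀ x ∈ Icc 0 X, ∀ y ∈ Icc 0 T, (x + y * Complex.I : ℂ) ∈ Icc 0 X ×ℂ Icc 0 T := by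
    intro x hx y hy
    simpa [Complex.mem_reProdIm] using ⟨hx, hy⟩
  -- the holomorphic part
  set H : ℂ → ℂ := fun z => Complex.exp (Complex.I * a * z) * D.ℓ (b + z) with hH
  have hHd : ∀ z ∈ Icc 0 X ×ℂ Icc 0 T, DifferentiableAt ℂ H z := by
    intro z hz
    refine (by fun_prop : DifferentiableAt ℂ (fun z => Complex.exp (Complex.I * a * z)) z).mul ?_
    exact DifferentiableAt.comp z
      (D.diff.differentiableAt (Metric.isOpen_ball.mem_nhds (hball z hz))) (by fun_prop)
  have hHc : ContinuousOn H (Icc 0 X ×ℂ Icc 0 T) := fun z hz =>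
    (hHd z hz).continuousAt.continuousWithinAt
  have hH0 : rectIntegral H X 0 T = 0 :=
    rectIntegral_eq_zero countable_empty hX0 hT.le hHc fun z hz => hHd z hz.1
  have hHi : RectIntegrable H X 0 T := by
    have hpath : ∀ (γ : ℝ → ℂ) (p q : ℝ), p ≤ q → Continuous γ →
        (∀ t ∈ Icc p q, γ t ∈ Icc 0 X ×ℂ Icc 0 T) →
        IntervalIntegrable (fun t => H (γ t)) volume p q := by
      intro γ p q hpq hγ h
      refine ContinuousOn.intervalIntegrable ?_
      rw [uIcc_of_le hpq]
      exact hHc.comp hγ.continuousOn h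
    refine ⟨hpath _ _ _ hX0 (by fun_prop) fun x hx => hmem x hx 0 ⟨le_rfl, hT.le⟩,
      hpath _ _ _ hX0 (by fun_prop) fun x hx => hmem x hx T ⟨hT.le, le_rfl⟩,
      hpath _ _ _ hT.le (by fun_prop) fun y hy => hmem X ⟨hX0, le_rfl⟩ y hy,
      hpath _ _ _ hT.le (by fun_prop) fun y hy => ?_⟩
    simpa using hmem 0 ⟨le_rfl, hX0⟩ y hy
  set F : ℂ → ℂ := fun z => Complex.exp (Complex.I * a * z) * D.branch (b + z) with hF
  -- A holomorphic term, one logarithm for each zero, and the logarithm of the pole. The pole sits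
  -- at height `0`, so its integral vanishes by `rectIntegral_expLog_of_im_le`.
  have hFeq : F = fun z => (H z + ∑ i, expLog a (D.w i - b) z) - expLog a (1 - b) z := by
    funext z
    simp only [hF, hH, ZetaLocalLog.branch, expLog, ← Finset.mul_sum]
    have e1 : ∀ i, (b : ℂ) + z - D.w i = z - (D.w i - b) := fun i => by ring
    have e2 : (b : ℂ) + z - 1 = z - (1 - b) := by ring
    simp_rw [e1, e2]
    ring
  have hsumi : RectIntegrable (fun z => ∑ i, expLog a (D.w i - b) z) X 0 T :=
    RectIntegrable.sum _ fun i _ => rectIntegrable_expLog _ _ _ _ _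
  have hFint : rectIntegral F X 0 T =
      ∑ i, if 0 < (D.w i).im ∧ (D.w i).im < T then zeroJump a (D.w i - b) else 0 := by
    rw [hFeq, rectIntegral_sub (hHi.add hsumi) (rectIntegrable_expLog _ _ _ _ _),
      rectIntegral_add hHi hsumi, hH0,
      rectIntegral_sum _ fun i _ => rectIntegrable_expLog _ _ _ _ _,
      rectIntegral_expLog_of_im_le hX0 hT.le (by simp), zero_add, sub_zero]
    refine Finset.sum_congr rfl fun i _ => ?_
    have him : (D.w i - b : ℂ).im = (D.w i).im := by simp
    have hre : (D.w i - b : ℂ).re ≤ X := by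
      have := D.re_zero_lt_one i
      simp only [Complex.sub_re, Complex.ofReal_re]
      linarith
    rw [rectIntegral_expLog ha.ne' hX0 hT.le hre (by rw [him]; exact D.im_ne hTo i), him]
  refine ⟨D.n, D.w, D.zero, ?_, ?_⟩
  · intro ρ hρ hbρ h0 hTρ
    have hρ1 : ρ.re < 1 := by
      by_contra h
      exact riemannZeta₁_ne_zero_of_one_le_re (not_lt.1 h) hρ
    have hρb := hball (ρ - b) ⟨⟨by simp; linarith, by simp; linarith⟩, by simp; linarith,
      by simp; linarith⟩
    rw [add_sub_cancel] at hρb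
    -- The exponential factor does not vanish, so a zero inside the disc must be one of the `w i`.
    have := D.eq ρ hρb
    rw [hρ, eq_comm, mul_eq_zero, Finset.prod_eq_zero_iff] at this
    rcases this with h | ⟨i, -, hi⟩
    · exact absurd h (Complex.exp_ne_zero _)
    · exact ⟨i, (sub_eq_zero.1 hi).symm⟩
  rw [← hFint]
  simp only [rectIntegral]
  have hne : ∀ᵐ x : ℝ, x ≠ 1 - b :=
    measure_eq_zero_iff_ae_notMem.1 ((countable_singleton (1 - b)).measure_zero volume)
  congr 1
  · congr 1
    · congr 1
      · refine intervalIntegral.integral_congr_ae ?_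
        filter_upwards [hne] with x hx hxm
        rw [uIoc_of_le hX0] at hxm
        simp only [hF, Complex.ofReal_zero, zero_mul, add_zero]
        congr 1
        have := D.branch_ofReal (σ := b + x) (by linarith [hxm.1])
          (by rw [abs_lt]; constructor <;> linarith [hxm.1, hxm.2])
          (fun h => hx (by linarith))
        rw [← Complex.ofReal_add, this]
        simp only [lt_sub_iff_add_lt']
      · refine intervalIntegral.integral_congr fun x hx => ?_
        rw [uIcc_of_le hX0] at hx
        have h := D.zetaLog_eq_branch (hball _ (hmem x hx T ⟨hT.le, le_rfl⟩)) (by simpa using hT.ne')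
          (by simpa using D.im_ne hTo)
        simp only [hF, ← h, add_assoc]
    · congr 1
      refine intervalIntegral.integral_congr_ae ?_
      filter_upwards [ae_notMem_zetaOrdinates] with y hy hym
      rw [uIoc_of_le hT.le] at hym
      have h := D.zetaLog_eq_branch (hball _ (hmem X ⟨hX0, le_rfl⟩ y ⟨hym.1.le, hym.2⟩))
        (by simpa using hym.1.ne') (by simpa using D.im_ne hy)
      simp only [hF, ← h, add_assoc]
  · congr 1
    refine intervalIntegral.integral_congr_ae ?_
    filter_upwards [ae_notMem_zetaOrdinates] with y hy hym
    rw [uIoc_of_le hT.le] at hym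
    have h := D.zetaLog_eq_branch (s := b + y * Complex.I)
      (by simpa using hball _ (hmem 0 ⟨le_rfl, hX0⟩ y ⟨hym.1.le, hym.2⟩))
      (by simpa using hym.1.ne') (by simpa using D.im_ne hy)
    simp only [hF, ← h]

/-! ### Letting the rectangle grow -/

lemma measurable_riemannZeta : Measurable riemannZeta :=
  measurable_of_continuousOn_compl_singleton 1 fun _ hz =>
    (differentiableAt_riemannZeta hz).continuousAt.continuousWithinAt

lemma integrableOn_log_riemannZeta_horizontal {b : ℝ} (hb : 1 / 2 ≤ b) (hb1 : b < 1) :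
    IntegrableOn (fun x : ℝ => Real.log ‖riemannZeta (b + x)‖) (Ioi 0) := by
  obtain ⟨B, -, hB⟩ := exists_horizontal_majorant hb hb1
  obtain ⟨G, hGi, -, -, hG⟩ := hB 0
  refine Integrable.mono' hGi ?_ ?_
  · exact (Real.measurable_log.comp
      (measurable_riemannZeta.comp (by fun_prop)).norm).aestronglyMeasurable
  · refine (ae_restrict_iff' measurableSet_Ioi).2 (hG.mono fun x hx hx0 => ?_)
    simpa using (hx hx0).1

/-- The difference of the integrals over the two rays in the contour argument. -/
def rayDifference (a b : ℝ) : ℂ :=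
  (∫ x in Ioi (0 : ℝ), Complex.exp (Complex.I * a * x) * (Real.log ‖riemannZeta (b + x)‖ -
      if x < 1 - b then Real.pi * Complex.I else 0)) -
    Complex.I * ∫ t in Ioi (0 : ℝ), (Real.exp (-a * t) : ℂ) * zetaLog (b + t * Complex.I)

lemma integrableOn_exp_mul_log {a b : ℝ} (hb : 1 / 2 ≤ b) (hb1 : b < 1) :
    IntegrableOn (fun x : ℝ => Complex.exp (Complex.I * a * x) *
      (Real.log ‖riemannZeta (b + x)‖ : ℂ)) (Ioi 0) := by
  refine Integrable.bdd_mul (c := 1) (integrableOn_log_riemannZeta_horizontal hb hb1).ofReal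
    (by fun_prop) (Eventually.of_forall fun x => le_of_eq ?_)
  rw [show Complex.I * a * x = ((a * x : ℝ) : ℂ) * Complex.I by push_cast; ring,
    Complex.norm_exp_ofReal_mul_I]

lemma exp_mul_ite_eq_indicator (a b : ℝ) : (fun x : ℝ => Complex.exp (Complex.I * a * x) *
      (if x < 1 - b then Real.pi * Complex.I else 0)) =
    (Iio (1 - b)).indicator fun x : ℝ =>
      Real.pi * Complex.I * Complex.exp (Complex.I * a * x) := by
  funext x
  simp only [indicator, mem_Iio]
  split_ifs
  · ring
  · simp

lemma integrableOn_exp_mul_ite (a b : ℝ) :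
    IntegrableOn (fun x : ℝ => Complex.exp (Complex.I * a * x) *
      (if x < 1 - b then Real.pi * Complex.I else 0)) (Ioi 0) := by
  rw [exp_mul_ite_eq_indicator, IntegrableOn, integrable_indicator_iff measurableSet_Iio,
    IntegrableOn, Measure.restrict_restrict measurableSet_Iio, Iio_inter_Ioi]
  have hc : Continuous fun x : ℝ => Real.pi * Complex.I * Complex.exp (Complex.I * a * x) := by
    fun_prop
  exact hc.integrableOn_Icc.mono_set Ioo_subset_Icc_self

lemma integral_exp_mul_ite {a b : ℝ} (ha : a ≠ 0) (hb1 : b < 1) :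
    ∫ x in Ioi (0 : ℝ), Complex.exp (Complex.I * a * x) *
      (if x < 1 - b then Real.pi * Complex.I else 0) =
      Real.pi / a * (Complex.exp ((a * (1 - b) : ℝ) * Complex.I) - 1) := by
  have hac : (a : ℂ) ≠ 0 := by exact_mod_cast ha
  rw [exp_mul_ite_eq_indicator, setIntegral_indicator measurableSet_Iio, Ioi_inter_Iio,
    ← integral_Ioc_eq_integral_Ioo, ← intervalIntegral.integral_of_le (by linarith),
    intervalIntegral.integral_const_mul,
    integral_exp_mul_complex (mul_ne_zero Complex.I_ne_zero hac)]
  have e : Complex.I * a * ((1 - b : ℝ) : ℂ) = (a * (1 - b) : ℝ) * Complex.I := by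
    push_cast; ring
  rw [e]
  simp only [Complex.ofReal_zero, mul_zero, Complex.exp_zero]
  field_simp

lemma tendsto_linear_mul_exp {c : ℝ} (hc : 0 < c) (A B : ℝ) :
    Tendsto (fun n : ℕ => (A + B * n) * Real.exp (-c * n)) atTop (𝓝 0) := by
  have h0 := (Real.summable_pow_mul_exp_neg_nat_mul 0 hc).tendsto_atTop_zero
  have h1 := (Real.summable_pow_mul_exp_neg_nat_mul 1 hc).tendsto_atTop_zero
  have := (h0.const_mul A).add (h1.const_mul B)
  simp only [mul_zero, add_zero] at this
  exact this.congr fun n => by ring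

/-- The contour identity in the limit: `rayDifference` is a limit of finite sums over zeros. -/
lemma exists_tendsto_rayDifference {a b : ℝ} (ha : 0 < a) (hb : 1 / 2 ≤ b) (hb1 : b < 1) :
    ∃ (n : ℕ → ℕ) (w : ∀ k, Fin (n k) → ℂ) (T : ℕ → ℝ), (∀ k : ℕ, (k : ℝ) < T k) ∧
      (∀ k i, riemannZeta₁ (w k i) = 0) ∧
      (∀ k, ∀ ρ : ℂ, riemannZeta₁ ρ = 0 → b < ρ.re → 0 < ρ.im → ρ.im < T k → ∃ i, w k i = ρ) ∧
      Tendsto (fun k => ∑ i, if 0 < (w k i).im ∧ (w k i).im < T k then zeroJump a (w k i - b) else 0)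
        atTop (𝓝 (rayDifference a b)) := by
  -- One height in each `(k, k + 1)` that carries no zero, so that the branch is continuous on the
  -- top edge.
  choose T hT hTo using exists_notMem_zetaOrdinates
  have hT0 : ∀ k : ℕ, 0 < T k := fun k => (k.cast_nonneg (α := ℝ)).trans_lt (hT k).1
  have hX1 : ∀ k : ℕ, (1 : ℝ) ≤ (k : ℝ) + 2 := fun k => by linarith [k.cast_nonneg (α := ℝ)]
  choose n w hz hmem hid using fun k : ℕ =>
    exists_rect_identity ha hb hb1 (hX1 k) (hT0 k) (hTo k)
  refine ⟨n, w, T, fun k => (hT k).1, hz, hmem, ?_⟩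
  have hTtop : Tendsto T atTop atTop :=
    tendsto_atTop_mono (fun k => (hT k).1.le) tendsto_natCast_atTop_atTop
  have hXtop : Tendsto (fun k : ℕ => (k : ℝ) + 2) atTop atTop :=
    tendsto_atTop_add_const_right _ _ tendsto_natCast_atTop_atTop
  have hbotint : IntegrableOn (fun x : ℝ => Complex.exp (Complex.I * a * x) *
      (Real.log ‖riemannZeta (b + x)‖ - if x < 1 - b then Real.pi * Complex.I else 0)) (Ioi 0) := by
    refine ((integrableOn_exp_mul_log (a := a) hb hb1).sub
      (integrableOn_exp_mul_ite a b)).congr (Eventually.of_forall fun x => ?_)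
    simp only [Pi.sub_apply]
    ring
  have hbot := intervalIntegral_tendsto_integral_Ioi 0 hbotint hXtop
  have hexpI : ∀ y : ℝ, Complex.exp (Complex.I * a * (y * Complex.I)) = (Real.exp (-a * y) : ℂ) := by
    intro y
    rw [Complex.ofReal_exp]
    congr 1
    push_cast
    linear_combination (a * y : ℂ) * Complex.I_mul_I
  have hleft := intervalIntegral_tendsto_integral_Ioi 0 (integrableOn_exp_mul_zetaLog ha hb hb1) hTtop
  have hnorm : ∀ x y : ℝ, ‖Complex.exp (Complex.I * a * (x + y * Complex.I))‖ =
      Real.exp (-a * y) := by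
    intro x y
    rw [Complex.norm_exp]
    congr 1
    simp
  -- On the top edge the factor `exp (-a T)` beats the linear growth of the majorant's integral.
  have htop : Tendsto (fun k : ℕ => ∫ x : ℝ in 0..((k : ℝ) + 2),
      Complex.exp (Complex.I * a * (x + T k * Complex.I)) *
        zetaLog (b + x + T k * Complex.I)) atTop (𝓝 0) := by
    obtain ⟨B, hB0, hB⟩ := exists_horizontal_majorant hb hb1
    refine squeeze_zero_norm (fun k => ?_) (tendsto_linear_mul_exp ha (2 * B) B)
    obtain ⟨G, hGi, hG0, hGint, hG⟩ := hB (T k)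
    have hX0 : (0 : ℝ) ≤ (k : ℝ) + 2 := by positivity
    have hGii : IntervalIntegrable (fun x => Real.exp (-a * T k) * G x) volume 0 ((k : ℝ) + 2) := by
      rw [intervalIntegrable_iff_integrableOn_Ioc_of_le hX0]
      exact (hGi.mono_set Ioc_subset_Ioi_self).const_mul _
    refine (intervalIntegral.norm_integral_le_of_norm_le hX0 (hG.mono fun x hx hxm => ?_)
      hGii).trans ?_
    · rw [norm_mul, hnorm]
      exact mul_le_mul_of_nonneg_left ((hx hxm.1).2 (hT0 k).ne' (hTo k)) (Real.exp_pos _).le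
    · rw [intervalIntegral.integral_const_mul, intervalIntegral.integral_of_le hX0]
      have h1 : ∫ x in Ioc 0 ((k : ℝ) + 2), G x ≤ ∫ x in Ioi 0, G x :=
        setIntegral_mono_set hGi (Eventually.of_forall hG0)
          (LE.le.eventuallyLE Ioc_subset_Ioi_self)
      rw [abs_of_pos (hT0 k)] at hGint
      have h2 : Real.exp (-a * T k) ≤ Real.exp (-a * k) := by
        rw [Real.exp_le_exp]; nlinarith [(hT k).1]
      have h3 : ∫ x in Ioc 0 ((k : ℝ) + 2), G x ≤ 2 * B + B * k := by
        nlinarith [(hT k).2]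
      have h4 : 0 ≤ ∫ x in Ioc 0 ((k : ℝ) + 2), G x := integral_nonneg hG0
      rw [mul_comm]
      gcongr
  -- On the right edge `log ζ` decays exponentially in the abscissa while the length is at most `k +
  -- 1`.
  have hright : Tendsto (fun k : ℕ => ∫ y : ℝ in 0..T k,
      Complex.exp (Complex.I * a * (((k : ℝ) + 2 : ℝ) + y * Complex.I)) *
        zetaLog (b + ((k : ℝ) + 2 : ℝ) + y * Complex.I)) atTop (𝓝 0) := by
    refine squeeze_zero_norm (fun k => ?_)
      (tendsto_linear_mul_exp (by norm_num : (0 : ℝ) < 1 / 2) 8 8)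
    have hk0 : (0 : ℝ) ≤ k := k.cast_nonneg
    refine (intervalIntegral.norm_integral_le_of_norm_le_const
      (C := 8 * Real.exp (-(1 / 2) * k)) fun y hy => ?_).trans ?_
    · rw [uIoc_of_le (hT0 k).le] at hy
      rw [norm_mul, hnorm]
      have hre : (b + ((k : ℝ) + 2 : ℝ) + y * Complex.I : ℂ).re = b + (k + 2) := by simp
      have h2 : 2 ≤ (b + ((k : ℝ) + 2 : ℝ) + y * Complex.I : ℂ).re := by rw [hre]; linarith
      rw [zetaLog_of_two_le_re h2]
      have h3 := norm_log_riemannZeta_le_exp h2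
      rw [hre] at h3
      have h4 : Real.exp (-(1 / 2) * (b + (k + 2))) ≤ Real.exp (-(1 / 2) * k) := by
        rw [Real.exp_le_exp]; linarith
      have h5 : Real.exp (-a * y) ≤ 1 := Real.exp_le_one_iff.2 (by nlinarith [hy.1])
      have := norm_nonneg (Complex.log (riemannZeta (b + ((k : ℝ) + 2 : ℝ) + y * Complex.I)))
      nlinarith [Real.exp_pos (-a * y)]
    · rw [sub_zero, abs_of_pos (hT0 k)]
      have := Real.exp_pos (-(1 / 2) * (k : ℝ))
      nlinarith [(hT k).2]
  have hlim := ((hbot.sub htop).add (hright.const_mul Complex.I)).sub (hleft.const_mul Complex.I)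
  rw [sub_zero, mul_zero, add_zero] at hlim
  refine hlim.congr fun k => ?_
  rw [← hid k]
  simp_rw [hexpI]

lemma rayDifference_eq {a b : ℝ} (ha : 0 < a) (hb : 1 / 2 ≤ b) (hb1 : b < 1)
    (h₁ : IntegrableOn (fun t : ℝ =>
      Real.exp (-a * t) * Real.log ‖riemannZeta (b + t * Complex.I)‖) (Ioi 0))
    (h₂ : IntegrableOn (fun x : ℝ => Real.sin (a * x) * Real.log ‖riemannZeta (b + x)‖) (Ioi 0))
    (h₃ : IntegrableOn (fun t : ℝ => Real.exp (-a * t) * zetaArg (b + t * Complex.I)) (Ioi 0))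
    (h₄ : IntegrableOn (fun x : ℝ => Real.cos (a * x) * Real.log ‖riemannZeta (b + x)‖) (Ioi 0)) :
    rayDifference a b =
      ((∫ x in Ioi (0 : ℝ), Real.cos (a * x) * Real.log ‖riemannZeta (b + x)‖ : ℝ) +
        (∫ x in Ioi (0 : ℝ), Real.sin (a * x) * Real.log ‖riemannZeta (b + x)‖ : ℝ) * Complex.I -
        Real.pi / a * (Complex.exp ((a * (1 - b) : ℝ) * Complex.I) - 1)) -
      Complex.I * ((∫ t in Ioi (0 : ℝ),
          Real.exp (-a * t) * Real.log ‖riemannZeta (b + t * Complex.I)‖ : ℝ) +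
        (∫ t in Ioi (0 : ℝ), Real.exp (-a * t) * zetaArg (b + t * Complex.I) : ℝ) * Complex.I) := by
  rw [rayDifference]
  congr 1
  · rw [← integral_exp_mul_ite ha.ne' hb1]
    simp_rw [mul_sub]
    rw [integral_sub (integrableOn_exp_mul_log hb hb1) (integrableOn_exp_mul_ite a b),
      ← integral_complex_ofReal, ← integral_complex_ofReal, ← integral_mul_const,
      ← integral_add h₄.ofReal (h₂.ofReal.mul_const _)]
    congr 1
    refine integral_congr_ae (Eventually.of_forall fun x => ?_)
    beta_reduce
    rw [show Complex.I * a * x = ((a * x : ℝ) : ℂ) * Complex.I by push_cast; ring,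
      Complex.exp_mul_I, ← Complex.ofReal_cos, ← Complex.ofReal_sin, Complex.ofReal_mul,
      Complex.ofReal_mul (Real.sin _)]
    ring
  · rw [← integral_complex_ofReal, ← integral_complex_ofReal, ← integral_mul_const,
      ← integral_add h₁.ofReal (h₃.ofReal.mul_const _)]
    congr 1
    refine integral_congr_ae (Eventually.of_forall fun t => ?_)
    beta_reduce
    rw [zetaLog]
    push_cast
    ring

/-! ### Signs of the contributions and the equivalences -/

lemma zeroJump_of_re_le {a : ℝ} {w : ℂ} (hw : w.re ≤ 0) : zeroJump a w = 0 := by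
  simp [zeroJump, max_eq_right hw]

lemma zeroJump_eq (a : ℝ) (w : ℂ) : zeroJump a w =
    ((2 * Real.pi / a * Real.exp (-a * w.im) * (1 - Real.cos (a * max w.re 0)) : ℝ) : ℂ) -
    ((2 * Real.pi / a * Real.exp (-a * w.im) * Real.sin (a * max w.re 0) : ℝ) : ℂ) * Complex.I := by
  rw [zeroJump, show Complex.I * a * (max w.re 0 : ℝ) = ((a * max w.re 0 : ℝ) : ℂ) * Complex.I by
    push_cast; ring, Complex.exp_mul_I, ← Complex.ofReal_cos, ← Complex.ofReal_sin]
  push_cast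
  ring

/-- Conjugation reflects a zero from the lower half plane, and `ζ` has no positive real zero. The
contour in the first quadrant thus misses nothing. -/
lemma exists_zero_im_pos {b : ℝ} (hb : 0 < b) (h : ¬ ∀ s : ℂ, b < s.re → riemannZeta s ≠ 0) :
    ∃ ρ : ℂ, riemannZeta₁ ρ = 0 ∧ b < ρ.re ∧ 0 < ρ.im := by
  push Not at h
  obtain ⟨s, hs, hs0⟩ := h
  have hz : riemannZeta₁ s = 0 := by
    by_contra h'
    exact (riemannZeta₁_ne_zero_iff s).1 h' hs0
  rcases lt_trichotomy s.im 0 with him | him | him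
  · exact ⟨(starRingEnd ℂ) s, by rw [riemannZeta₁_conj, hz, map_zero], by simpa, by simpa⟩
  · refine absurd hz ?_
    have : s = (s.re : ℂ) := Complex.ext (by simp) (by simp [him])
    rw [this]
    exact riemannZeta₁_ofReal_ne_zero (hb.trans hs)
  · exact ⟨s, hz, hs, him⟩

/-- A real linear functional for which every zero to the right of the line contributes positively
detects the absence of such zeros. -/
lemma apply_rayDifference_eq_zero_iff {a b : ℝ} (ha : 0 < a) (hb : 1 / 2 ≤ b) (hb1 : b < 1)
    (L : ℂ →L[ℝ] ℝ)
    (hL : ∀ w : ℂ, 0 < w.re → w.re < 1 - b → 0 < L (zeroJump a w)) :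
    L (rayDifference a b) = 0 ↔ ∀ s : ℂ, b < s.re → riemannZeta s ≠ 0 := by
  obtain ⟨n, w, T, hT, hz, hmem, hlim⟩ := exists_tendsto_rayDifference ha hb hb1
  have hre1 : ∀ s : ℂ, riemannZeta₁ s = 0 → s.re < 1 := by
    intro s hs
    by_contra h
    exact riemannZeta₁_ne_zero_of_one_le_re (not_lt.1 h) hs
  have hLlim := (L.continuous.tendsto _).comp hlim
  simp only [Function.comp_def, map_sum] at hLlim
  constructor
  · intro h0
    by_contra hcon
    obtain ⟨ρ, hρ, hbρ, him⟩ := exists_zero_im_pos (by linarith) hcon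
    have hpos := hL (ρ - b) (by simpa using hbρ) (by simpa using hre1 ρ hρ)
    have hnonneg : ∀ k i, 0 ≤ L (if 0 < (w k i).im ∧ (w k i).im < T k then
        zeroJump a (w k i - b) else 0) := by
      intro k i
      split_ifs
      · rcases le_or_gt (w k i - b : ℂ).re 0 with h | h
        · rw [zeroJump_of_re_le h, map_zero]
        · exact (hL _ h (by simpa using hre1 _ (hz k i))).le
      · simp
    -- All terms being nonnegative, once the rectangle is high enough every sum is at least the
    -- contribution of `ρ`, and so is the limit. Convergence of a sum over all zeros is never
    -- needed.
    have hge := ge_of_tendsto hLlim (b := L (zeroJump a (ρ - b))) (by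
      filter_upwards [eventually_ge_atTop ⌈ρ.im⌉₊] with k hk
      have hTk : ρ.im < T k :=
        (Nat.le_ceil _).trans_lt ((Nat.cast_le.2 hk).trans_lt (hT k))
      obtain ⟨i, hi⟩ := hmem k ρ hρ hbρ him hTk
      have := Finset.single_le_sum (fun j _ => hnonneg k j) (Finset.mem_univ i)
      rwa [hi, if_pos ⟨him, hTk⟩] at this)
    linarith
  · intro hno
    have hzero : ∀ k, ∑ i, L (if 0 < (w k i).im ∧ (w k i).im < T k then
        zeroJump a (w k i - b) else 0) = 0 := by
      intro k
      refine Finset.sum_eq_zero fun i _ => ?_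
      have hle : (w k i - b : ℂ).re ≤ 0 := by
        by_contra h
        have : b < (w k i).re := by simpa using h
        exact (riemannZeta₁_ne_zero_iff _).2 (hno _ this) (hz k i)
      rw [zeroJump_of_re_le hle]
      simp
    simp_rw [hzero] at hLlim
    exact (tendsto_nhds_unique hLlim tendsto_const_nhds)

/-- The left side of the modulus equality is minus the imaginary part of `rayDifference`, that of
the argument equality its real part. Accordingly the detecting functionals are `-Im` and `Re`. -/
lemma integrals_and_equivalences {a b : ℝ} (ha : 0 < a) (hb : 1 / 2 ≤ b) (hb1 : b < 1) :
    (IntegrableOn (fun t : ℝ =>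
        Real.exp (-a * t) * Real.log ‖riemannZeta (b + t * Complex.I)‖) (Ioi 0) ∧
      IntegrableOn (fun x : ℝ => Real.sin (a * x) * Real.log ‖riemannZeta (b + x)‖) (Ioi 0) ∧
      IntegrableOn (fun t : ℝ => Real.exp (-a * t) * zetaArg (b + t * Complex.I)) (Ioi 0) ∧
      IntegrableOn (fun x : ℝ => Real.cos (a * x) * Real.log ‖riemannZeta (b + x)‖) (Ioi 0)) ∧
    (a * (1 - b) ≤ Real.pi →
      (LogModulusEquality a b ↔ ∀ s : ℂ, b < s.re → riemannZeta s ≠ 0)) ∧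
    (a * (1 - b) ≤ 2 * Real.pi →
      (ArgumentEquality a b ↔ ∀ s : ℂ, b < s.re → riemannZeta s ≠ 0)) := by
  have hv := integrableOn_exp_mul_zetaLog ha hb hb1
  have hh := integrableOn_log_riemannZeta_horizontal hb hb1
  have h₁ : IntegrableOn (fun t : ℝ =>
      Real.exp (-a * t) * Real.log ‖riemannZeta (b + t * Complex.I)‖) (Ioi 0) := by
    refine hv.re.congr (Eventually.of_forall fun t => ?_)
    simp [zetaLog, -Complex.ofReal_exp]
  have h₃ : IntegrableOn (fun t : ℝ => Real.exp (-a * t) * zetaArg (b + t * Complex.I)) (Ioi 0) := by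
    refine hv.im.congr (Eventually.of_forall fun t => ?_)
    simp [zetaLog, -Complex.ofReal_exp]
  have h₂ : IntegrableOn (fun x : ℝ => Real.sin (a * x) * Real.log ‖riemannZeta (b + x)‖)
      (Ioi 0) :=
    hh.bdd_mul (c := 1) (by fun_prop) (Eventually.of_forall fun x => Real.abs_sin_le_one _)
  have h₄ : IntegrableOn (fun x : ℝ => Real.cos (a * x) * Real.log ‖riemannZeta (b + x)‖)
      (Ioi 0) :=
    hh.bdd_mul (c := 1) (by fun_prop) (Eventually.of_forall fun x => Real.abs_cos_le_one _)
  have hJ := rayDifference_eq ha hb hb1 h₁ h₂ h₃ h₄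
  have hpi := Real.pi_pos
  have hexp : Complex.exp ((a * (1 - b) : ℝ) * Complex.I) =
      (Real.cos (a * (1 - b)) : ℂ) + (Real.sin (a * (1 - b)) : ℂ) * Complex.I := by
    rw [Complex.exp_mul_I, Complex.ofReal_cos, Complex.ofReal_sin]
  have hpa : (Real.pi / a : ℂ) = ((Real.pi / a : ℝ) : ℂ) := by push_cast; rfl
  rw [hexp, hpa] at hJ
  refine ⟨⟨h₁, h₂, h₃, h₄⟩, fun hab => ?_, fun hab => ?_⟩
  · rw [← apply_rayDifference_eq_zero_iff ha hb hb1 (-Complex.imCLM) ?_]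
    · rw [hJ, LogModulusEquality, ← neg_eq_zero (a := (-Complex.imCLM) _)]
      simp [-Complex.ofReal_cos, -Complex.ofReal_sin, -Complex.ofReal_div]
      constructor <;> intro h <;> linarith
    · intro w h0 h1
      rw [zeroJump_eq, max_eq_left h0.le]
      -- Here `0 < a Re w < a(1 - b) ≤ π`. The strict middle inequality, from `Re ρ < 1`, is what
      -- admits the endpoint `a(1 - b) = π`.
      have hs : 0 < Real.sin (a * w.re) :=
        Real.sin_pos_of_pos_of_lt_pi (by positivity) (lt_of_lt_of_le (by gcongr) hab)
      have : 0 < 2 * Real.pi / a * Real.exp (-a * w.im) * Real.sin (a * w.re) := by positivity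
      simpa [-Complex.ofReal_mul, -Complex.ofReal_div] using this
  · rw [← apply_rayDifference_eq_zero_iff ha hb hb1 Complex.reCLM ?_]
    · rw [hJ, ArgumentEquality]
      simp [-Complex.ofReal_cos, -Complex.ofReal_sin, -Complex.ofReal_div]
      constructor <;> intro h <;> linarith
    · intro w h0 h1
      rw [zeroJump_eq, max_eq_left h0.le]
      -- Only the value `1` must be avoided, so `a Re w` may range over all of `(0, 2π)`; this is
      -- why the admissible range of `a` doubles.
      have hc : Real.cos (a * w.re) < 1 := by
        refine lt_of_le_of_ne (Real.cos_le_one _) fun h => ?_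
        have hpos : 0 < a * w.re := by positivity
        rw [Real.cos_eq_one_iff_of_lt_of_lt (by linarith) (lt_of_lt_of_le (by gcongr) hab)] at h
        linarith
      have : 0 < 2 * Real.pi / a * Real.exp (-a * w.im) * (1 - Real.cos (a * w.re)) := by
        have : 0 < 1 - Real.cos (a * w.re) := by linarith
        positivity
      simpa [-Complex.ofReal_mul, -Complex.ofReal_div] using this

end

theorem theorem2 :
    (∀ a b : ℝ, 0 < a → 1 / 2 ≤ b → b < 1 →
      -- all the integrals converge absolutely
      (IntegrableOn (fun t : ℝ =>
          Real.exp (-a * t) * Real.log ‖riemannZeta (b + t * Complex.I)‖) (Ioi 0) ∧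
        IntegrableOn (fun x : ℝ =>
          Real.sin (a * x) * Real.log ‖riemannZeta (b + x)‖) (Ioi 0) ∧
        IntegrableOn (fun t : ℝ =>
          Real.exp (-a * t) * zetaArg (b + t * Complex.I)) (Ioi 0) ∧
        IntegrableOn (fun x : ℝ =>
          Real.cos (a * x) * Real.log ‖riemannZeta (b + x)‖) (Ioi 0)) ∧
      (a * (1 - b) ≤ Real.pi →
        (LogModulusEquality a b ↔ ∀ s : ℂ, b < s.re → riemannZeta s ≠ 0)) ∧
      (a * (1 - b) ≤ 2 * Real.pi →
        (ArgumentEquality a b ↔ ∀ s : ℂ, b < s.re → riemannZeta s ≠ 0))) ∧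
    -- the case `b = 1/2`
    (∀ a : ℝ, 0 < a → a * (1 - 1 / 2) ≤ Real.pi →
      (LogModulusEquality a (1 / 2) ↔ RiemannHypothesis)) ∧
    (∀ a : ℝ, 0 < a → a * (1 - 1 / 2) ≤ 2 * Real.pi →
      (ArgumentEquality a (1 / 2) ↔ RiemannHypothesis)) ∧
    -- `a = 2π`, `b = 1/2` in the first equality
    ((∫ t in Ioi (0 : ℝ), Real.exp (-2 * Real.pi * t) *
          Real.log ‖riemannZeta (1 / 2 + t * Complex.I)‖)
        - (∫ x in Ioi (0 : ℝ), Real.sin (2 * Real.pi * x) *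
          Real.log ‖riemannZeta (1 / 2 + x)‖) = 0 ↔ RiemannHypothesis) ∧
    -- `a = π`, `b = 1/2` in the second equality
    ((∫ t in Ioi (0 : ℝ), Real.exp (-Real.pi * t) * zetaArg (1 / 2 + t * Complex.I))
        + (∫ x in Ioi (0 : ℝ), Real.cos (Real.pi * x) *
          Real.log ‖riemannZeta (1 / 2 + x)‖) + 1 = 0 ↔ RiemannHypothesis) := by
  have main := fun a b (ha : 0 < a) (hb : 1 / 2 ≤ b) (hb1 : b < 1) =>
    integrals_and_equivalences ha hb hb1
  have hlog : ∀ a : ℝ, 0 < a → a * (1 - 1 / 2) ≤ Real.pi →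
      (LogModulusEquality a (1 / 2) ↔ RiemannHypothesis) := fun a ha h => by
    rw [riemannHypothesis_iff_half]
    exact (main a (1 / 2) ha le_rfl (by norm_num)).2.1 h
  have harg : ∀ a : ℝ, 0 < a → a * (1 - 1 / 2) ≤ 2 * Real.pi →
      (ArgumentEquality a (1 / 2) ↔ RiemannHypothesis) := fun a ha h => by
    rw [riemannHypothesis_iff_half]
    exact (main a (1 / 2) ha le_rfl (by norm_num)).2.2 h
  have hpi := Real.pi_pos
  refine ⟨main, hlog, harg, ?_, ?_⟩
  · rw [← hlog (2 * Real.pi) (by positivity) (by linarith), LogModulusEquality]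
    have e : Real.sin (2 * Real.pi * (1 - 1 / 2)) = 0 := by
      rw [show 2 * Real.pi * (1 - 1 / 2) = Real.pi by ring, Real.sin_pi]
    rw [e, mul_zero, add_zero]
    push_cast
    simp only [neg_mul]
  · rw [← harg Real.pi hpi (by linarith), ArgumentEquality]
    have e : Real.cos (Real.pi * (1 - 1 / 2)) = 0 := by
      rw [show Real.pi * (1 - 1 / 2) = Real.pi / 2 by ring, Real.cos_pi_div_two]
    rw [e, sub_zero, mul_one, div_self hpi.ne']
    push_cast
    rfl
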